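/- **Setting.** Let $q\in\mathbb C^*$ not be a root of unity, fix a square root $q^{1/2}$, let $2s\in\mathbb Z_{\ge0}$, and let $\mathsf b,\mathsf c,\mathsf b^*,\mathsf c^*,\zeta,\chi\in\mathbb C^*$ with $\mathsf b\mathsf c=\mathsf b^*\mathsf c^*$. Put $\theta_M=\mathsf bq^{2M}+\mathsf cq^{-2M}$, $\theta^*_N=\mathsf b^*q^{2N}+\mathsf c^*q^{-2N}$, and assume (genericity) that $\theta_{-1},\theta_0,\dots,\theta_{2s+1}$ are pairwise distinct, and so are $\theta^*_{-1},\theta^*_0,\dots,\theta^*_{2s+1}$. Write $b(x)=x-x^{-1}$, $[X,Y]_q=qXY-q^{-1}YX$, $[n]_q=\frac{q^n-q^{-n}}{q-q^{-1}}$, $Z=\zeta^2+\zeta^{-2}$, $\Sigma=\mathsf bq^{2s}+\mathsf cq^{-2s}$, $\Sigma^*=\mathsf b^*q^{2s}+\mathsf c^*q^{-2s}$, $\kappa=q^{2s+1}+q^{-2s-1}$. The Askey–Wilson algebra is generated by $\mathsf A,\mathsf A^*$ with relations $$[\mathsf A,[\mathsf A,\mathsf A^*]_q]_{q^{-1}}=\rho\mathsf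 A^*+\omega\mathsf A+\eta,\qquad [\mathsf A^*,[\mathsf A^*,\mathsf A]_q]_{q^{-1}}=\rho\mathsf A+\omega\mathsf A^*+\eta^*,$$ where $\rho=-\mathsf b\mathsf c(q^2-q^{-2})^2$, $\omega=(q-q^{-1})^2(\mathsf b\mathsf cZ\kappa-\Sigma\Sigma^*)$, $\eta=-\frac{(q^2-q^{-2})^2}{q+q^{-1}}\mathsf b\mathsf c(\Sigma Z-\Sigma^*\kappa)$, $\eta^*=-\frac{(q^2-q^{-2})^2}{q+q^{-1}}\mathsf b^*\mathsf c^*(\Sigma^*Z-\Sigma\kappa)$. Let $\pi$ be an irreducible representation of it on a complex vector space $\mathcal V$ of dimension $2s+1$ with bases $\{|\theta_M\rangle\}_{M=0}^{2s}$, $\{|\theta^*_N\rangle\}_{N=0}^{2s}$ such that $\pi(\mathsf A)|\theta_M\rangle=\theta_M|\theta_M\rangle$ and $\pi(\mathsf A^*)|\theta^*_N\rangle=\theta^*_N|\theta^*_N\rangle$, normalized so that for $1\le M\le2s$ the coefficient of $|\theta_M\rangle$ in $\pi(\mathsf A^*)|\theta_{M-1}\rangle$ is $$A^*_{M,M-1}=q^{2-4s}\frac{(1-q^{2M})(\mathsf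 c-\mathsf bq^{2M+4s})(\mathsf b^*q^{2s-1}\zeta^{-2}+\mathsf bq^{2M-2})(\mathsf cq^{2s-1}\zeta^2+\mathsf c^*q^{2M-2})}{(\mathsf c-\mathsf bq^{4M-2})(\mathsf c-\mathsf bq^{4M})},$$ and for $1\le N\le 2s$ the coefficient of $|\theta^*_N\rangle$ in $\pi(\mathsf A)|\theta^*_{N-1}\rangle$ is $A_{N,N-1}$, obtained from $A^*_{N,N-1}$ by exchanging $(\mathsf b,\mathsf c,\zeta)\leftrightarrow(\mathsf b^*,\mathsf c^*,\zeta^{-1})$. Let $\langle\theta_M|$, $\langle\theta^*_N|$ be nonzero linear forms with $\langle\theta_M|\pi(\mathsf A)=\theta_M\langle\theta_M|$ and $\langle\theta^*_N|\pi(\mathsf A^*)=\theta^*_N\langle\theta^*_N|$. Let $P$ be the transition matrix, $|\theta^*_N\rangle=\sum_MP_{MN}|\theta_M\rangle$, $|\theta_M\rangle=\sum_N(P^{-1})_{NM}|\theta^*_N\rangle$. Put $|\Omega^-\rangle=|\theta_0\rangle$, $|\Omega^+\rangle=|\theta_0^*\rangle$, $\langle\Omega^-|=\langle\theta_0|$,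 $\langle\Omega^+|=\langle\theta_0^*|$. For $0\le M,N\le 2s$ let $$R_M(\theta^*_N)={}_4\phi_3\!\left[{q^{-2M},\ \tfrac{\mathsf b}{\mathsf c}q^{2M},\ q^{-2N},\ \tfrac{\mathsf b^*}{\mathsf c^*}q^{2N}\atop -\tfrac{\mathsf b}{\mathsf c^*}q^{2s+1}\zeta^2,\ -\tfrac{\mathsf b^*}{\mathsf c}q^{2s+1}\zeta^{-2},\ q^{-4s}};q^2,q^2\right].$$ **Dynamical operators and Bethe states.** With $\bar\eta(u)=(q+q^{-1})\rho^{-1}(\eta u+\eta^*u^{-1})$ set $$K_{11}(u)=b(u^2)(qu\mathsf A-q^{-1}u^{-1}\mathsf A^*)-\bar\eta(u),\qquad K_{22}(u)=b(u^2)(qu\mathsf A^*-q^{-1}u^{-1}\mathsf A)-\bar\eta(u^{-1}),$$ $$K_{12}(u)=\chi b(u^2)\Big(\rho^{-1}\big([\mathsf A^*,\mathsf A]_q+\tfrac{\omega}{q-q^{-1}}\big)+\tfrac{qu^2+q^{-1}u^{-2}}{q^2-q^{-2}}\Big),\quad K_{21}(u)=\rho\chi^{-1}b(u^2)\Big(\rho^{-1}\big([\mathsf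 A,\mathsf A^*]_q+\tfrac{\omega}{q-q^{-1}}\big)+\tfrac{qu^2+q^{-1}u^{-2}}{q^2-q^{-2}}\Big).$$ For $\epsilon=\pm1$ and $\alpha,\beta\in\mathbb C$ put $\gamma^\epsilon(x,m)=\alpha^{\frac{1-\epsilon}2}\beta^{\frac{1+\epsilon}2}q^{-m}x-\alpha^{\frac{1+\epsilon}2}\beta^{\frac{1-\epsilon}2}q^mx^{-1}$, $G^\epsilon_t(u)=tu^{-\epsilon}K_{11}(u)+K_{12}(u)-t^2K_{21}(u)-tu^\epsilon K_{22}(u)$ and $$\mathscr B^\epsilon(u,m)=\frac{-\epsilon q^{-\epsilon}u^{-\epsilon}}{\gamma^\epsilon(1,m+1)}G^\epsilon_{\beta q^{-\epsilon m}}(u),\qquad \mathscr C^\epsilon(u,m)=\frac{\epsilon q^{-\epsilon}u^{-\epsilon}}{\gamma^\epsilon(1,m-1)}G^\epsilon_{\alpha q^{\epsilon m}}(u).$$ Fix $m_0\in\mathbb Z$. Define $$|\Psi^M_\epsilon(\bar u,m_0)\rangle=\pi\big(\mathscr B^\epsilon(u_1,m_0+2(M-1))\cdots\mathscr B^\epsilon(u_M,m_0)\big)|\Omega^\epsilon\rangle$$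 with $\beta=0$ and $(q^2-q^{-2})\chi^{-1}\alpha\mathsf bq^{-m_0}=-1$ if $\epsilon=-$, $(q^2-q^{-2})\chi^{-1}\alpha\mathsf c^*q^{m_0}=1$ if $\epsilon=+$; and $$\langle\Psi^N_-(\bar v,m_0)|=\langle\Omega^-|\pi\big(\mathscr C^-(v_1,m_0+2)\cdots\mathscr C^-(v_N,m_0+2N)\big)$$ with $\alpha=0$ and $(q^2-q^{-2})\chi^{-1}\beta\mathsf cq^{m_0-2}=-1$. **Bethe equations.** Let $f(u,v)=\frac{b(qv/u)b(uv)}{b(v/u)b(quv)}$, $h(u,v)=\frac{b(q^2uv)b(qu/v)}{b(quv)b(u/v)}$, $$\Lambda_1^\epsilon(u)=\frac{q^{-2s-1}}{u^\epsilon}(q^{2s+1}u\zeta^{-1}-u^{-1}\zeta)(q^{2s+1}u\zeta-u^{-1}\zeta^{-1})(u\mathsf c^*q^{-2s}+u^{-1}\mathsf bq^{2s})\Big(u(\tfrac{\mathsf c}{\mathsf c^*})^{\frac{1-\epsilon}2}+u^{-1}(\tfrac{\mathsf b^*}{\mathsf b})^{\frac{1+\epsilon}2}\Big),$$ $$\Lambda_2^\epsilon(u)=\frac{b(u^2)q^{-2s-1}}{u^\epsilon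 b(qu^2)}(q^{2s-1}u^{-1}\zeta-u\zeta^{-1})(q^{2s-1}u^{-1}\zeta^{-1}-u\zeta)(q^2u\mathsf bq^{2s}+u^{-1}\mathsf c^*q^{-2s})\Big(q^2u(\tfrac{\mathsf b^*}{\mathsf b})^{\frac{1+\epsilon}2}+u^{-1}(\tfrac{\mathsf c}{\mathsf c^*})^{\frac{1-\epsilon}2}\Big).$$ All sets $\bar u$ of Bethe roots below are nontrivial and admissible: $u_i\ne0$, $b(u_i^2)\ne0$, $b(qu_i^2)\neq0$, and the numbers $(qu_i^2+q^{-1}u_i^{-2})/(q+q^{-1})$ are pairwise distinct. Put $\sigma(\bar u)=\sum_{j}(qu_j^2+q^{-1}u_j^{-2})$ and, for $2s$ roots, $F_i(\bar u)=\frac{b(u_i^2)}{b(q)}\frac{\prod_{k=0}^{2s}b(q^{1/2+k-s}\zeta u_i)b(q^{1/2+k-s}\zeta^{-1}u_i)}{\prod_{j\ne i}b(u_iu_j^{-1})b(qu_iu_j)}$. * $S_-^{M(h)}$: any set $\{u_1,\dots,u_M\}$ with, for all $i$, $-\frac{b(u_i^2)}{b(qu_i^2)}\prod_{j\ne i}f(u_i,u_j)\Lambda_1^-(u_i)+\prod_{j\ne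 i}h(u_i,u_j)\Lambda_2^-(u_i)=0$. * $S_+^{M(i)}$ (resp. $S_-^{*N(i)}$): any set of $2s$ roots with, for all $i$ and for the upper (resp. lower) sign, $$\frac{b(u_i^2)}{b(qu_i^2)}u_i^{\pm1}\prod_{j\ne i}f(u_i,u_j)\Lambda_1^{\pm}(u_i)-(q^2u_i^3)^{\mp1}\prod_{j\ne i}h(u_i,u_j)\Lambda_2^\pm(u_i)+\nu_\pm u_i^{\mp2}F_i(\bar u)=0,$$ $\nu_+=q^{-1-4s}\mathsf c^*$, $\nu_-=q^{1+4s}\mathsf b$, and with $\theta_M=q^{-4s}(\mathsf c^*Z[2s]_q+q^{2s}\Sigma-q\mathsf c^*\sigma(\bar u))$ (resp. $\theta^*_N=q^{4s}(\mathsf bZ[2s]_q+q^{-2s}\Sigma^*-q^{-1}\mathsf b\sigma(\bar u))$). * $dS_-^{*N(i)}$: any set of $2s$ roots with, for all $i$, $$\frac{b(y_i^2)}{b(qy_i^2)}y_i\prod_{j\ne i}f(y_i,y_j)\Lambda_1^-(y_i)-(q^2y_i^3)^{-1}\prod_{j\ne i}h(y_i,y_j)\Lambda_2^-(y_i)+q^{-1-4s}\mathsf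 c\,F_i(\bar y)=0$$ and $\theta_N^*=q^{-4s}(\mathsf cZ[2s]_q+q^{2s}\Sigma^*-q\mathsf c\,\sigma(\bar y))$. (That such sets exist for all $0\le M,N\le2s$ is part of the Hypotheses 1–3 under which the formulas are stated.) **Claim.** Let $0\le M,N\le 2s$, and let $$\mathcal N^{(i)}_M(\bar u)=(P^{-1})_{2s,M}\prod_{k=1}^{2s}\big(-q^{-1}u_k^{-1}b(u_k^2)A_{k,k-1}\big)^{-1},\qquad \mathcal N^{*(i)}_N(\bar w)=P_{2s,N}\prod_{k=1}^{2s}\big(qw_kb(w_k^2)A^*_{k,k-1}\big)^{-1}.$$ 1. For all sets $\bar v=S_-^{M(h)}$, $\bar w=S_-^{*N(i)}$, $\bar u=S_+^{M(i)}$, all denominators are nonzero and $$R_M(\theta^*_N)=\mathcal N_M^{(i)}(\bar u)^{-1}\,\frac{\langle\Psi_-^M(\bar v,m_0)|\Psi_-^{2s}(\bar w,m_0)\rangle}{\langle\Omega^-|\Psi_-^{2s}(\bar w,m_0)\rangle}\,\frac{\langle\Omega^-|\Omega^-\rangle}{\langle\Psi_-^M(\bar v,m_0)|\Psi_+^{2s}(\bar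 u,m_0)\rangle}.$$ 2. For all sets $\bar u=S_+^{M(i)}$, $\bar y=S_-^{*N(i)}$, $\bar y'=dS_-^{*N(i)}$, all denominators are nonzero and $$R_M(\theta^*_N)=\mathcal N_N^{*(i)}(\bar y)^{-1}\,\frac{\langle\Psi_-^{2s}(\bar y',m_0)|\Psi_+^{2s}(\bar u,m_0)\rangle}{\langle\Omega^+|\Psi_+^{2s}(\bar u,m_0)\rangle}\,\frac{\langle\Omega^+|\Omega^+\rangle}{\langle\Psi_-^{2s}(\bar y',m_0)|\Psi_-^{2s}(\bar y,m_0)\rangle}.$$ -/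

import Mathlib

/-! Scalars, the Askey-Wilson algebra, its dynamical operators, Bethe states and Bethe equations. -/

noncomputable section

namespace QRacah

/-- `b(x) = x - x⁻¹`. -/
def bf (x : ℂ) : ℂ := x - x⁻¹

/-- The `q`-shifted factorial `(a; Q)_k`. -/
def qPoch (a Q : ℂ) (k : ℕ) : ℂ := ∏ j ∈ Finset.range k, (1 - a * Q ^ j)

/-- The basic hypergeometric series `₄φ₃(a₁, a₂, a₃, a₄; b₁, b₂, b₃; Q, z)`. -/
def fourPhiThree (a₁ a₂ a₃ a₄ b₁ b₂ b₃ Q z : ℂ) : ℂ :=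
  ∑' k : ℕ, (qPoch a₁ Q k * qPoch a₂ Q k * qPoch a₃ Q k * qPoch a₄ Q k) /
    (qPoch b₁ Q k * qPoch b₂ Q k * qPoch b₃ Q k * qPoch Q Q k) * z ^ k

/-- The `q`-commutator `[x, y]_q = q x y - q⁻¹ y x`. -/
def qComm {R : Type*} [Ring R] [Algebra ℂ R] (q : ℂ) (x y : R) : R :=
  q • (x * y) - q⁻¹ • (y * x)

/-- The scalar data: `n = 2s`, `p = q^{1/2}`, the parameters `𝖻, 𝖼, 𝖻*, 𝖼*` of the two eigenvalue
sequences, `ζ`, and the free scalar `χ` that normalizes the off-diagonal entries of the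
K-operator. -/
structure Params where
  n : ℕ
  p : ℂ
  b : ℂ
  c : ℂ
  bs : ℂ
  cs : ℂ
  ζ : ℂ
  χ : ℂ

namespace Params

variable (P : Params)

def q : ℂ := P.p ^ 2

/-- `θ_M = 𝖻 q^{2M} + 𝖼 q^{-2M}`. -/
def θ (M : ℕ) : ℂ := P.b * P.q ^ (2 * (M : ℤ)) + P.c * P.q ^ (-2 * (M : ℤ))

/-- `θ*_N = 𝖻* q^{2N} + 𝖼* q^{-2N}`. -/
def θs (N : ℕ) : ℂ := P.bs * P.q ^ (2 * (N : ℤ)) + P.cs * P.q ^ (-2 * (N : ℤ))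

/-- Genericity: `q` is not a root of unity, no parameter vanishes, `𝖻𝖼 = 𝖻*𝖼*` (the two values of
the structure constant `ρ` agree), and, by the last two clauses, each of the sequences
`θ_{-1}, θ_0, …, θ_{2s+1}` and `θ*_{-1}, θ*_0, …, θ*_{2s+1}` has pairwise distinct terms. -/
structure IsGeneric : Prop where
  p_ne : P.p ≠ 0
  q_pow : ∀ k : ℕ, 0 < k → P.q ^ k ≠ 1
  b_ne : P.b ≠ 0
  c_ne : P.c ≠ 0
  bs_ne : P.bs ≠ 0
  cs_ne : P.cs ≠ 0
  ζ_ne : P.ζ ≠ 0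
  χ_ne : P.χ ≠ 0
  bc_eq : P.b * P.c = P.bs * P.cs
  c_ne_b : ∀ k : ℤ, -1 ≤ k → k ≤ 2 * (P.n : ℤ) + 1 → P.c ≠ P.b * P.q ^ (2 * k)
  cs_ne_bs : ∀ k : ℤ, -1 ≤ k → k ≤ 2 * (P.n : ℤ) + 1 → P.cs ≠ P.bs * P.q ^ (2 * k)

/-- The exchange `(𝖻, 𝖼, ζ) ↔ (𝖻*, 𝖼*, ζ⁻¹)`. -/
def swap : Params :=
  { n := P.n, p := P.p, b := P.bs, c := P.cs, bs := P.b, cs := P.c, ζ := P.ζ⁻¹, χ := P.χ }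

/-! ### The Askey-Wilson algebra -/

def ρ : ℂ := -(P.b * P.c) * (P.q ^ 2 - P.q⁻¹ ^ 2) ^ 2

def ω : ℂ :=
  (P.q - P.q⁻¹) ^ 2 *
    (P.b * P.c * (P.ζ ^ 2 + P.ζ⁻¹ ^ 2) * (P.q ^ ((P.n : ℤ) + 1) + P.q ^ (-(P.n : ℤ) - 1)) -
      (P.b * P.q ^ (P.n : ℤ) + P.c * P.q ^ (-(P.n : ℤ))) *
        (P.bs * P.q ^ (P.n : ℤ) + P.cs * P.q ^ (-(P.n : ℤ))))

def η : ℂ :=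
  -((P.q ^ 2 - P.q⁻¹ ^ 2) ^ 2 / (P.q + P.q⁻¹)) * (P.b * P.c) *
    ((P.b * P.q ^ (P.n : ℤ) + P.c * P.q ^ (-(P.n : ℤ))) * (P.ζ ^ 2 + P.ζ⁻¹ ^ 2) -
      (P.bs * P.q ^ (P.n : ℤ) + P.cs * P.q ^ (-(P.n : ℤ))) *
        (P.q ^ ((P.n : ℤ) + 1) + P.q ^ (-(P.n : ℤ) - 1)))

def ηs : ℂ :=
  -((P.q ^ 2 - P.q⁻¹ ^ 2) ^ 2 / (P.q + P.q⁻¹)) * (P.bs * P.cs) *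
    ((P.bs * P.q ^ (P.n : ℤ) + P.cs * P.q ^ (-(P.n : ℤ))) * (P.ζ ^ 2 + P.ζ⁻¹ ^ 2) -
      (P.b * P.q ^ (P.n : ℤ) + P.c * P.q ^ (-(P.n : ℤ))) *
        (P.q ^ ((P.n : ℤ) + 1) + P.q ^ (-(P.n : ℤ) - 1)))

/-- The defining relations of the Askey-Wilson algebra; `FreeAlgebra.ι ℂ 0` is `𝖠` and
`FreeAlgebra.ι ℂ 1` is `𝖠*`. -/
inductive AWRel : FreeAlgebra ℂ (Fin 2) → FreeAlgebra ℂ (Fin 2) → Prop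
  | aw1 : AWRel
      (qComm P.q⁻¹ (FreeAlgebra.ι ℂ 0) (qComm P.q (FreeAlgebra.ι ℂ 0) (FreeAlgebra.ι ℂ 1)))
      (P.ρ • FreeAlgebra.ι ℂ 1 + P.ω • FreeAlgebra.ι ℂ 0 + P.η • 1)
  | aw2 : AWRel
      (qComm P.q⁻¹ (FreeAlgebra.ι ℂ 1) (qComm P.q (FreeAlgebra.ι ℂ 1) (FreeAlgebra.ι ℂ 0)))
      (P.ρ • FreeAlgebra.ι ℂ 0 + P.ω • FreeAlgebra.ι ℂ 1 + P.ηs • 1)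

/-- The Askey-Wilson algebra. -/
abbrev AW : Type := RingQuot P.AWRel

def genA : P.AW := RingQuot.mkAlgHom ℂ P.AWRel (FreeAlgebra.ι ℂ 0)

def genAs : P.AW := RingQuot.mkAlgHom ℂ P.AWRel (FreeAlgebra.ι ℂ 1)

/-! ### The dynamical operators

`K11, K12, K21, K22` are the entries of the K-operator which presents the Askey-Wilson algebra as a
reflection algebra. -/

def etaBar (u : ℂ) : ℂ := (P.q + P.q⁻¹) * P.ρ⁻¹ * (P.η * u + P.ηs * u⁻¹)

def K11 (u : ℂ) : P.AW :=
  bf (u ^ 2) • ((P.q * u) • P.genA - (P.q⁻¹ * u⁻¹) • P.genAs) - P.etaBar u • 1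

def K12 (u : ℂ) : P.AW :=
  (P.χ * bf (u ^ 2)) •
    (P.ρ⁻¹ • (qComm P.q P.genAs P.genA + (P.ω / (P.q - P.q⁻¹)) • 1) +
      ((P.q * u ^ 2 + P.q⁻¹ * u⁻¹ ^ 2) / (P.q ^ 2 - P.q⁻¹ ^ 2)) • 1)

def K21 (u : ℂ) : P.AW :=
  (P.ρ * P.χ⁻¹ * bf (u ^ 2)) •
    (P.ρ⁻¹ • (qComm P.q P.genA P.genAs + (P.ω / (P.q - P.q⁻¹)) • 1) +
      ((P.q * u ^ 2 + P.q⁻¹ * u⁻¹ ^ 2) / (P.q ^ 2 - P.q⁻¹ ^ 2)) • 1)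

def K22 (u : ℂ) : P.AW :=
  bf (u ^ 2) • ((P.q * u) • P.genAs - (P.q⁻¹ * u⁻¹) • P.genA) - P.etaBar u⁻¹ • 1

/-- `γ^ε(x, m) = α^{(1-ε)/2} β^{(1+ε)/2} q^{-m} x - α^{(1+ε)/2} β^{(1-ε)/2} q^m x⁻¹`. -/
def γ (ε : ℤˣ) (α β x : ℂ) (m : ℤ) : ℂ :=
  α ^ ((1 - (ε : ℤ)) / 2) * β ^ ((1 + (ε : ℤ)) / 2) * P.q ^ (-m) * x -
    α ^ ((1 + (ε : ℤ)) / 2) * β ^ ((1 - (ε : ℤ)) / 2) * P.q ^ m * x⁻¹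

/-- The row `(1, -t u^ε)` times the K-operator at `u` times the column `(t u^{-ε}, 1)`. -/
def gauged (ε : ℤˣ) (t u : ℂ) : P.AW :=
  (t * u ^ (-(ε : ℤ))) • P.K11 u + P.K12 u - (t ^ 2) • P.K21 u - (t * u ^ (ε : ℤ)) • P.K22 u

/-- The dynamical operator `ℬ^ε(u, m)`. -/
def dynB (ε : ℤˣ) (α β u : ℂ) (m : ℤ) : P.AW :=
  (-(((ε : ℤ) : ℂ)) * P.q ^ (-(ε : ℤ)) * u ^ (-(ε : ℤ)) / P.γ ε α β 1 (m + 1)) •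
    P.gauged ε (β * P.q ^ (-(ε : ℤ) * m)) u

/-- The dynamical operator `𝒞^ε(u, m)`. -/
def dynC (ε : ℤˣ) (α β u : ℂ) (m : ℤ) : P.AW :=
  ((((ε : ℤ) : ℂ)) * P.q ^ (-(ε : ℤ)) * u ^ (-(ε : ℤ)) / P.γ ε α β 1 (m - 1)) •
    P.gauged ε (α * P.q ^ ((ε : ℤ) * m)) u

/-- `B^ε(ū, m, M) = ℬ^ε(u₁, m + 2(M-1)) ⋯ ℬ^ε(u_M, m)`. -/
def stringB (ε : ℤˣ) (α β : ℂ) {M : ℕ} (u : Fin M → ℂ) (m : ℤ) : P.AW :=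
  (List.ofFn fun i : Fin M => P.dynB ε α β (u i) (m + 2 * ((M : ℤ) - 1 - (i : ℕ)))).prod

/-- `C^ε(v̄, m, N) = 𝒞^ε(v₁, m + 2) ⋯ 𝒞^ε(v_N, m + 2N)`. -/
def stringC (ε : ℤˣ) (α β : ℂ) {N : ℕ} (v : Fin N → ℂ) (m : ℤ) : P.AW :=
  (List.ofFn fun i : Fin N => P.dynC ε α β (v i) (m + 2 * (((i : ℕ) : ℤ) + 1))).prod

/-! ### Bethe equations -/

def f (u v : ℂ) : ℂ := bf (P.q * v / u) * bf (u * v) / (bf (v / u) * bf (P.q * u * v))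

def h (u v : ℂ) : ℂ := bf (P.q ^ 2 * u * v) * bf (P.q * u / v) / (bf (P.q * u * v) * bf (u / v))

def Λ₁ (ε : ℤˣ) (u : ℂ) : ℂ :=
  P.q ^ (-(P.n : ℤ) - 1) / u ^ (ε : ℤ) *
    (P.q ^ ((P.n : ℤ) + 1) * u * P.ζ⁻¹ - u⁻¹ * P.ζ) *
    (P.q ^ ((P.n : ℤ) + 1) * u * P.ζ - u⁻¹ * P.ζ⁻¹) *
    (u * P.cs * P.q ^ (-(P.n : ℤ)) + u⁻¹ * P.b * P.q ^ (P.n : ℤ)) *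
    (u * (P.c / P.cs) ^ ((1 - (ε : ℤ)) / 2) + u⁻¹ * (P.bs / P.b) ^ ((1 + (ε : ℤ)) / 2))

def Λ₂ (ε : ℤˣ) (u : ℂ) : ℂ :=
  (u ^ 2 - u⁻¹ ^ 2) * P.q ^ (-(P.n : ℤ) - 1) /
      (u ^ (ε : ℤ) * (P.q * u ^ 2 - P.q⁻¹ * u⁻¹ ^ 2)) *
    (P.q ^ ((P.n : ℤ) - 1) * u⁻¹ * P.ζ - u * P.ζ⁻¹) *
    (P.q ^ ((P.n : ℤ) - 1) * u⁻¹ * P.ζ⁻¹ - u * P.ζ) *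
    (P.q ^ 2 * u * P.b * P.q ^ (P.n : ℤ) + u⁻¹ * P.cs * P.q ^ (-(P.n : ℤ))) *
    (P.q ^ 2 * u * (P.bs / P.b) ^ ((1 + (ε : ℤ)) / 2) +
      u⁻¹ * (P.c / P.cs) ^ ((1 - (ε : ℤ)) / 2))

/-- The function `E_ε^M(u_i, ū_i)` of the homogeneous Bethe equations. -/
def homE (ε : ℤˣ) {M : ℕ} (u : Fin M → ℂ) (i : Fin M) : ℂ :=
  -(bf (u i ^ 2) / bf (P.q * u i ^ 2)) *
      (∏ j ∈ Finset.univ.erase i, P.f (u i) (u j)) * P.Λ₁ ε (u i) +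
    (∏ j ∈ Finset.univ.erase i, P.h (u i) (u j)) * P.Λ₂ ε (u i)

/-- `b(x²)/b(q) · ∏_{k=0}^{2s} b(q^{1/2+k-s} ζ x) b(q^{1/2+k-s} ζ⁻¹ x) /
∏_{j ≠ i} b(x/u_j) b(q x u_j)` at `x = u_i`. -/
def inhomTerm (u : Fin P.n → ℂ) (i : Fin P.n) : ℂ :=
  bf (u i ^ 2) / bf P.q *
    (∏ k ∈ Finset.range (P.n + 1),
      bf (P.p ^ (1 + 2 * (k : ℤ) - (P.n : ℤ)) * P.ζ * u i) *
        bf (P.p ^ (1 + 2 * (k : ℤ) - (P.n : ℤ)) * P.ζ⁻¹ * u i)) /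
    ∏ j ∈ Finset.univ.erase i, (bf (u i / u j) * bf (P.q * u i * u j))

/-- The function `E_+(u_i, ū_i)` of the inhomogeneous Bethe equations. -/
def inhomEPlus (u : Fin P.n → ℂ) (i : Fin P.n) : ℂ :=
  bf (u i ^ 2) / bf (P.q * u i ^ 2) * u i *
      (∏ j ∈ Finset.univ.erase i, P.f (u i) (u j)) * P.Λ₁ 1 (u i) -
    (P.q ^ 2 * u i ^ 3)⁻¹ * (∏ j ∈ Finset.univ.erase i, P.h (u i) (u j)) * P.Λ₂ 1 (u i) +
    P.q ^ (-1 - 2 * (P.n : ℤ)) * P.cs * (u i)⁻¹ ^ 2 * P.inhomTerm u i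

/-- The function `E_-(u_i, ū_i)` of the inhomogeneous Bethe equations. -/
def inhomEMinus (u : Fin P.n → ℂ) (i : Fin P.n) : ℂ :=
  bf (u i ^ 2) / bf (P.q * u i ^ 2) * (u i)⁻¹ *
      (∏ j ∈ Finset.univ.erase i, P.f (u i) (u j)) * P.Λ₁ (-1) (u i) -
    P.q ^ 2 * u i ^ 3 * (∏ j ∈ Finset.univ.erase i, P.h (u i) (u j)) * P.Λ₂ (-1) (u i) +
    P.q ^ (1 + 2 * (P.n : ℤ)) * P.b * u i ^ 2 * P.inhomTerm u i

/-- The function `Ẽ_-(y_i, ȳ_i)` of the dual inhomogeneous Bethe equations. -/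
def dualInhomEMinus (y : Fin P.n → ℂ) (i : Fin P.n) : ℂ :=
  bf (y i ^ 2) / bf (P.q * y i ^ 2) * y i *
      (∏ j ∈ Finset.univ.erase i, P.f (y i) (y j)) * P.Λ₁ (-1) (y i) -
    (P.q ^ 2 * y i ^ 3)⁻¹ * (∏ j ∈ Finset.univ.erase i, P.h (y i) (y j)) * P.Λ₂ (-1) (y i) +
    P.q ^ (-1 - 2 * (P.n : ℤ)) * P.c * P.inhomTerm y i

/-- The symmetrized Bethe root `U = (q u² + q⁻¹ u⁻²)/(q + q⁻¹)`. -/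
def symRoot (u : ℂ) : ℂ := (P.q * u ^ 2 + P.q⁻¹ * u⁻¹ ^ 2) / (P.q + P.q⁻¹)

/-- Nontrivial (`u ≠ 0`, `u² ≠ u⁻²`, and the denominators `b(q u²)` of the Bethe equations do not
vanish) and admissible (distinct symmetrized roots) tuples. -/
structure IsAdmissible {M : ℕ} (u : Fin M → ℂ) : Prop where
  ne_zero : ∀ i, u i ≠ 0
  bf_sq_ne : ∀ i, bf (u i ^ 2) ≠ 0
  bf_q_sq_ne : ∀ i, bf (P.q * u i ^ 2) ≠ 0
  symRoot_inj : Function.Injective fun i => P.symRoot (u i)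

/-- `[2s]_q`. -/
def qNum : ℂ := (P.q ^ (P.n : ℤ) - P.q ^ (-(P.n : ℤ))) / (P.q - P.q⁻¹)

/-- `ū` is a set `S_-^{M(h)}`. -/
def IsHomMinus {M : ℕ} (u : Fin M → ℂ) : Prop :=
  P.IsAdmissible u ∧ ∀ i, P.homE (-1) u i = 0

/-- `ū` is a set `S_+^{M(i)}`. -/
def IsInhomPlus (M : ℕ) (u : Fin P.n → ℂ) : Prop :=
  P.IsAdmissible u ∧ (∀ i, P.inhomEPlus u i = 0) ∧
    P.θ M = P.q ^ (-2 * (P.n : ℤ)) *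
      (P.cs * (P.ζ ^ 2 + P.ζ⁻¹ ^ 2) * P.qNum +
        P.q ^ (P.n : ℤ) * (P.b * P.q ^ (P.n : ℤ) + P.c * P.q ^ (-(P.n : ℤ))) -
        P.q * P.cs * ∑ j, (P.q * u j ^ 2 + P.q⁻¹ * (u j)⁻¹ ^ 2))

/-- `w̄` is a set `S_-^{*N(i)}`. -/
def IsInhomMinus (N : ℕ) (w : Fin P.n → ℂ) : Prop :=
  P.IsAdmissible w ∧ (∀ i, P.inhomEMinus w i = 0) ∧
    P.θs N = P.q ^ (2 * (P.n : ℤ)) *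
      (P.b * (P.ζ ^ 2 + P.ζ⁻¹ ^ 2) * P.qNum +
        P.q ^ (-(P.n : ℤ)) * (P.bs * P.q ^ (P.n : ℤ) + P.cs * P.q ^ (-(P.n : ℤ))) -
        P.q⁻¹ * P.b * ∑ j, (P.q * w j ^ 2 + P.q⁻¹ * (w j)⁻¹ ^ 2))

/-- `ȳ'` is a set `dS_-^{*N(i)}`. -/
def IsDualInhomMinus (N : ℕ) (y : Fin P.n → ℂ) : Prop :=
  P.IsAdmissible y ∧ (∀ i, P.dualInhomEMinus y i = 0) ∧
    P.θs N = P.q ^ (-2 * (P.n : ℤ)) *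
      (P.c * (P.ζ ^ 2 + P.ζ⁻¹ ^ 2) * P.qNum +
        P.q ^ (P.n : ℤ) * (P.bs * P.q ^ (P.n : ℤ) + P.cs * P.q ^ (-(P.n : ℤ))) -
        P.q * P.c * ∑ j, (P.q * y j ^ 2 + P.q⁻¹ * (y j)⁻¹ ^ 2))

/-! ### `q`-Racah polynomials -/

/-- The `q`-Racah polynomial `R_M(θ*_N)`. -/
def qRacah (M N : ℕ) : ℂ :=
  fourPhiThree (P.q ^ (-2 * (M : ℤ))) (P.b / P.c * P.q ^ (2 * (M : ℤ)))
    (P.q ^ (-2 * (N : ℤ))) (P.bs / P.cs * P.q ^ (2 * (N : ℤ)))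
    (-(P.b / P.cs) * P.q ^ ((P.n : ℤ) + 1) * P.ζ ^ 2)
    (-(P.bs / P.c) * P.q ^ ((P.n : ℤ) + 1) * P.ζ⁻¹ ^ 2)
    (P.q ^ (-2 * (P.n : ℤ))) (P.q ^ 2) (P.q ^ 2)

/-! ### The representation, its eigenbases and the Bethe states -/

/-- `A*_{M,M-1}`, the coefficient of `|θ_M⟩` in `π(𝖠*)|θ_{M-1}⟩`. -/
def coefAs (M : ℕ) : ℂ :=
  P.q ^ (2 - 2 * (P.n : ℤ)) *
    ((1 - P.q ^ (2 * (M : ℤ))) * (P.c - P.b * P.q ^ (2 * (M : ℤ) + 2 * (P.n : ℤ))) *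
      (P.bs * P.q ^ ((P.n : ℤ) - 1) * P.ζ⁻¹ ^ 2 + P.b * P.q ^ (2 * (M : ℤ) - 2)) *
      (P.c * P.q ^ ((P.n : ℤ) - 1) * P.ζ ^ 2 + P.cs * P.q ^ (2 * (M : ℤ) - 2))) /
    ((P.c - P.b * P.q ^ (4 * (M : ℤ) - 2)) * (P.c - P.b * P.q ^ (4 * (M : ℤ))))

/-- `A_{N,N-1}`, the coefficient of `|θ*_N⟩` in `π(𝖠)|θ*_{N-1}⟩`. -/
def coefA (N : ℕ) : ℂ := P.swap.coefAs N

variable {V : Type*} [AddCommGroup V] [Module ℂ V]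

/-- `𝒱` is irreducible under the Askey-Wilson algebra. -/
def IsIrreducible (π : P.AW →ₐ[ℂ] Module.End ℂ V) : Prop :=
  Nontrivial V ∧
    ∀ W : Submodule ℂ V, (∀ x : P.AW, ∀ w ∈ W, π x w ∈ W) → W = ⊥ ∨ W = ⊤

/-- The eigenbases `|θ_M⟩`, `|θ*_N⟩` and the dual eigenvectors `⟨θ_M|`, `⟨θ*_N|`. The kets are
normalized, relative to `|θ_0⟩` and `|θ*_0⟩`, by the subdiagonal coefficients `A*_{M,M-1}` and
`A_{N,N-1}`; the bras are normalized arbitrarily. -/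
structure IsEigenData (π : P.AW →ₐ[ℂ] Module.End ℂ V)
    (ket kets : Module.Basis (Fin (P.n + 1)) ℂ V)
    (bra bras : Fin (P.n + 1) → Module.Dual ℂ V) : Prop where
  ket_eigen : ∀ M, π P.genA (ket M) = P.θ M • ket M
  kets_eigen : ∀ N, π P.genAs (kets N) = P.θs N • kets N
  ket_normal : ∀ i : Fin P.n,
    ket.repr (π P.genAs (ket i.castSucc)) i.succ = P.coefAs ((i : ℕ) + 1)
  kets_normal : ∀ i : Fin P.n,
    kets.repr (π P.genA (kets i.castSucc)) i.succ = P.coefA ((i : ℕ) + 1)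
  bra_ne : ∀ M, bra M ≠ 0
  bras_ne : ∀ N, bras N ≠ 0
  bra_eigen : ∀ M, (bra M).comp (π P.genA) = P.θ M • bra M
  bras_eigen : ∀ N, (bras N).comp (π P.genAs) = P.θs N • bras N

/-- The Bethe state `|Ψ_ε^M(ū, m₀)⟩ = π(B^ε(ū, m₀, M))|Ω^ε⟩` at `β = 0`. -/
def betheKet (π : P.AW →ₐ[ℂ] Module.End ℂ V) (ε : ℤˣ) (α : ℂ) (m₀ : ℤ) {M : ℕ}
    (u : Fin M → ℂ) (Ω : V) : V :=
  π (P.stringB ε α 0 u m₀) Ω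

/-- The dual Bethe state `⟨Ψ_ε^N(v̄, m₀)| = ⟨Ω^ε|π(C^ε(v̄, m₀, N))` at `α = 0`. -/
def betheBra (π : P.AW →ₐ[ℂ] Module.End ℂ V) (ε : ℤˣ) (β : ℂ) (m₀ : ℤ) {N : ℕ}
    (v : Fin N → ℂ) (Ω : Module.Dual ℂ V) : Module.Dual ℂ V :=
  Ω.comp (π (P.stringC ε 0 β v m₀))

/-- `𝒩_{2s}(w̄) = ∏_{k=1}^{2s} (q w_k b(w_k²) A*_{k,k-1})⁻¹`. -/
def normMinus (w : Fin P.n → ℂ) : ℂ :=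
  ∏ k : Fin P.n, (P.q * w k * bf (w k ^ 2) * P.coefAs ((k : ℕ) + 1))⁻¹

/-- `𝒩*_{2s}(ū) = ∏_{k=1}^{2s} (-q⁻¹ u_k⁻¹ b(u_k²) A_{k,k-1})⁻¹`. -/
def normPlus (u : Fin P.n → ℂ) : ℂ :=
  ∏ k : Fin P.n, (-(P.q⁻¹ * (u k)⁻¹) * bf (u k ^ 2) * P.coefA ((k : ℕ) + 1))⁻¹

/-- `𝒩_M^{(i)}(ū) = 𝒩*_{2s}(ū) (P⁻¹)_{2s,M}`, where `|θ_M⟩ = ∑_N (P⁻¹)_{NM} |θ*_N⟩`. -/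
def normInhom (ket kets : Module.Basis (Fin (P.n + 1)) ℂ V) (M : Fin (P.n + 1))
    (u : Fin P.n → ℂ) : ℂ :=
  P.normPlus u * kets.toMatrix ket (Fin.last P.n) M

/-- `𝒩_N^{*(i)}(w̄) = 𝒩_{2s}(w̄) P_{2s,N}`, where `|θ*_N⟩ = ∑_M P_{MN} |θ_M⟩`. -/
def normInhomStar (ket kets : Module.Basis (Fin (P.n + 1)) ℂ V) (N : Fin (P.n + 1))
    (w : Fin P.n → ℂ) : ℂ :=
  P.normMinus w * ket.toMatrix kets (Fin.last P.n) N

end Params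

end QRacah

end

/-!
The element `X = ρ⁻¹([𝖠*, 𝖠]_q + ω/(q - q⁻¹))` of the Askey-Wilson algebra (`third`) is a third
generator on the same footing as `𝖠` and `𝖠*`. When `α` or `β` vanishes, each factor of a Bethe
state has gauge parameter `t = 0`, and the corresponding dynamical operator reduces to a scalar
times `K12(u)`, which is linear in `X`. Hence a Bethe state is, up to an explicit scalar, the vector
`p(X)Ω`, where `p` is the monic polynomial whose roots are the points `x(q u_j²)` (`rootPoly`,
`rootVec`) and `Ω` is an extremal eigenvector.

On vectors `p(X)Ω` with `𝖠*Ω = θ*_0 Ω` the generator `𝖠*` acts on `p` by a second-order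
`q`-difference operator of Askey-Wilson type, and `𝖠` by a similar operator raising the degree by
one (`diffB`, `diffA`, `AWPair.apply_aeval`). At a root of `p` the image of `p` under such an
operator has only its two shift terms, so the homogeneous Bethe equations say that the image under
`diffB` vanishes at the roots of `p`, hence is a multiple of `p` (`AWPair.hom_eigen`). For `diffA`
the excess degree is removed by subtracting a multiple of the explicit polynomial `specPoly` of
degree `2s + 1`, whence the inhomogeneous term. This polynomial is an eigenvector of `diffB` for
`θ*_{2s+1}`, which is not an eigenvalue of `𝖠*`, so `specPoly(X)Ω = 0` and the subtraction does not
change the state (`AWPair.aeval_specPoly`, `AWPair.inhom_eigen`). Inverting `q` and transposing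
carries this to all four families of Bethe equations (`AWPair.inhomPlus_eigen`,
`AWPair.inhomMinus_eigen`, `AWPair.inhomDual_eigen`, `AWPair.homDual_eigen`). So each Bethe state is
proportional to an eigenvector; for the kets the constant is read off from the last coordinate,
where only the leading term of `p` contributes (`coord_aeval`, `betheKet_plus_eq`,
`betheKet_minus_eq`), and for the bras it cancels.

The claim is thereby reduced to `⟨θ_M|θ*_N⟩ = R_M(θ*_N) ⟨θ_0|θ*_N⟩` for the coordinate forms
(`LeonardData.coord_eq_qRacah`). On the functionals `⟨θ_0|(𝖠* - θ*_0)⋯(𝖠* - θ*_{k-1})` the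
transpose of `𝖠` is bidiagonal (`LeonardData.dualMap_A_splitForm`), so its eigenforms are explicit
finite sums, which evaluated at `|θ*_N⟩` are the terminating `₄φ₃` series. The normalization of
the kets by the subdiagonal coefficients makes all coordinates of `|θ*_0⟩` equal
(`LeonardData.coord_ground`), which fixes the remaining constant. The second variant follows by
exchanging `𝖠` and `𝖠*`, under which `R_M(θ*_N)` is symmetric (`Params.qRacah_swap`).
-/

noncomputable section

namespace QRacah

open Params Polynomial

namespace Params

variable {P : Params}

/-! ### Parameters and their symmetries -/

/-- The eigenvalue `𝖻 q^{2k} + 𝖼 q^{-2k}` at an arbitrary integer `k`; the sequence `θ*` is the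
one attached to `P.swap`. -/
def thZ (P : Params) (k : ℤ) : ℂ := P.b * P.q ^ (2 * k) + P.c * P.q ^ (-2 * k)

/-- The parameters after `q ↦ q⁻¹`, with the roles of `𝖠` and `𝖠*` exchanged. The structure
constants are unchanged up to `η ↔ η*`. -/
def rev (P : Params) : Params :=
  { n := P.n, p := P.p⁻¹, b := P.cs, c := P.bs, bs := P.c, cs := P.b, ζ := P.ζ, χ := P.χ }

@[simp] lemma swap_n : P.swap.n = P.n := rfl
@[simp] lemma swap_q : P.swap.q = P.q := rfl
@[simp] lemma swap_b : P.swap.b = P.bs := rfl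
@[simp] lemma swap_c : P.swap.c = P.cs := rfl
@[simp] lemma swap_bs : P.swap.bs = P.b := rfl
@[simp] lemma swap_cs : P.swap.cs = P.c := rfl
@[simp] lemma swap_ζ : P.swap.ζ = P.ζ⁻¹ := rfl
@[simp] lemma rev_n : P.rev.n = P.n := rfl
@[simp] lemma rev_q : P.rev.q = P.q⁻¹ := by simp [rev, q]
@[simp] lemma rev_b : P.rev.b = P.cs := rfl
@[simp] lemma rev_c : P.rev.c = P.bs := rfl
@[simp] lemma rev_bs : P.rev.bs = P.c := rfl
@[simp] lemma rev_cs : P.rev.cs = P.b := rfl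
@[simp] lemma rev_ζ : P.rev.ζ = P.ζ := rfl

lemma swap_swap : P.swap.swap = P := by simp [swap]

lemma rev_swap_thZ (k : ℤ) : P.rev.swap.thZ k = P.thZ k := by
  simp [thZ, add_comm]

namespace IsGeneric

lemma q_ne (hP : P.IsGeneric) : P.q ≠ 0 := pow_ne_zero 2 hP.p_ne

lemma q_zpow_ne_one (hP : P.IsGeneric) {k : ℤ} (hk : k ≠ 0) : P.q ^ k ≠ 1 := by
  rcases lt_or_gt_of_ne hk with h | h
  · intro h1
    apply hP.q_pow (-k).toNat (by omega)
    rw [← zpow_natCast, Int.toNat_of_nonneg (by omega), zpow_neg, h1, inv_one]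
  · intro h1
    apply hP.q_pow k.toNat (by omega)
    rw [← zpow_natCast, Int.toNat_of_nonneg (by omega), h1]

lemma swap (hP : P.IsGeneric) : P.swap.IsGeneric where
  p_ne := hP.p_ne
  q_pow := hP.q_pow
  b_ne := hP.bs_ne
  c_ne := hP.cs_ne
  bs_ne := hP.b_ne
  cs_ne := hP.c_ne
  ζ_ne := inv_ne_zero hP.ζ_ne
  χ_ne := hP.χ_ne
  bc_eq := hP.bc_eq.symm
  c_ne_b := hP.cs_ne_bs
  cs_ne_bs := hP.c_ne_b

lemma rev (hP : P.IsGeneric) : P.rev.IsGeneric where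
  p_ne := inv_ne_zero hP.p_ne
  q_pow k hk := by simpa using hP.q_pow k hk
  b_ne := hP.cs_ne
  c_ne := hP.bs_ne
  bs_ne := hP.c_ne
  cs_ne := hP.b_ne
  ζ_ne := hP.ζ_ne
  χ_ne := hP.χ_ne
  bc_eq := by
    have := hP.bc_eq
    simp only [rev_b, rev_c, rev_bs, rev_cs]
    linear_combination -this
  c_ne_b k h1 h2 h := by
    apply hP.cs_ne_bs k h1 h2
    simp only [rev_b, rev_c, rev_q, inv_zpow'] at h
    rw [h, mul_assoc, ← zpow_add₀ hP.q_ne]; simp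
  cs_ne_bs k h1 h2 h := by
    apply hP.c_ne_b k h1 h2
    simp only [rev_bs, rev_cs, rev_q, inv_zpow'] at h
    rw [h, mul_assoc, ← zpow_add₀ hP.q_ne]; simp

lemma q_sub_inv_ne (hP : P.IsGeneric) : P.q - P.q⁻¹ ≠ 0 := by
  have h := hP.q_pow 2 (by norm_num)
  have h0 := hP.q_ne
  intro h1
  apply h
  field_simp at h1
  linear_combination h1

lemma q_sq_ne_one (hP : P.IsGeneric) : P.q ^ 2 - 1 ≠ 0 :=
  sub_ne_zero.mpr (hP.q_pow 2 (by norm_num))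

lemma q_sq_add_one_ne (hP : P.IsGeneric) : P.q ^ 2 + 1 ≠ 0 := by
  intro h
  exact hP.q_pow 4 (by norm_num) (by linear_combination (P.q ^ 2 - 1) * h)

lemma q_add_inv_ne (hP : P.IsGeneric) : P.q + P.q⁻¹ ≠ 0 := by
  have h0 := hP.q_ne
  intro h1
  apply hP.q_sq_add_one_ne
  field_simp at h1
  linear_combination h1

lemma q_sq_sub_inv_ne (hP : P.IsGeneric) : P.q ^ 2 - P.q⁻¹ ^ 2 ≠ 0 := by
  have := mul_ne_zero hP.q_sub_inv_ne hP.q_add_inv_ne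
  intro h
  apply this
  linear_combination h

lemma ρ_ne (hP : P.IsGeneric) : P.ρ ≠ 0 := by
  unfold ρ
  exact mul_ne_zero (neg_ne_zero.mpr (mul_ne_zero hP.b_ne hP.c_ne))
    (pow_ne_zero _ hP.q_sq_sub_inv_ne)

lemma thZ_ne (hP : P.IsGeneric) {i j : ℤ} (hij : i ≠ j) (h1 : -1 ≤ i + j)
    (h2 : i + j ≤ 2 * P.n + 1) : P.thZ i ≠ P.thZ j := by
  have hq := hP.q_ne
  have e : P.thZ i - P.thZ j =
      (P.q ^ (2 * i) - P.q ^ (2 * j)) * (P.b * P.q ^ (2 * (i + j)) - P.c) *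
        P.q ^ (-2 * (i + j)) := by
    unfold thZ
    have e1 : P.q ^ (-2 * (i + j)) = (P.q ^ (2 * i))⁻¹ * (P.q ^ (2 * j))⁻¹ := by
      rw [← zpow_neg, ← zpow_neg, ← zpow_add₀ hq]; ring_nf
    have e2 : P.q ^ (2 * (i + j)) = P.q ^ (2 * i) * P.q ^ (2 * j) := by
      rw [← zpow_add₀ hq]; ring_nf
    have e3 : P.q ^ (-2 * i) = (P.q ^ (2 * i))⁻¹ := by rw [← zpow_neg]; ring_nf
    have e4 : P.q ^ (-2 * j) = (P.q ^ (2 * j))⁻¹ := by rw [← zpow_neg]; ring_nf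
    rw [e1, e2, e3, e4]
    have := zpow_ne_zero (2 * i) hq
    have := zpow_ne_zero (2 * j) hq
    field_simp
    ring
  rw [← sub_ne_zero, e]
  refine mul_ne_zero (mul_ne_zero ?_ ?_) (zpow_ne_zero _ hq)
  · rw [sub_ne_zero]
    intro h
    apply hP.q_zpow_ne_one (k := 2 * i - 2 * j) (by omega)
    rw [zpow_sub₀ hq, h, div_self (zpow_ne_zero _ hq)]
  · exact sub_ne_zero.mpr (hP.c_ne_b _ h1 h2).symm

end IsGeneric

lemma thZ_add_thZ (hq : P.q ≠ 0) (k : ℤ) :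
    P.thZ (k + 1) + P.thZ (k - 1) = (P.q ^ 2 + P.q⁻¹ ^ 2) * P.thZ k := by
  unfold thZ
  have e1 : P.q ^ (2 * (k + 1)) = P.q ^ (2 * k) * P.q ^ 2 := by
    rw [mul_add, zpow_add₀ hq]; rfl
  have e2 : P.q ^ (2 * (k - 1)) = P.q ^ (2 * k) * P.q⁻¹ ^ 2 := by
    rw [mul_sub, zpow_sub₀ hq, div_eq_mul_inv, inv_pow]; rfl
  have e3 : P.q ^ (-2 * (k + 1)) = P.q ^ (-2 * k) * P.q⁻¹ ^ 2 := by
    rw [mul_add, zpow_add₀ hq, inv_pow]; rfl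
  have e4 : P.q ^ (-2 * (k - 1)) = P.q ^ (-2 * k) * P.q ^ 2 := by
    rw [mul_sub, zpow_sub₀ hq, div_eq_mul_inv]
    congr 1
    simp only [mul_one, zpow_neg, inv_inv]; rfl
  rw [e1, e2, e3, e4]
  ring

lemma thZ_mul_thZ (hq : P.q ≠ 0) (k : ℤ) :
    P.thZ (k + 1) * P.thZ (k - 1) = P.thZ k ^ 2 - P.ρ := by
  unfold thZ ρ
  have e1 : P.q ^ (2 * (k + 1)) = P.q ^ (2 * k) * P.q ^ 2 := by
    rw [mul_add, zpow_add₀ hq]; rfl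
  have e2 : P.q ^ (2 * (k - 1)) = P.q ^ (2 * k) * P.q⁻¹ ^ 2 := by
    rw [mul_sub, zpow_sub₀ hq, div_eq_mul_inv, inv_pow]; rfl
  have e3 : P.q ^ (-2 * (k + 1)) = (P.q ^ (2 * k))⁻¹ * P.q⁻¹ ^ 2 := by
    rw [mul_add, zpow_add₀ hq, inv_pow, ← zpow_neg, neg_mul]; rfl
  have e4 : P.q ^ (-2 * (k - 1)) = (P.q ^ (2 * k))⁻¹ * P.q ^ 2 := by
    rw [mul_sub, zpow_sub₀ hq, div_eq_mul_inv, ← zpow_neg (P.q) (2 * k), neg_mul]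
    congr 1
    simp only [mul_one, zpow_neg, inv_inv]; rfl
  have e5 : P.q ^ (-2 * k) = (P.q ^ (2 * k))⁻¹ := by rw [← zpow_neg]; ring_nf
  rw [e1, e2, e3, e4, e5]
  have := zpow_ne_zero (2 * k) hq
  field_simp
  ring

lemma thZ_factor (hq : P.q ≠ 0) (k : ℤ) (z : ℂ) :
    z ^ 2 - (P.q ^ 2 + P.q⁻¹ ^ 2) * z * P.thZ k + P.thZ k ^ 2 - P.ρ =
      (z - P.thZ (k + 1)) * (z - P.thZ (k - 1)) := by
  linear_combination z * thZ_add_thZ hq k - thZ_mul_thZ hq k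

lemma ρ_swap (hP : P.IsGeneric) : P.swap.ρ = P.ρ := by
  simp only [ρ, swap_b, swap_c, swap_q, hP.bc_eq]

lemma ω_swap (hP : P.IsGeneric) : P.swap.ω = P.ω := by
  simp only [ω, swap_b, swap_c, swap_q, swap_bs, swap_cs, swap_n, swap_ζ, hP.bc_eq, inv_inv]
  ring

lemma η_swap : P.swap.η = P.ηs := by
  simp only [η, ηs, swap_b, swap_c, swap_q, swap_bs, swap_cs, swap_n, swap_ζ, inv_inv]
  ring

lemma ηs_swap : P.swap.ηs = P.η := by
  simp only [η, ηs, swap_b, swap_c, swap_q, swap_bs, swap_cs, swap_n, swap_ζ, inv_inv]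
  ring

lemma ρ_rev (hP : P.IsGeneric) : P.rev.ρ = P.ρ := by
  simp only [ρ, rev_b, rev_c, rev_q, hP.bc_eq, inv_inv]
  ring

lemma ω_rev (hP : P.IsGeneric) : P.rev.ω = P.ω := by
  simp only [ω, rev_b, rev_c, rev_q, rev_bs, rev_cs, rev_n, rev_ζ, hP.bc_eq, inv_inv, inv_zpow',
    neg_add, neg_neg, sub_eq_add_neg]
  ring

lemma η_rev : P.rev.η = P.ηs := by
  simp only [η, ηs, rev_b, rev_c, rev_q, rev_bs, rev_cs, rev_n, rev_ζ, inv_inv, inv_zpow',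
    neg_add, neg_neg, sub_eq_add_neg]
  ring

lemma ηs_rev : P.rev.ηs = P.η := by
  simp only [η, ηs, rev_b, rev_c, rev_q, rev_bs, rev_cs, rev_n, rev_ζ, inv_inv, inv_zpow',
    neg_add, neg_neg, sub_eq_add_neg]
  ring

end Params

variable {P : Params} {V : Type*} [AddCommGroup V] [Module ℂ V]

/-! ### Askey-Wilson pairs and the third generator -/

/-- A pair of operators satisfying the Askey-Wilson relations, in expanded form. -/
structure AWPair (P : Params) (A B : Module.End ℂ V) : Prop where
  rel₁ : A * (A * B) - (P.q ^ 2 + P.q⁻¹ ^ 2) • (A * (B * A)) + B * (A * A) =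
    P.ρ • B + P.ω • A + P.η • 1
  rel₂ : B * (B * A) - (P.q ^ 2 + P.q⁻¹ ^ 2) • (B * (A * B)) + A * (B * B) =
    P.ρ • A + P.ω • B + P.ηs • 1

/-- The operator `ρ⁻¹([𝖠*, 𝖠]_q + ω/(q - q⁻¹))`, a third generator on the same footing as
`𝖠` and `𝖠*`. -/
def third (P : Params) (A B : Module.End ℂ V) : Module.End ℂ V :=
  P.ρ⁻¹ • (qComm P.q B A + (P.ω / (P.q - P.q⁻¹)) • 1)

lemma awPair_of_rep (hq : P.q ≠ 0) (π : P.AW →ₐ[ℂ] Module.End ℂ V) :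
    AWPair P (π P.genA) (π P.genAs) := by
  have h1 := congrArg π (RingQuot.mkAlgHom_rel ℂ (AWRel.aw1 (P := P)))
  have h2 := congrArg π (RingQuot.mkAlgHom_rel ℂ (AWRel.aw2 (P := P)))
  simp only [qComm, map_sub, map_add, map_smul, map_mul, map_one, inv_inv] at h1 h2
  change P.q⁻¹ • (π P.genA * (P.q • (π P.genA * π P.genAs) - P.q⁻¹ • (π P.genAs * π P.genA))) -
    P.q • ((P.q • (π P.genA * π P.genAs) - P.q⁻¹ • (π P.genAs * π P.genA)) * π P.genA) =
      P.ρ • π P.genAs + P.ω • π P.genA + P.η • 1 at h1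
  change P.q⁻¹ • (π P.genAs * (P.q • (π P.genAs * π P.genA) - P.q⁻¹ • (π P.genA * π P.genAs))) -
    P.q • ((P.q • (π P.genAs * π P.genA) - P.q⁻¹ • (π P.genA * π P.genAs)) * π P.genAs) =
      P.ρ • π P.genA + P.ω • π P.genAs + P.ηs • 1 at h2
  generalize π P.genA = A at *
  generalize π P.genAs = B at *
  constructor
  · rw [← h1]
    simp only [mul_sub, sub_mul, mul_smul_comm, smul_mul_assoc, smul_sub, smul_smul, mul_assoc]
    match_scalars <;> field_simp
    ring
  · rw [← h2]
    simp only [mul_sub, sub_mul, mul_smul_comm, smul_mul_assoc, smul_sub, smul_smul, mul_assoc]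
    match_scalars <;> field_simp
    ring

namespace AWPair

variable {A B : Module.End ℂ V}

lemma swap (hP : P.IsGeneric) (h : AWPair P A B) : AWPair P.swap B A where
  rel₁ := by rw [swap_q, ρ_swap hP, ω_swap hP, η_swap]; exact h.rel₂
  rel₂ := by rw [swap_q, ρ_swap hP, ω_swap hP, ηs_swap]; exact h.rel₁

lemma rev (hP : P.IsGeneric) (h : AWPair P A B) : AWPair P.rev B A where
  rel₁ := by
    rw [rev_q, ρ_rev hP, ω_rev hP, η_rev, inv_inv, add_comm (_ ^ 2)]; exact h.rel₂
  rel₂ := by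
    rw [rev_q, ρ_rev hP, ω_rev hP, ηs_rev, inv_inv, add_comm (_ ^ 2)]; exact h.rel₁

/-- Transposition reverses products, under which the Askey-Wilson relations are invariant. -/
lemma dual (h : AWPair P A B) : AWPair P A.dualMap B.dualMap where
  rel₁ := by
    have := congrArg LinearMap.dualMap h.rel₁
    ext f v
    have := congrArg (fun T : Module.End ℂ (Module.Dual ℂ V) => T f v) this
    simp only [LinearMap.dualMap_apply, LinearMap.add_apply, LinearMap.sub_apply,
      LinearMap.smul_apply, Module.End.mul_apply, Module.End.one_apply, map_add, map_sub,
      map_smul] at this ⊢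
    rw [← this]; abel
  rel₂ := by
    have := congrArg LinearMap.dualMap h.rel₂
    ext f v
    have := congrArg (fun T : Module.End ℂ (Module.Dual ℂ V) => T f v) this
    simp only [LinearMap.dualMap_apply, LinearMap.add_apply, LinearMap.sub_apply,
      LinearMap.smul_apply, Module.End.mul_apply, Module.End.one_apply, map_add, map_sub,
      map_smul] at this ⊢
    rw [← this]; abel

lemma B_mul_third (hP : P.IsGeneric) (h : AWPair P A B) :
    B * third P A B = P.q ^ 2 • (third P A B * B) + P.q • A + (P.q * P.ηs / P.ρ) • 1 := by
  have hρ := hP.ρ_ne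
  have hq := hP.q_ne
  have hq2 := hP.q_sq_ne_one
  rw [← sub_eq_zero]
  refine Eq.trans ?_ ((congrArg (fun T => (P.q / P.ρ) • T) (sub_eq_zero.mpr h.rel₂)).trans
    (smul_zero _))
  simp only [third, qComm, mul_sub, mul_add, add_mul, sub_mul, mul_smul_comm, smul_mul_assoc,
    mul_assoc, mul_one, one_mul]
  match_scalars <;> field_simp <;> ring

lemma A_mul_third (hP : P.IsGeneric) (h : AWPair P A B) :
    A * third P A B =
      P.q⁻¹ ^ 2 • (third P A B * A) - P.q⁻¹ • B - (P.q⁻¹ * P.η / P.ρ) • 1 := by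
  have hρ := hP.ρ_ne
  have hq := hP.q_ne
  have hq2 := hP.q_sq_ne_one
  rw [← sub_eq_zero]
  refine Eq.trans ?_ ((congrArg (fun T => (-P.q⁻¹ / P.ρ) • T) (sub_eq_zero.mpr h.rel₁)).trans
    (smul_zero _))
  simp only [third, qComm, mul_sub, mul_add, add_mul, sub_mul, mul_smul_comm, smul_mul_assoc,
    mul_assoc, mul_one, one_mul]
  match_scalars <;> field_simp <;> ring

end AWPair

lemma third_rev (hP : P.IsGeneric) (A B : Module.End ℂ V) :
    third P.rev B A = -third P A B := by
  have hq := hP.q_ne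
  have hq2 := hP.q_sq_ne_one
  have hq2' : 1 - P.q ^ 2 ≠ 0 := by rw [← neg_sub]; exact neg_ne_zero.mpr hq2
  simp only [third, qComm, rev_q, ρ_rev hP, ω_rev hP, inv_inv]
  match_scalars <;> field_simp
  grind

lemma third_swap_dual (hP : P.IsGeneric) (A B : Module.End ℂ V) :
    third P.swap B.dualMap A.dualMap = (third P A B).dualMap := by
  ext f v
  simp only [third, qComm, swap_q, ρ_swap hP, ω_swap hP, LinearMap.dualMap_apply,
    LinearMap.add_apply, LinearMap.sub_apply, LinearMap.smul_apply, Module.End.mul_apply,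
    Module.End.one_apply, map_add, map_sub, map_smul]

/-! ### The action of `𝖠` on an extremal eigenvector of `𝖠*` -/

namespace Params

variable {P : Params}

/-- The coefficient of the third generator in the action of `𝖠` on `|θ*_0⟩`. -/
def rCoef (P : Params) : ℂ := -(P.q⁻¹ * P.cs * (P.q ^ 2 - P.q⁻¹ ^ 2))

/-- The scalar part of the action of `𝖠` on `|θ*_0⟩`. -/
def tCoef (P : Params) : ℂ :=
  P.q ^ (P.n : ℤ) * (P.b * P.q ^ (P.n : ℤ) + P.c * P.q ^ (-(P.n : ℤ))) -
    P.cs * (P.ζ ^ 2 + P.ζ⁻¹ ^ 2) * P.q ^ (-(P.n : ℤ) - 1)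

/-- The diagonal coefficient of `𝖠` on an eigenvector of `𝖠*` for the eigenvalue `θ*_k`. -/
def diagA (P : Params) (k : ℤ) : ℂ :=
  (P.ω * P.swap.thZ k + P.ηs) /
    ((P.swap.thZ k - P.swap.thZ (k + 1)) * (P.swap.thZ k - P.swap.thZ (k - 1)))

lemma diagA_zero_mul (hP : P.IsGeneric) :
    P.diagA 0 * (P.q * P.swap.thZ 1 - P.q⁻¹ * P.swap.thZ 0) =
      P.ω / (P.q - P.q⁻¹) + (P.q - P.q⁻¹) * P.swap.thZ 0 * P.diagA 0 +
        P.tCoef * (P.q * P.swap.thZ 1 - P.q⁻¹ * P.swap.thZ 0) := by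
  have hq := hP.q_ne
  have hq2 := hP.q_sq_ne_one
  have h1 := sub_ne_zero.mpr (hP.swap.thZ_ne (i := 0) (j := 1) (by norm_num) (by norm_num)
    (by simp))
  have h2 := sub_ne_zero.mpr (hP.swap.thZ_ne (i := 0) (j := -1) (by norm_num) (by norm_num)
    (by simp; omega))
  have hq' : P.q - P.q⁻¹ ≠ 0 := hP.q_sub_inv_ne
  have hbs := hP.bs_ne
  have hz := hP.ζ_ne
  have hq4 := hP.q_sq_add_one_ne
  have hc : P.c = P.bs * P.cs / P.b := by
    rw [eq_div_iff hP.b_ne, ← hP.bc_eq, mul_comm]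
  have hQ : P.q ^ (P.n : ℤ) ≠ 0 := zpow_ne_zero _ hq
  have e0 : P.swap.thZ 0 = P.bs + P.cs := by simp [thZ]
  have e1 : P.swap.thZ 1 = P.bs * P.q ^ 2 + P.cs * P.q⁻¹ ^ 2 := by
    simp only [thZ, swap_b, swap_c, swap_q, mul_one, zpow_neg, inv_pow]; rfl
  have e2 : P.swap.thZ (-1) = P.bs * P.q⁻¹ ^ 2 + P.cs * P.q ^ 2 := by
    simp only [thZ, swap_b, swap_c, swap_q, mul_neg, mul_one, zpow_neg, inv_pow, neg_neg]; rfl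
  have key : (P.ω * (P.bs + P.cs) + P.ηs) * P.q ^ 2 =
      -((P.ω + P.tCoef * (P.q * P.swap.thZ 1 - P.q⁻¹ * P.swap.thZ 0) * (P.q - P.q⁻¹)) *
        (P.bs - P.cs * P.q ^ 2)) := by
    rw [e0, e1]
    unfold ω ηs tCoef
    rw [zpow_add₀ hq, zpow_sub₀ hq, zpow_neg, zpow_one, hc]
    generalize P.q ^ (P.n : ℤ) = Q at *
    have := hP.b_ne
    field_simp
    ring
  have hden : (P.swap.thZ 0 - P.swap.thZ 1) * (P.swap.thZ 0 - P.swap.thZ (-1)) * P.q ^ 2 =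
      -((P.q - P.q⁻¹) * ((P.q * P.swap.thZ 1 - P.q⁻¹ * P.swap.thZ 0) -
        (P.q - P.q⁻¹) * P.swap.thZ 0) * (P.bs - P.cs * P.q ^ 2)) := by
    rw [e0, e1, e2]
    field_simp
    ring
  have hd : P.diagA 0 * ((P.swap.thZ 0 - P.swap.thZ 1) * (P.swap.thZ 0 - P.swap.thZ (-1))) =
      P.ω * (P.bs + P.cs) + P.ηs := by
    unfold diagA
    rw [zero_add, zero_sub, div_mul_cancel₀ _ (mul_ne_zero h1 h2), e0]
  have h3 : P.bs - P.cs * P.q ^ 2 ≠ 0 := by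
    intro h
    apply mul_ne_zero (mul_ne_zero h1 h2) (pow_ne_zero 2 hq)
    rw [hden, h]; ring
  generalize P.swap.thZ 0 = x0 at *
  generalize P.swap.thZ 1 = x1 at *
  generalize P.swap.thZ (-1) = x2 at *
  generalize P.q - P.q⁻¹ = s at *
  have : (P.diagA 0 * (s * ((P.q * x1 - P.q⁻¹ * x0) - s * x0)) -
      (P.ω + P.tCoef * (P.q * x1 - P.q⁻¹ * x0) * s)) * (P.bs - P.cs * P.q ^ 2) = 0 := by
    linear_combination -key - P.q ^ 2 * hd + P.diagA 0 * hden
  have := (mul_eq_zero.mp this).resolve_right h3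
  field_simp
  field_simp at this
  linear_combination this

end Params

variable {P : Params} {V : Type*} [AddCommGroup V] [Module ℂ V] {A B : Module.End ℂ V}

/-- The second-order relation reads `(𝖠* - θ*_1)(𝖠* - θ*_{-1})(𝖠 - a)Ω = 0`; as `θ*_{-1}` is not
an eigenvalue, `(𝖠 - a)Ω` is an eigenvector for `θ*_1`. -/
lemma AWPair.B_A_ground (hP : P.IsGeneric) (h : AWPair P A B) {Ω : V}
    (hΩ : B Ω = P.swap.thZ 0 • Ω) (hm : ∀ v, B v = P.swap.thZ (-1) • v → v = 0) :
    B (A Ω - P.diagA 0 • Ω) = P.swap.thZ 1 • (A Ω - P.diagA 0 • Ω) := by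
  rw [← sub_eq_zero]
  apply hm
  have hrel := LinearMap.congr_fun h.rel₂ Ω
  simp only [LinearMap.add_apply, LinearMap.sub_apply, LinearMap.smul_apply,
    Module.End.mul_apply, Module.End.one_apply, hΩ, map_smul] at hrel
  have h1 := sub_ne_zero.mpr (hP.swap.thZ_ne (i := 0) (j := 1) (by norm_num) (by norm_num)
    (by simp))
  have h2 := sub_ne_zero.mpr (hP.swap.thZ_ne (i := 0) (j := -1) (by norm_num) (by norm_num)
    (by simp; omega))
  have hd : P.diagA 0 * ((P.swap.thZ 0 - P.swap.thZ 1) * (P.swap.thZ 0 - P.swap.thZ (-1))) =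
      P.ω * P.swap.thZ 0 + P.ηs := by
    unfold diagA
    rw [zero_add, zero_sub, div_mul_cancel₀ _ (mul_ne_zero h1 h2)]
  have ea := thZ_add_thZ (P := P.swap) hP.q_ne 0
  have em := thZ_mul_thZ (P := P.swap) hP.q_ne 0
  rw [ρ_swap hP] at em
  simp only [zero_add, zero_sub, swap_q] at ea em
  simp only [map_sub, map_smul, hΩ]
  generalize P.swap.thZ 0 = x0 at *
  generalize P.swap.thZ 1 = x1 at *
  generalize P.swap.thZ (-1) = x2 at *
  rw [← sub_eq_zero] at hrel ⊢
  rw [← hrel]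
  match_scalars
  · ring
  · linear_combination -hd
  · linear_combination -ea
  · linear_combination em

lemma AWPair.A_ground (hP : P.IsGeneric) (h : AWPair P A B) {Ω : V}
    (hΩ : B Ω = P.swap.thZ 0 • Ω) (hm : ∀ v, B v = P.swap.thZ (-1) • v → v = 0) :
    A Ω = P.rCoef • third P A B Ω + P.tCoef • Ω := by
  have h1 := h.B_A_ground hP hΩ hm
  have hd := diagA_zero_mul hP
  have hr : P.rCoef * (P.q * P.swap.thZ 1 - P.q⁻¹ * P.swap.thZ 0) = P.ρ := by
    have e0 : P.swap.thZ 0 = P.bs + P.cs := by simp [thZ]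
    have e1 : P.swap.thZ 1 = P.bs * P.q ^ 2 + P.cs * P.q⁻¹ ^ 2 := by
      simp only [thZ, swap_b, swap_c, swap_q, mul_one, zpow_neg, inv_pow]; rfl
    have hq := hP.q_ne
    rw [e0, e1]; unfold rCoef ρ; rw [hP.bc_eq]
    field_simp; ring
  have hρ := hP.ρ_ne
  simp only [map_sub, map_smul, hΩ] at h1
  have hBA : B (A Ω) = P.swap.thZ 1 • (A Ω - P.diagA 0 • Ω) +
      P.diagA 0 • P.swap.thZ 0 • Ω := by rw [← h1]; abel
  simp only [third, qComm, LinearMap.add_apply, LinearMap.sub_apply, LinearMap.smul_apply,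
    Module.End.mul_apply, Module.End.one_apply, hΩ, map_smul, hBA]
  have hri : P.rCoef * P.ρ⁻¹ * (P.q * P.swap.thZ 1 - P.q⁻¹ * P.swap.thZ 0) = 1 := by
    rw [mul_right_comm, hr, mul_inv_cancel₀ hρ]
  match_scalars
  · linear_combination -hri
  · linear_combination P.rCoef * P.ρ⁻¹ * hd + P.tCoef * hri

/-! ### The polynomial model -/

namespace Params

variable {P : Params}

/-- The images of `x^k` under the difference operators by which `𝖠*` (first component) and `𝖠`
(second component) act on vectors `p(X)|θ*_0⟩`, where `X` is the third generator. -/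
def diffSeq (P : Params) : ℕ → ℂ[X] × ℂ[X]
  | 0 => (C (P.swap.thZ 0), C P.rCoef * X + C P.tCoef)
  | k + 1 =>
    (C (P.q ^ 2) * (X * (P.diffSeq k).1) + C P.q * (P.diffSeq k).2 +
        C (P.q * P.ηs / P.ρ) * X ^ k,
      C (P.q⁻¹ ^ 2) * (X * (P.diffSeq k).2) - C P.q⁻¹ * (P.diffSeq k).1 -
        C (P.q⁻¹ * P.η / P.ρ) * X ^ k)

/-- The operator by which `𝖠*` acts in the polynomial model. -/
def diffB (P : Params) : ℂ[X] →ₗ[ℂ] ℂ[X] :=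
  Polynomial.lsum fun k => LinearMap.toSpanSingleton ℂ ℂ[X] (P.diffSeq k).1

/-- The operator by which `𝖠` acts in the polynomial model. -/
def diffA (P : Params) : ℂ[X] →ₗ[ℂ] ℂ[X] :=
  Polynomial.lsum fun k => LinearMap.toSpanSingleton ℂ ℂ[X] (P.diffSeq k).2

lemma diffB_monomial (k : ℕ) (a : ℂ) : P.diffB (monomial k a) = a • (P.diffSeq k).1 := by
  simp [diffB, Polynomial.lsum_apply, Polynomial.sum_monomial_index]

lemma diffA_monomial (k : ℕ) (a : ℂ) : P.diffA (monomial k a) = a • (P.diffSeq k).2 := by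
  simp [diffA, Polynomial.lsum_apply, Polynomial.sum_monomial_index]

lemma diffB_X_mul (p : ℂ[X]) : P.diffB (X * p) =
    C (P.q ^ 2) * (X * P.diffB p) + C P.q * P.diffA p + C (P.q * P.ηs / P.ρ) * p := by
  induction p using Polynomial.induction_on' with
  | add p r hp hr => rw [mul_add, map_add, hp, hr, map_add, map_add]; ring
  | monomial k a =>
    rw [X_mul_monomial, diffB_monomial, diffB_monomial, diffA_monomial, diffSeq,
      ← C_mul_X_pow_eq_monomial]
    simp only [smul_eq_C_mul]; ring

lemma diffA_X_mul (p : ℂ[X]) : P.diffA (X * p) =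
    C (P.q⁻¹ ^ 2) * (X * P.diffA p) - C P.q⁻¹ * P.diffB p - C (P.q⁻¹ * P.η / P.ρ) * p := by
  induction p using Polynomial.induction_on' with
  | add p r hp hr => rw [mul_add, map_add, hp, hr, map_add, map_add]; ring
  | monomial k a =>
    rw [X_mul_monomial, diffA_monomial, diffB_monomial, diffA_monomial, diffSeq,
      ← C_mul_X_pow_eq_monomial]
    simp only [smul_eq_C_mul]; ring

lemma diffB_C (a : ℂ) : P.diffB (C a) = C a * C (P.swap.thZ 0) := by
  rw [← monomial_zero_left, diffB_monomial, diffSeq, smul_eq_C_mul, monomial_zero_left]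

lemma diffA_C (a : ℂ) : P.diffA (C a) = C a * (C P.rCoef * X + C P.tCoef) := by
  rw [← monomial_zero_left, diffA_monomial, diffSeq, smul_eq_C_mul, monomial_zero_left]

/-- Induction along multiplication by the variable. -/
lemma poly_induction {motive : ℂ[X] → Prop} (hC : ∀ a, motive (C a))
    (hadd : ∀ p r, motive p → motive r → motive (p + r))
    (hX : ∀ p, motive p → motive (X * p)) (p : ℂ[X]) : motive p := by
  induction p using Polynomial.induction_on with
  | C a => exact hC a
  | add p r hp hr => exact hadd p r hp hr
  | monomial k a h =>
    have := hX _ h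
    rwa [show (X : ℂ[X]) * (C a * X ^ k) = C a * X ^ (k + 1) by ring] at this

lemma thZ_natCast (k : ℕ) : P.thZ k = P.b * P.q ^ (2 * k) + P.c * P.q⁻¹ ^ (2 * k) := by
  unfold thZ
  rw [inv_pow, ← zpow_natCast, ← zpow_neg]
  push_cast
  rw [neg_mul]

lemma diffSeq_coeff (hq : P.q ≠ 0) (k : ℕ) :
    ((P.diffSeq k).1.natDegree ≤ k ∧ (P.diffSeq k).1.coeff k = P.swap.thZ k) ∧
    (P.diffSeq k).2.natDegree ≤ k + 1 ∧
      (P.diffSeq k).2.coeff (k + 1) = P.q⁻¹ ^ (2 * k) * P.rCoef ∧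
      (P.diffSeq k).2.coeff k = P.q⁻¹ ^ (2 * k) * P.tCoef := by
  induction k with
  | zero =>
    simp only [diffSeq]
    refine ⟨⟨by simp, by simp⟩, ?_, by simp, by simp⟩
    compute_degree
  | succ k ih =>
    obtain ⟨⟨h1, h2⟩, h3, h4, h5⟩ := ih
    have hX : (X ^ k : ℂ[X]).natDegree ≤ k := by simp
    have h1' : (P.diffSeq k).1.coeff (k + 1) = 0 := coeff_eq_zero_of_natDegree_lt (by omega)
    have h1'' : (P.diffSeq k).1.coeff (k + 2) = 0 := coeff_eq_zero_of_natDegree_lt (by omega)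
    simp only [diffSeq]
    refine ⟨⟨?_, ?_⟩, ?_, ?_, ?_⟩
    · refine (natDegree_add_le_of_degree_le (natDegree_add_le_of_degree_le
        ((natDegree_C_mul_le _ _).trans ?_) ((natDegree_C_mul_le _ _).trans h3))
        ((natDegree_C_mul_le _ _).trans (hX.trans (by omega))))
      refine natDegree_mul_le.trans ?_
      simp only [natDegree_X]; omega
    · simp only [coeff_add, coeff_C_mul, coeff_X_mul, h2, h4, coeff_X_pow]
      have e := P.swap.thZ_natCast (k + 1)
      have e' := P.swap.thZ_natCast k
      push_cast at e ⊢
      rw [e, e', rCoef, if_neg (by omega)]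
      simp only [swap_b, swap_c, swap_q, inv_pow]
      field_simp
      ring
    · refine (natDegree_sub_le_of_le (n := k + 2) (natDegree_sub_le_of_le (m := k + 2)
        (n := k + 2) ((natDegree_C_mul_le _ _).trans ?_)
        ((natDegree_C_mul_le _ _).trans (h1.trans (by omega))))
        ((natDegree_C_mul_le _ _).trans (hX.trans (by omega)))).trans (by simp)
      refine natDegree_mul_le.trans ?_
      simp only [natDegree_X]; omega
    · simp only [coeff_sub, coeff_C_mul, coeff_X_mul, h4, h1'', coeff_X_pow]
      rw [if_neg (by omega)]
      ring
    · simp only [coeff_sub, coeff_C_mul, coeff_X_mul, h5, h1', coeff_X_pow]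
      rw [if_neg (by omega)]
      ring

lemma diffB_natDegree_coeff (hq : P.q ≠ 0) {n : ℕ} {p : ℂ[X]} (hp : p.natDegree ≤ n) :
    (P.diffB p).natDegree ≤ n ∧ (P.diffB p).coeff n = P.swap.thZ n * p.coeff n := by
  revert hp
  refine p.induction_with_natDegree_le
    (fun p => (P.diffB p).natDegree ≤ n ∧ (P.diffB p).coeff n = P.swap.thZ n * p.coeff n)
    n ?_ ?_ ?_
  · simp
  · intro k a _ hk
    obtain ⟨⟨h1, h2⟩, -⟩ := diffSeq_coeff hq k
    rw [C_mul_X_pow_eq_monomial, diffB_monomial]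
    refine ⟨(natDegree_smul_le _ _).trans (h1.trans hk), ?_⟩
    rw [coeff_smul, coeff_monomial]
    rcases hk.eq_or_lt with rfl | hk
    · rw [h2, if_pos rfl, smul_eq_mul, mul_comm]
    · rw [coeff_eq_zero_of_natDegree_lt (h1.trans_lt hk), if_neg hk.ne]; simp
  · rintro f g - - ⟨h1, h2⟩ ⟨h3, h4⟩
    rw [map_add, coeff_add, coeff_add, h2, h4]
    exact ⟨natDegree_add_le_of_degree_le h1 h3, by ring⟩

lemma diffA_natDegree_coeff (hq : P.q ≠ 0) {n : ℕ} {p : ℂ[X]} (hp : p.natDegree ≤ n) :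
    (P.diffA p).natDegree ≤ n + 1 ∧
      (P.diffA p).coeff (n + 1) = P.q⁻¹ ^ (2 * n) * P.rCoef * p.coeff n ∧
      (P.diffA p).coeff n = P.q⁻¹ ^ (2 * n) * (P.tCoef * p.coeff n +
        P.q ^ 2 * P.rCoef * (X * p).coeff n) := by
  revert hp
  refine p.induction_with_natDegree_le
    (fun p => (P.diffA p).natDegree ≤ n + 1 ∧
      (P.diffA p).coeff (n + 1) = P.q⁻¹ ^ (2 * n) * P.rCoef * p.coeff n ∧
      (P.diffA p).coeff n = P.q⁻¹ ^ (2 * n) * (P.tCoef * p.coeff n +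
        P.q ^ 2 * P.rCoef * (X * p).coeff n))
    n ?_ ?_ ?_
  · simp
  · intro k a _ hk
    obtain ⟨-, h1, h2, h3⟩ := diffSeq_coeff hq k
    rw [C_mul_X_pow_eq_monomial, diffA_monomial, X_mul_monomial]
    refine ⟨(natDegree_smul_le _ _).trans (h1.trans (by omega)), ?_⟩
    simp only [coeff_smul, coeff_monomial, smul_eq_mul]
    rcases hk.eq_or_lt with rfl | hk
    · rw [h2, h3, if_pos rfl, if_neg (by omega)]
      exact ⟨by ring, by ring⟩
    · rw [if_neg hk.ne, coeff_eq_zero_of_natDegree_lt (n := n + 1) (by omega)]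
      refine ⟨by ring, ?_⟩
      rcases (Nat.succ_le_of_lt hk).eq_or_lt with rfl | hk'
      · rw [if_pos rfl, Nat.succ_eq_add_one, h2]
        simp only [inv_pow]
        field_simp
        ring
      · rw [if_neg (by omega), coeff_eq_zero_of_natDegree_lt (by omega)]; ring
  · rintro f g - - ⟨h1, h2, h3⟩ ⟨h4, h5, h6⟩
    have e : (X * (f + g)).coeff n = (X * f).coeff n + (X * g).coeff n := by
      rw [mul_add, coeff_add]
    rw [map_add, e]
    simp only [coeff_add, h2, h3, h5, h6]
    exact ⟨natDegree_add_le_of_degree_le h1 h4, by ring, by ring⟩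

end Params

variable {P : Params} {V : Type*} [AddCommGroup V] [Module ℂ V] {A B : Module.End ℂ V}

lemma AWPair.apply_aeval (hP : P.IsGeneric) (h : AWPair P A B) {Ω : V}
    (hΩ : B Ω = P.swap.thZ 0 • Ω) (hm : ∀ v, B v = P.swap.thZ (-1) • v → v = 0) (p : ℂ[X]) :
    B (aeval (third P A B) p Ω) = aeval (third P A B) (P.diffB p) Ω ∧
      A (aeval (third P A B) p Ω) = aeval (third P A B) (P.diffA p) Ω := by
  induction p using poly_induction with
  | hC a =>
    rw [diffB_C, diffA_C]
    simp only [map_mul, map_add, aeval_C, aeval_X, Module.algebraMap_end_apply,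
      Module.End.mul_apply, map_smul, LinearMap.add_apply, hΩ, h.A_ground hP hΩ hm]
    exact ⟨smul_comm _ _ _, by rw [smul_add, smul_comm a, smul_comm a]⟩
  | hadd p r hp hr =>
    simp only [map_add, LinearMap.add_apply, hp.1, hp.2, hr.1, hr.2]
    exact ⟨trivial, trivial⟩
  | hX p hp =>
    have e1 := LinearMap.congr_fun (h.B_mul_third hP) (aeval (third P A B) p Ω)
    have e2 := LinearMap.congr_fun (h.A_mul_third hP) (aeval (third P A B) p Ω)
    rw [diffB_X_mul, diffA_X_mul]
    simp only [map_mul, map_add, map_sub, aeval_C, aeval_X, Module.algebraMap_end_apply,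
      Module.End.mul_apply, LinearMap.add_apply, LinearMap.sub_apply, LinearMap.smul_apply,
      Module.End.one_apply, hp.1, hp.2] at e1 e2 ⊢
    exact ⟨e1, e2⟩

/-! ### Divided differences and the pointwise form of the difference operators -/

/-- The divided difference `(p(y) - p(x))/(y - x)`, as a linear form on polynomials that makes
sense also for `y = x`. -/
def divDiff (y x : ℂ) : ℂ[X] →ₗ[ℂ] ℂ :=
  Polynomial.lsum fun k => (∑ i ∈ Finset.range k, y ^ i * x ^ (k - 1 - i)) • LinearMap.id

lemma divDiff_monomial (y x : ℂ) (k : ℕ) (a : ℂ) :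
    divDiff y x (monomial k a) = (∑ i ∈ Finset.range k, y ^ i * x ^ (k - 1 - i)) * a := by
  simp [divDiff, Polynomial.lsum_apply, Polynomial.sum_monomial_index]

lemma divDiff_C (y x a : ℂ) : divDiff y x (C a) = 0 := by
  rw [← monomial_zero_left, divDiff_monomial]; simp

lemma divDiff_X_mul (y x : ℂ) (p : ℂ[X]) :
    divDiff y x (X * p) = y * divDiff y x p + p.eval x := by
  induction p using Polynomial.induction_on' with
  | add p r hp hr => rw [mul_add, map_add, hp, hr, map_add, eval_add]; ring
  | monomial k a =>
    rw [X_mul_monomial, divDiff_monomial, divDiff_monomial, eval_monomial,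
      Finset.sum_range_succ']
    have : ∀ i ∈ Finset.range k, y ^ (i + 1) * x ^ (k + 1 - 1 - (i + 1)) =
        y * (y ^ i * x ^ (k - 1 - i)) := by
      intro i _
      rw [show k + 1 - 1 - (i + 1) = k - 1 - i by omega]; ring
    rw [Finset.sum_congr rfl this, ← Finset.mul_sum]
    simp only [pow_zero, one_mul, Nat.add_sub_cancel, Nat.sub_zero]
    ring

lemma sub_mul_divDiff (y x : ℂ) (p : ℂ[X]) :
    (y - x) * divDiff y x p = p.eval y - p.eval x := by
  induction p using poly_induction with
  | hC a => simp [divDiff_C]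
  | hadd p r hp hr => rw [map_add, mul_add, hp, hr, eval_add, eval_add]; ring
  | hX p hp =>
    rw [divDiff_X_mul, eval_mul, eval_mul, eval_X, eval_X]
    linear_combination y * hp

lemma divDiff_X_sub_C_mul (y x : ℂ) (p : ℂ[X]) :
    divDiff y x ((X - C x) * p) = p.eval y := by
  rw [sub_mul, map_sub, divDiff_X_mul, ← smul_eq_C_mul, map_smul, smul_eq_mul]
  linear_combination sub_mul_divDiff y x p

namespace Params

variable {P : Params}

/-- The spectral variable `-(w + w⁻¹)/(q² - q⁻²)`; a Bethe root `u` enters through `w = q u²`. -/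
def xw (P : Params) (w : ℂ) : ℂ := -(w + w⁻¹) / (P.q ^ 2 - P.q⁻¹ ^ 2)

/-- The coefficient of the upward shift `w ↦ q² w` in the Askey-Wilson operator `diffB`; the
coefficient of the downward shift is its value at `w⁻¹`. -/
def shiftB (P : Params) (w : ℂ) : ℂ :=
  -(P.q ^ (-(P.n : ℤ) - 1) / (P.q + P.q⁻¹)) *
    ((w - P.q ^ (P.n : ℤ) * P.ζ ^ 2) * (w - P.q ^ (P.n : ℤ) * P.ζ⁻¹ ^ 2)) *
    ((P.q ^ ((P.n : ℤ) + 1) * w * P.b + P.cs * P.q ^ (-(P.n : ℤ))) *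
      (P.q * w * (P.bs / P.b) + 1)) / (w ^ 2 * (w - w⁻¹))

lemma xw_inv (w : ℂ) : P.xw w⁻¹ = P.xw w := by
  unfold xw; rw [inv_inv, add_comm]

lemma shiftB_add (hP : P.IsGeneric) {w : ℂ} (hw : w ≠ 0) (hw2 : w ^ 2 ≠ 1) :
    P.shiftB w + P.shiftB w⁻¹ =
      (P.swap.thZ 1 - P.swap.thZ 0) * P.xw w + P.q * P.tCoef + P.q * P.ηs / P.ρ := by
  have hq := hP.q_ne
  have hq2 := hP.q_sq_ne_one
  have hq4 := hP.q_sq_add_one_ne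
  have hq22 := hP.q_sq_sub_inv_ne
  have hb := hP.b_ne
  have hbs := hP.bs_ne
  have hcs := hP.cs_ne
  have hz := hP.ζ_ne
  have hc : P.c = P.bs * P.cs / P.b := by
    rw [eq_div_iff hP.b_ne, ← hP.bc_eq, mul_comm]
  have hQ : P.q ^ (P.n : ℤ) ≠ 0 := zpow_ne_zero _ hq
  have hw2' : w ^ 2 - 1 ≠ 0 := sub_ne_zero.mpr hw2
  have hw2'' : 1 - w ^ 2 ≠ 0 := sub_ne_zero.mpr hw2.symm
  have hq4' : P.q ^ 4 - 1 ≠ 0 := by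
    have := mul_ne_zero hq2 hq4
    intro h; apply this; linear_combination h
  have e0 : P.swap.thZ 0 = P.bs + P.cs := by simp [thZ]
  have e1 : P.swap.thZ 1 = P.bs * P.q ^ 2 + P.cs * P.q⁻¹ ^ 2 := by
    simp only [thZ, swap_b, swap_c, swap_q, mul_one, zpow_neg, inv_pow]; rfl
  rw [e0, e1]
  unfold shiftB xw tCoef ηs ρ
  rw [zpow_add₀ hq, zpow_sub₀ hq, zpow_neg, zpow_one, hc]
  generalize P.q ^ (P.n : ℤ) = Q at *
  have e5 : P.q ^ 2 - P.q⁻¹ ^ 2 = (P.q ^ 2 - 1) * (P.q ^ 2 + 1) / P.q ^ 2 := by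
    field_simp; ring
  have e6 : w - w⁻¹ = (w ^ 2 - 1) / w := by field_simp
  have e7 : w⁻¹ - w⁻¹⁻¹ = -(w ^ 2 - 1) / w := by field_simp; ring
  rw [e5, e6, e7]
  field_simp
  ring

lemma shiftB_add' (hP : P.IsGeneric) {w : ℂ} (hw : w ≠ 0) (hw2 : w ^ 2 ≠ 1) :
    P.q⁻¹ * w⁻¹ * P.shiftB w + P.q⁻¹ * w * P.shiftB w⁻¹ =
      (P.q⁻¹ ^ 2 - 1) * (P.rCoef * P.xw w + P.tCoef) * P.xw w - P.q⁻¹ * P.swap.thZ 0 -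
        P.q⁻¹ * P.η / P.ρ := by
  have hq := hP.q_ne
  have hq2 := hP.q_sq_ne_one
  have hq4 := hP.q_sq_add_one_ne
  have hb := hP.b_ne
  have hbs := hP.bs_ne
  have hcs := hP.cs_ne
  have hz := hP.ζ_ne
  have hc : P.c = P.bs * P.cs / P.b := by
    rw [eq_div_iff hP.b_ne, ← hP.bc_eq, mul_comm]
  have hQ : P.q ^ (P.n : ℤ) ≠ 0 := zpow_ne_zero _ hq
  have hw2' : w ^ 2 - 1 ≠ 0 := sub_ne_zero.mpr hw2
  have e0 : P.swap.thZ 0 = P.bs + P.cs := by simp [thZ]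
  rw [e0]
  unfold shiftB xw tCoef rCoef η ρ
  rw [zpow_add₀ hq, zpow_sub₀ hq, zpow_neg, zpow_one, hc]
  generalize P.q ^ (P.n : ℤ) = Q at *
  have e5 : P.q ^ 2 - P.q⁻¹ ^ 2 = (P.q ^ 2 - 1) * (P.q ^ 2 + 1) / P.q ^ 2 := by
    field_simp; ring
  have e6 : w - w⁻¹ = (w ^ 2 - 1) / w := by field_simp
  have e7 : w⁻¹ - w⁻¹⁻¹ = -(w ^ 2 - 1) / w := by field_simp; ring
  rw [e5, e6, e7]
  field_simp
  ring

lemma xw_shift (hP : P.IsGeneric) {w : ℂ} (hw : w ≠ 0) :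
    P.xw (P.q ^ 2 * w) - P.q ^ 2 * P.xw w = w⁻¹ ∧
      P.xw (P.q ^ 2 * w) - P.q⁻¹ ^ 2 * P.xw w = -w ∧
      P.xw (P.q ^ 2 * w) - P.xw w =
        -(P.q * (w - (P.q ^ 2 * w)⁻¹) / (P.q + P.q⁻¹)) := by
  have hq := hP.q_ne
  have hq2 := hP.q_sq_ne_one
  have hq4 := hP.q_sq_add_one_ne
  have e5 : P.q ^ 2 - P.q⁻¹ ^ 2 = (P.q ^ 2 - 1) * (P.q ^ 2 + 1) / P.q ^ 2 := by
    field_simp; ring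
  unfold xw
  rw [e5]
  refine ⟨?_, ?_, ?_⟩ <;> field_simp <;> ring

lemma eval_diff (hP : P.IsGeneric) {w : ℂ} (hw : w ≠ 0) (hw2 : w ^ 2 ≠ 1) (p : ℂ[X]) :
    (P.diffB p).eval (P.xw w) = P.swap.thZ 0 * p.eval (P.xw w) +
        P.shiftB w * divDiff (P.xw (P.q ^ 2 * w)) (P.xw w) p +
        P.shiftB w⁻¹ * divDiff (P.xw (P.q ^ 2 * w⁻¹)) (P.xw w) p ∧
      (P.diffA p).eval (P.xw w) = (P.rCoef * P.xw w + P.tCoef) * p.eval (P.xw w) +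
        P.q⁻¹ * w⁻¹ * P.shiftB w * divDiff (P.xw (P.q ^ 2 * w)) (P.xw w) p +
        P.q⁻¹ * w * P.shiftB w⁻¹ * divDiff (P.xw (P.q ^ 2 * w⁻¹)) (P.xw w) p := by
  have hq := hP.q_ne
  have hqq : P.q * P.q⁻¹ = 1 := mul_inv_cancel₀ hq
  have hww : w * w⁻¹ = 1 := mul_inv_cancel₀ hw
  have s1 := shiftB_add hP hw hw2
  have s2 := shiftB_add' hP hw hw2
  obtain ⟨d1, d2, -⟩ := xw_shift hP hw
  obtain ⟨d3, d4, -⟩ := xw_shift hP (inv_ne_zero hw)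
  rw [xw_inv, inv_inv] at d3
  rw [xw_inv] at d4
  induction p using poly_induction with
  | hC a =>
    rw [diffB_C, diffA_C]
    simp only [divDiff_C, eval_mul, eval_C, eval_add, eval_X]
    exact ⟨by ring, by ring⟩
  | hadd p r hp hr =>
    simp only [map_add, eval_add, hp.1, hp.2, hr.1, hr.2]
    exact ⟨by ring, by ring⟩
  | hX p hp =>
    have hth : P.swap.thZ 1 - P.swap.thZ 0 = (P.q ^ 2 - 1) * P.swap.thZ 0 + P.q * P.rCoef := by
      have e1 := P.swap.thZ_natCast 1
      have e0 := P.swap.thZ_natCast 0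
      simp only [Nat.cast_one, Nat.cast_zero, swap_q, swap_b, swap_c] at e0 e1
      rw [e0, e1]
      unfold rCoef
      simp only [inv_pow]
      field_simp
      ring
    rw [diffB_X_mul, diffA_X_mul]
    simp only [divDiff_X_mul, eval_mul, eval_C, eval_add, eval_sub, eval_X, hp.1, hp.2]
    rw [hth] at s1
    generalize P.xw w = x at *
    generalize P.xw (P.q ^ 2 * w) = xp at *
    generalize P.xw (P.q ^ 2 * w⁻¹) = xm at *
    generalize divDiff xp x p = dp at *
    generalize divDiff xm x p = dm at *
    generalize P.shiftB w = a at *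
    generalize P.shiftB w⁻¹ = a' at *
    generalize w⁻¹ = w' at *
    generalize P.q⁻¹ = q' at *
    have e1 : P.q * q' * w' * a * dp = w' * a * dp := by rw [hqq]; ring
    have e2 : P.q * q' * w * a' * dm = w * a' * dm := by rw [hqq]; ring
    constructor
    · linear_combination e1 + e2 - a * dp * d1 - a' * dm * d3 - p.eval x * s1
    · have e3 : w * w' * (q' * a * dp) = q' * a * dp := by rw [hww]; ring
      have e4 : w * w' * (q' * a' * dm) = q' * a' * dm := by rw [hww]; ring
      linear_combination e3 + e4 - q' * w' * a * dp * d2 - q' * w * a' * dm * d4 - p.eval x * s2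

end Params

/-! ### The characteristic polynomial of the third generator -/

namespace Params

variable {P : Params}

/-- The characteristic polynomial of the third generator on the `(2s+1)`-dimensional
representation: its roots are the values of the spectral variable at `w = ζ² q^{2k-2s}`, `0 ≤ k ≤ 2s`. -/
def specPoly (P : Params) : ℂ[X] :=
  ∏ k ∈ Finset.range (P.n + 1), (X - C (P.xw (P.ζ ^ 2 * P.q ^ (2 * (k : ℤ) - P.n))))

lemma xw_sub_xw (P : Params) {w y : ℂ} (hw : w ≠ 0) (hy : y ≠ 0) :
    P.xw w - P.xw y = -(P.q ^ 2 - P.q⁻¹ ^ 2)⁻¹ * w⁻¹ * ((w - y) * (w - y⁻¹)) := by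
  unfold xw
  rw [div_eq_mul_inv, div_eq_mul_inv]
  generalize (P.q ^ 2 - P.q⁻¹ ^ 2)⁻¹ = a
  field_simp
  ring

/-- The finite product `∏_{k=0}^{2s} (w - y q^{2k-2s})`. -/
def strProd (P : Params) (y w : ℂ) : ℂ :=
  ∏ k ∈ Finset.range (P.n + 1), (w - y * P.q ^ (2 * (k : ℤ) - P.n))

lemma strProd_shift (hq : P.q ≠ 0) (y w : ℂ) :
    (w - y * P.q ^ (P.n : ℤ)) * P.strProd y (P.q ^ 2 * w) =
      P.q ^ (2 * (P.n + 1)) * (w - y * P.q ^ (-(P.n : ℤ) - 2)) * P.strProd y w := by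
  let a : ℕ → ℂ := fun k => w - y * P.q ^ (2 * (k : ℤ) - P.n - 2)
  have h1 : P.strProd y (P.q ^ 2 * w) =
      P.q ^ (2 * (P.n + 1)) * ∏ k ∈ Finset.range (P.n + 1), a k := by
    rw [pow_mul, ← Finset.card_range (P.n + 1), ← Finset.prod_const, Finset.card_range,
      ← Finset.prod_mul_distrib]
    refine Finset.prod_congr rfl fun k _ => ?_
    simp only [a]
    rw [zpow_sub₀ hq (2 * (k : ℤ) - P.n) 2, show P.q ^ (2 : ℤ) = P.q ^ 2 from rfl]
    field_simp
  have h2 : P.strProd y w = ∏ k ∈ Finset.range (P.n + 1), a (k + 1) := by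
    refine Finset.prod_congr rfl fun k _ => ?_
    simp only [a]
    congr 3
    push_cast
    ring
  have h3 : w - y * P.q ^ (P.n : ℤ) = a (P.n + 1) := by
    simp only [a]
    congr 3
    push_cast
    ring
  have h4 : w - y * P.q ^ (-(P.n : ℤ) - 2) = a 0 := by
    simp [a]
  rw [h1, h2, h3, h4]
  have := (Finset.prod_range_succ a (P.n + 1)).symm.trans (Finset.prod_range_succ' a (P.n + 1))
  linear_combination P.q ^ (2 * (P.n + 1)) * this

lemma eval_specPoly (hP : P.IsGeneric) {w : ℂ} (hw : w ≠ 0) :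
    P.specPoly.eval (P.xw w) = (-(P.q ^ 2 - P.q⁻¹ ^ 2)⁻¹ * w⁻¹) ^ (P.n + 1) *
      (P.strProd (P.ζ ^ 2) w * P.strProd (P.ζ⁻¹ ^ 2) w) := by
  have hq := hP.q_ne
  have hz := hP.ζ_ne
  have h1 : P.strProd (P.ζ⁻¹ ^ 2) w =
      ∏ k ∈ Finset.range (P.n + 1), (w - (P.ζ ^ 2 * P.q ^ (2 * (k : ℤ) - P.n))⁻¹) := by
    unfold strProd
    rw [← Finset.prod_range_reflect]
    refine Finset.prod_congr rfl fun k hk => ?_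
    rw [mul_inv, ← zpow_neg, inv_pow]
    have : k ≤ P.n := by simpa [Nat.lt_succ_iff] using hk
    congr 3
    rw [Nat.add_sub_cancel, Nat.cast_sub this]
    ring
  rw [h1]
  unfold strProd specPoly
  rw [eval_prod, ← Finset.prod_mul_distrib]
  have h2 : (-(P.q ^ 2 - P.q⁻¹ ^ 2)⁻¹ * w⁻¹) ^ (P.n + 1) =
      ∏ _k ∈ Finset.range (P.n + 1), (-(P.q ^ 2 - P.q⁻¹ ^ 2)⁻¹ * w⁻¹) := by
    rw [Finset.prod_const, Finset.card_range]
  rw [h2, ← Finset.prod_mul_distrib]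
  refine Finset.prod_congr rfl fun k _ => ?_
  rw [eval_sub, eval_X, eval_C,
    xw_sub_xw P hw (mul_ne_zero (pow_ne_zero 2 hz) (zpow_ne_zero _ hq))]

lemma specPoly_shift (hP : P.IsGeneric) {w : ℂ} (hw : w ≠ 0) :
    (w - P.q ^ (P.n : ℤ) * P.ζ ^ 2) * (w - P.q ^ (P.n : ℤ) * P.ζ⁻¹ ^ 2) *
        P.specPoly.eval (P.xw (P.q ^ 2 * w)) =
      P.q ^ (2 * (P.n + 1)) * ((w - P.ζ ^ 2 * P.q ^ (-(P.n : ℤ) - 2)) *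
        (w - P.ζ⁻¹ ^ 2 * P.q ^ (-(P.n : ℤ) - 2))) * P.specPoly.eval (P.xw w) := by
  have hq := hP.q_ne
  rw [eval_specPoly hP hw, eval_specPoly hP (mul_ne_zero (pow_ne_zero 2 hq) hw)]
  have h1 := strProd_shift hq (P.ζ ^ 2) w
  have h2 := strProd_shift hq (P.ζ⁻¹ ^ 2) w
  have e : (-(P.q ^ 2 - P.q⁻¹ ^ 2)⁻¹ * (P.q ^ 2 * w)⁻¹) ^ (P.n + 1) * P.q ^ (2 * (P.n + 1)) =
      (-(P.q ^ 2 - P.q⁻¹ ^ 2)⁻¹ * w⁻¹) ^ (P.n + 1) := by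
    rw [pow_mul, ← mul_pow]
    congr 1
    field_simp
  have h3 := congrArg₂ (· * ·) h1 h2
  rw [← e]
  linear_combination (-(P.q ^ 2 - P.q⁻¹ ^ 2)⁻¹ * (P.q ^ 2 * w)⁻¹) ^ (P.n + 1) * h3

lemma shiftB_divDiff_specPoly (hP : P.IsGeneric) {w : ℂ} (hw : w ≠ 0)
    (hw1 : P.q ^ 2 * w ^ 2 ≠ 1) :
    P.shiftB w * divDiff (P.xw (P.q ^ 2 * w)) (P.xw w) P.specPoly =
      P.q ^ (-(P.n : ℤ) - 1) * (P.q ^ (2 * (P.n + 1)) - 1) *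
        ((P.q ^ ((P.n : ℤ) + 1) * w * P.b + P.cs * P.q ^ (-(P.n : ℤ))) *
          (P.q * w * (P.bs / P.b) + 1)) / (P.q * w * (w - w⁻¹)) *
        P.specPoly.eval (P.xw w) := by
  have hq := hP.q_ne
  have hq4 := hP.q_sq_add_one_ne
  have hz := hP.ζ_ne
  have h1 := specPoly_shift hP hw
  have h2 := sub_mul_divDiff (P.xw (P.q ^ 2 * w)) (P.xw w) P.specPoly
  rw [(xw_shift hP hw).2.2] at h2
  have hw1' : P.q ^ 2 * w ^ 2 - 1 ≠ 0 := sub_ne_zero.mpr hw1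
  have key : (w - P.q ^ (P.n : ℤ) * P.ζ ^ 2) * (w - P.q ^ (P.n : ℤ) * P.ζ⁻¹ ^ 2) *
      divDiff (P.xw (P.q ^ 2 * w)) (P.xw w) P.specPoly =
      -((P.q ^ (2 * (P.n + 1)) - 1) * w * (P.q + P.q⁻¹) / P.q) * P.specPoly.eval (P.xw w) := by
    have e1 : P.q ^ (2 * (P.n + 1)) = (P.q ^ (P.n : ℤ)) ^ 2 * P.q ^ 2 := by
      rw [zpow_natCast]; ring
    rw [zpow_sub₀ hq, zpow_neg, show P.q ^ (2 : ℤ) = P.q ^ 2 from rfl, e1] at h1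
    rw [e1]
    have hQ : P.q ^ (P.n : ℤ) ≠ 0 := zpow_ne_zero _ hq
    generalize P.q ^ (P.n : ℤ) = Q at *
    generalize divDiff (P.xw (P.q ^ 2 * w)) (P.xw w) P.specPoly = d at *
    generalize P.specPoly.eval (P.xw (P.q ^ 2 * w)) = y at *
    generalize P.specPoly.eval (P.xw w) = x at *
    have h3 : y = -(P.q * (w - (P.q ^ 2 * w)⁻¹) / (P.q + P.q⁻¹)) * d + x := by
      rw [h2]; ring
    rw [h3] at h1
    have h4 : P.q ^ 2 * w ^ 2 - 1 ≠ 0 := hw1'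
    apply mul_left_cancel₀ h4
    field_simp at h1 ⊢
    linear_combination -h1
  unfold shiftB
  generalize divDiff (P.xw (P.q ^ 2 * w)) (P.xw w) P.specPoly = d at *
  calc _ = -(P.q ^ (-(P.n : ℤ) - 1) / (P.q + P.q⁻¹)) *
      ((P.q ^ ((P.n : ℤ) + 1) * w * P.b + P.cs * P.q ^ (-(P.n : ℤ))) *
      (P.q * w * (P.bs / P.b) + 1)) / (w ^ 2 * (w - w⁻¹)) *
      ((w - P.q ^ (P.n : ℤ) * P.ζ ^ 2) * (w - P.q ^ (P.n : ℤ) * P.ζ⁻¹ ^ 2) * d) := by ring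
    _ = _ := by
      rw [key, div_eq_mul_inv, div_eq_mul_inv _ (P.q * w * (w - w⁻¹)), mul_inv, mul_inv]
      have := hP.q_add_inv_ne
      generalize (w - w⁻¹)⁻¹ = a
      field_simp

lemma exists_xw (hP : P.IsGeneric) (x : ℂ) : ∃ w : ℂ, w ≠ 0 ∧ P.xw w = x := by
  obtain ⟨s, hs⟩ := IsAlgClosed.exists_eq_mul_self
    (discrim 1 (x * (P.q ^ 2 - P.q⁻¹ ^ 2)) 1)
  obtain ⟨w, hw⟩ := exists_quadratic_eq_zero one_ne_zero ⟨s, hs⟩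
  have hw0 : w ≠ 0 := by rintro rfl; simp at hw
  refine ⟨w, hw0, ?_⟩
  rw [xw, div_eq_iff hP.q_sq_sub_inv_ne]
  generalize P.q ^ 2 - P.q⁻¹ ^ 2 = d at *
  field_simp
  linear_combination -hw

/-- The characteristic polynomial is the eigenpolynomial of degree `2s + 1` of the Askey-Wilson
operator: by telescoping, its shifts are rational multiples of itself. -/
lemma diffB_specPoly (hP : P.IsGeneric) :
    P.diffB P.specPoly = C (P.swap.thZ (P.n + 1)) * P.specPoly := by
  have hq := hP.q_ne
  apply Polynomial.eq_of_infinite_eval_eq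
  -- The excluded points are those where `w = w⁻¹` or where a shift `w ↦ q² w^{±1}` fixes the
  -- spectral variable, so that the divided difference degenerates.
  refine Set.Infinite.mono (s := ({P.xw 1, P.xw (-1), P.xw P.q, P.xw (-P.q)} : Set ℂ)ᶜ) ?_
    (Set.Finite.infinite_compl (by simp))
  intro x hx
  obtain ⟨w, hw, rfl⟩ := exists_xw hP x
  simp only [Set.mem_compl_iff, Set.mem_insert_iff, Set.mem_singleton_iff, not_or] at hx
  obtain ⟨hx1, hx2, hx3, hx4⟩ := hx
  have hw2 : w ^ 2 ≠ 1 := by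
    intro h
    rcases sq_eq_sq_iff_eq_or_eq_neg.mp (h.trans (one_pow 2).symm) with rfl | rfl <;> contradiction
  have hw3 : P.q ^ 2 * w ^ 2 ≠ 1 := by
    intro h
    have h' : w⁻¹ ^ 2 = P.q ^ 2 := by
      rw [inv_pow]; exact (eq_inv_of_mul_eq_one_left h).symm
    rcases sq_eq_sq_iff_eq_or_eq_neg.mp h' with h' | h'
    · exact hx3 (by rw [← h', xw_inv])
    · exact hx4 (by rw [← h', xw_inv])
  have hw4 : P.q ^ 2 * w⁻¹ ^ 2 ≠ 1 := by
    intro h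
    have h' : w ^ 2 = P.q ^ 2 := by
      field_simp at h; exact h.symm
    rcases sq_eq_sq_iff_eq_or_eq_neg.mp h' with h' | h'
    · exact hx3 (by rw [← h'])
    · exact hx4 (by rw [← h'])
  rw [Set.mem_ofPred_eq, (eval_diff hP hw hw2 _).1, shiftB_divDiff_specPoly hP hw hw3]
  have h2 := shiftB_divDiff_specPoly hP (inv_ne_zero hw) hw4
  rw [xw_inv] at h2
  rw [h2, eval_mul, eval_C]
  rw [← add_mul, ← add_mul]
  congr 1
  have e0 : P.swap.thZ 0 = P.bs + P.cs := by simp [thZ]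
  have e1 := P.swap.thZ_natCast (P.n + 1)
  push_cast at e1
  rw [e0, e1, zpow_add₀ hq, zpow_sub₀ hq, zpow_neg, zpow_one, zpow_natCast]
  have e2 : P.q ^ (2 * (P.n + 1)) = (P.q ^ P.n) ^ 2 * P.q ^ 2 := by ring
  simp only [swap_b, swap_c, swap_q, inv_pow]
  rw [e2]
  have hQ : P.q ^ P.n ≠ 0 := pow_ne_zero _ hq
  generalize P.q ^ P.n = Q at *
  have hb := hP.b_ne
  have hw2' : w ^ 2 - 1 ≠ 0 := sub_ne_zero.mpr hw2
  have e6 : w - w⁻¹ = (w ^ 2 - 1) / w := by field_simp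
  have e7 : w⁻¹ - w⁻¹⁻¹ = -(w ^ 2 - 1) / w := by field_simp; ring
  rw [e6, e7]
  field_simp
  ring

end Params

variable {P : Params} {V : Type*} [AddCommGroup V] [Module ℂ V] {A B : Module.End ℂ V}

/-- The characteristic polynomial of the third generator annihilates `Ω`: the vector it produces
is multiplied by `θ*_{2s+1}` under `𝖠*`, which is not an eigenvalue. -/
lemma AWPair.aeval_specPoly (hP : P.IsGeneric) (h : AWPair P A B) {Ω : V}
    (hΩ : B Ω = P.swap.thZ 0 • Ω) (hm : ∀ v, B v = P.swap.thZ (-1) • v → v = 0)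
    (hM : ∀ v, B v = P.swap.thZ (P.n + 1) • v → v = 0) :
    aeval (third P A B) P.specPoly Ω = 0 := by
  apply hM
  rw [(h.apply_aeval hP hΩ hm _).1, diffB_specPoly hP, map_mul, aeval_C,
    Module.End.mul_apply, Module.algebraMap_end_apply]

/-! ### Bethe equations and eigenvectors -/

/-- The monic polynomial with roots the spectral variables of `w₁, …, w_M`. -/
def rootPoly (P : Params) {M : ℕ} (w : Fin M → ℂ) : ℂ[X] := ∏ j, (X - C (P.xw (w j)))

lemma natDegree_rootPoly {M : ℕ} (w : Fin M → ℂ) : (rootPoly P w).natDegree = M := by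
  simp [rootPoly]

lemma coeff_rootPoly {M : ℕ} (w : Fin M → ℂ) : (rootPoly P w).coeff M = 1 := by
  have := monic_prod_X_sub_C (fun j => P.xw (w j)) Finset.univ
  rw [Monic, leadingCoeff] at this
  rwa [← rootPoly, natDegree_rootPoly] at this

lemma coeff_X_mul_rootPoly {M : ℕ} (w : Fin M → ℂ) :
    (X * rootPoly P w).coeff M = -∑ j, P.xw (w j) := by
  cases M with
  | zero => simp
  | succ M =>
    rw [coeff_X_mul, rootPoly]
    have := prod_X_sub_C_coeff_card_pred Finset.univ (fun j => P.xw (w j)) (by simp)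
    simpa using this

lemma eval_rootPoly_eq_zero {M : ℕ} (w : Fin M → ℂ) (i : Fin M) :
    (rootPoly P w).eval (P.xw (w i)) = 0 := by
  rw [rootPoly, eval_prod]
  exact Finset.prod_eq_zero (Finset.mem_univ i) (by simp)

lemma divDiff_rootPoly {M : ℕ} (w : Fin M → ℂ) (i : Fin M) (y : ℂ) :
    divDiff y (P.xw (w i)) (rootPoly P w) =
      ∏ j ∈ Finset.univ.erase i, (y - P.xw (w j)) := by
  rw [rootPoly, ← Finset.mul_prod_erase _ _ (Finset.mem_univ i), divDiff_X_sub_C_mul, eval_prod]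
  simp

/-- A polynomial of degree at most `M` that vanishes at the roots of `rootPoly P w` is a multiple
of it. -/
lemma eq_C_mul_rootPoly {M : ℕ} {w : Fin M → ℂ} (hinj : Function.Injective fun i => P.xw (w i))
    {p : ℂ[X]} (hp : p.natDegree ≤ M) (h0 : ∀ i, p.eval (P.xw (w i)) = 0) :
    p = C (p.coeff M) * rootPoly P w := by
  rw [← sub_eq_zero]
  by_contra hne
  have hdeg : (p - C (p.coeff M) * rootPoly P w).natDegree ≤ M :=
    natDegree_sub_le_of_le (m := M) (n := M) hp
      ((natDegree_C_mul_le _ _).trans (natDegree_rootPoly w).le) |>.trans (by simp)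
  have hc : (p - C (p.coeff M) * rootPoly P w).coeff M = 0 := by
    rw [coeff_sub, coeff_C_mul, coeff_rootPoly]; ring
  have hlt : (p - C (p.coeff M) * rootPoly P w).natDegree < M := by
    refine lt_of_le_of_ne hdeg fun he => ?_
    apply hne
    rw [← leadingCoeff_eq_zero, leadingCoeff, he, hc]
  apply hne
  apply Polynomial.eq_zero_of_natDegree_lt_card_of_eval_eq_zero _ hinj
  · intro i
    rw [eval_sub, h0, eval_mul, eval_rootPoly_eq_zero]; ring
  · simpa using hlt

/-- The homogeneous Bethe equations make the state an eigenvector of the operator of which `Ω` is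
an eigenvector. -/
theorem AWPair.hom_eigen (hP : P.IsGeneric) (h : AWPair P A B) {Ω : V}
    (hΩ : B Ω = P.swap.thZ 0 • Ω) (hm : ∀ v, B v = P.swap.thZ (-1) • v → v = 0)
    {M : ℕ} {w : Fin M → ℂ} (hw : ∀ i, w i ≠ 0) (hw2 : ∀ i, w i ^ 2 ≠ 1)
    (hinj : Function.Injective fun i => P.xw (w i))
    (hB : ∀ i, P.shiftB (w i) *
          ∏ j ∈ Finset.univ.erase i, (P.xw (P.q ^ 2 * w i) - P.xw (w j)) +
        P.shiftB (w i)⁻¹ *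
          ∏ j ∈ Finset.univ.erase i, (P.xw (P.q ^ 2 * (w i)⁻¹) - P.xw (w j)) = 0) :
    B (aeval (third P A B) (rootPoly P w) Ω) =
      P.swap.thZ M • aeval (third P A B) (rootPoly P w) Ω := by
  have hd := diffB_natDegree_coeff (P := P) hP.q_ne (natDegree_rootPoly (P := P) w).le
  rw [(h.apply_aeval hP hΩ hm _).1, eq_C_mul_rootPoly hinj hd.1, hd.2, coeff_rootPoly, mul_one,
    map_mul, aeval_C, Module.End.mul_apply, Module.algebraMap_end_apply]
  intro i
  rw [(eval_diff hP (hw i) (hw2 i) _).1, eval_rootPoly_eq_zero, divDiff_rootPoly,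
    divDiff_rootPoly, mul_zero, zero_add, hB]

/-- The inhomogeneous Bethe equations make the state an eigenvector of the other operator of the
pair. The inhomogeneous term is the characteristic polynomial, subtracted to lower the degree. -/
theorem AWPair.inhom_eigen (hP : P.IsGeneric) (h : AWPair P A B) {Ω : V}
    (hΩ : B Ω = P.swap.thZ 0 • Ω) (hm : ∀ v, B v = P.swap.thZ (-1) • v → v = 0)
    (hM : ∀ v, B v = P.swap.thZ (P.n + 1) • v → v = 0)
    {m : ℕ} (hn : P.n = m) {w : Fin m → ℂ} (hw : ∀ i, w i ≠ 0) (hw2 : ∀ i, w i ^ 2 ≠ 1)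
    (hinj : Function.Injective fun i => P.xw (w i))
    (hB : ∀ i, P.q⁻¹ * (w i)⁻¹ * P.shiftB (w i) *
          ∏ j ∈ Finset.univ.erase i, (P.xw (P.q ^ 2 * w i) - P.xw (w j)) +
        P.q⁻¹ * w i * P.shiftB (w i)⁻¹ *
          ∏ j ∈ Finset.univ.erase i, (P.xw (P.q ^ 2 * (w i)⁻¹) - P.xw (w j)) =
        P.q⁻¹ ^ (2 * P.n) * P.rCoef * P.specPoly.eval (P.xw (w i))) :
    A (aeval (third P A B) (rootPoly P w) Ω) =
      (P.q⁻¹ ^ (2 * P.n) * (P.tCoef - P.q ^ 2 * P.rCoef * ∑ j, P.xw (w j) +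
        P.rCoef * ∑ k ∈ Finset.range (P.n + 1),
          P.xw (P.ζ ^ 2 * P.q ^ (2 * (k : ℤ) - P.n)))) •
        aeval (third P A B) (rootPoly P w) Ω := by
  subst hn
  obtain ⟨hd1, hd2, hd3⟩ :=
    diffA_natDegree_coeff (P := P) hP.q_ne (natDegree_rootPoly (P := P) w).le
  rw [coeff_rootPoly, mul_one] at hd2
  rw [coeff_rootPoly, coeff_X_mul_rootPoly] at hd3
  have hs1 : P.specPoly.natDegree = P.n + 1 := by
    simp [specPoly]
  have hs2 : P.specPoly.coeff (P.n + 1) = 1 := by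
    have := monic_prod_X_sub_C (fun k : ℕ => P.xw (P.ζ ^ 2 * P.q ^ (2 * (k : ℤ) - P.n)))
      (Finset.range (P.n + 1))
    rw [Monic, leadingCoeff] at this
    rwa [← specPoly, hs1] at this
  have hs3 : P.specPoly.coeff P.n = -∑ k ∈ Finset.range (P.n + 1),
      P.xw (P.ζ ^ 2 * P.q ^ (2 * (k : ℤ) - P.n)) := by
    have := prod_X_sub_C_coeff_card_pred (Finset.range (P.n + 1))
      (fun k : ℕ => P.xw (P.ζ ^ 2 * P.q ^ (2 * (k : ℤ) - P.n))) (by simp)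
    simpa [specPoly] using this
  set p := P.diffA (rootPoly P w) - C (P.q⁻¹ ^ (2 * P.n) * P.rCoef) * P.specPoly with hp
  have hpdeg : p.natDegree ≤ P.n := by
    rw [natDegree_le_iff_coeff_eq_zero]
    intro N hN
    rcases (Nat.succ_le_of_lt hN).eq_or_lt with rfl | hN
    · rw [hp, coeff_sub, coeff_C_mul, Nat.succ_eq_add_one, hd2, hs2]; ring
    · rw [hp, coeff_sub, coeff_C_mul, coeff_eq_zero_of_natDegree_lt (by omega),
        coeff_eq_zero_of_natDegree_lt (by omega)]; ring
  have hpe : ∀ i, p.eval (P.xw (w i)) = 0 := by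
    intro i
    rw [hp, eval_sub, (eval_diff hP (hw i) (hw2 i) _).2, eval_rootPoly_eq_zero, divDiff_rootPoly,
      divDiff_rootPoly, mul_zero, zero_add, hB, eval_mul, eval_C, sub_self]
  have hpm := eq_C_mul_rootPoly hinj hpdeg hpe
  have hpc : p.coeff P.n = P.q⁻¹ ^ (2 * P.n) * (P.tCoef - P.q ^ 2 * P.rCoef * ∑ j, P.xw (w j) +
        P.rCoef * ∑ k ∈ Finset.range (P.n + 1),
          P.xw (P.ζ ^ 2 * P.q ^ (2 * (k : ℤ) - P.n))) := by
    rw [hp, coeff_sub, coeff_C_mul, hd3, hs3]; ring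
  have e : P.diffA (rootPoly P w) = C (p.coeff P.n) * rootPoly P w +
      C (P.q⁻¹ ^ (2 * P.n) * P.rCoef) * P.specPoly := by
    rw [← hpm, hp]; ring
  rw [(h.apply_aeval hP hΩ hm _).2, e, hpc, map_add, map_mul _ (C (_ * _)),
    map_mul _ (C (_ * _)), LinearMap.add_apply,
    Module.End.mul_apply, Module.End.mul_apply, h.aeval_specPoly hP hΩ hm hM, map_zero, add_zero,
    aeval_C, Module.algebraMap_end_apply]

/-! ### The Bethe equations in terms of the difference operators -/

/-- `w + w⁻¹`. -/
def sw (w : ℂ) : ℂ := w + w⁻¹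

lemma sw_inv (w : ℂ) : sw w⁻¹ = sw w := by simp [sw, add_comm]

lemma bf_mul_bf {x y : ℂ} (hx : x ≠ 0) (hy : y ≠ 0) :
    bf x * bf y = sw (x * y) - sw (x / y) := by
  unfold bf sw; field_simp; ring

namespace Params

variable {P : Params}

lemma xw_eq (w : ℂ) : P.xw w = -(P.q ^ 2 - P.q⁻¹ ^ 2)⁻¹ * sw w := by
  unfold xw sw; rw [div_eq_mul_inv]; ring

/-- The product `∏_k (w + w⁻¹ - y_k - y_k⁻¹)` over `y_k = ζ² q^{2k-2s}`. -/
def specProd (P : Params) (w : ℂ) : ℂ :=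
  ∏ k ∈ Finset.range (P.n + 1), (sw w - sw (P.ζ ^ 2 * P.q ^ (2 * (k : ℤ) - P.n)))

lemma eval_specPoly_eq (w : ℂ) : P.specPoly.eval (P.xw w) =
    (-(P.q ^ 2 - P.q⁻¹ ^ 2)⁻¹) ^ (P.n + 1) * P.specProd w := by
  have h2 : (-(P.q ^ 2 - P.q⁻¹ ^ 2)⁻¹) ^ (P.n + 1) =
      ∏ _k ∈ Finset.range (P.n + 1), (-(P.q ^ 2 - P.q⁻¹ ^ 2)⁻¹) := by
    rw [Finset.prod_const, Finset.card_range]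
  rw [h2, specProd, ← Finset.prod_mul_distrib, specPoly, eval_prod]
  refine Finset.prod_congr rfl fun k _ => ?_
  rw [eval_sub, eval_X, eval_C, xw_eq, xw_eq]; ring

lemma specProd_rev (w : ℂ) : P.rev.specProd w = P.specProd w := by
  unfold specProd
  rw [rev_n, ← Finset.prod_range_reflect]
  refine Finset.prod_congr rfl fun k hk => ?_
  have : k ≤ P.n := by simpa [Nat.lt_succ_iff] using hk
  rw [Nat.add_sub_cancel, Nat.cast_sub this, rev_q, rev_ζ, inv_zpow']
  congr 4
  ring

lemma specProd_swap (w : ℂ) : P.swap.specProd w = P.specProd w := by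
  unfold specProd
  rw [swap_n, ← Finset.prod_range_reflect]
  refine Finset.prod_congr rfl fun k hk => ?_
  have : k ≤ P.n := by simpa [Nat.lt_succ_iff] using hk
  rw [Nat.add_sub_cancel, Nat.cast_sub this, swap_q, swap_ζ, ← sw_inv (P.ζ ^ 2 * _), mul_inv,
    inv_pow, ← zpow_neg]
  congr 4
  ring

lemma sum_specRoots (hP : P.IsGeneric) :
    ∑ k ∈ Finset.range (P.n + 1), P.xw (P.ζ ^ 2 * P.q ^ (2 * (k : ℤ) - P.n)) =
      -(P.q ^ 2 - P.q⁻¹ ^ 2)⁻¹ * ((P.ζ ^ 2 + P.ζ⁻¹ ^ 2) *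
        ((P.q ^ ((P.n : ℤ) + 1) - P.q ^ (-(P.n : ℤ) - 1)) / (P.q - P.q⁻¹))) := by
  have hq := hP.q_ne
  have hs := hP.q_sub_inv_ne
  have h1 : ∀ k : ℕ, P.q ^ (2 * (k : ℤ) - P.n) * (P.q - P.q⁻¹) =
      P.q ^ (2 * ((k + 1 : ℕ) : ℤ) - P.n - 1) - P.q ^ (2 * (k : ℤ) - P.n - 1) := by
    intro k
    rw [zpow_sub_one₀ hq, zpow_sub_one₀ hq,
      show 2 * ((k + 1 : ℕ) : ℤ) - P.n = (2 * (k : ℤ) - P.n) + 2 by push_cast; ring,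
      zpow_add₀ hq, show P.q ^ (2 : ℤ) = P.q ^ 2 from rfl]
    field_simp
  have h2 : ∀ k : ℕ, P.q ^ (-(2 * (k : ℤ) - P.n)) * (P.q - P.q⁻¹) =
      -P.q ^ (-(2 * ((k + 1 : ℕ) : ℤ) - P.n - 1)) - -P.q ^ (-(2 * (k : ℤ) - P.n - 1)) := by
    intro k
    rw [zpow_neg, zpow_neg, zpow_neg, zpow_sub_one₀ hq, zpow_sub_one₀ hq,
      show 2 * ((k + 1 : ℕ) : ℤ) - P.n = (2 * (k : ℤ) - P.n) + 2 by push_cast; ring,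
      zpow_add₀ hq, show P.q ^ (2 : ℤ) = P.q ^ 2 from rfl]
    have := zpow_ne_zero (2 * (k : ℤ) - P.n) hq
    field_simp
    ring
  have s1 : (∑ k ∈ Finset.range (P.n + 1), P.q ^ (2 * (k : ℤ) - P.n)) * (P.q - P.q⁻¹) =
      P.q ^ ((P.n : ℤ) + 1) - P.q ^ (-(P.n : ℤ) - 1) := by
    rw [Finset.sum_mul, Finset.sum_congr rfl fun k _ => h1 k,
      Finset.sum_range_sub (fun k : ℕ => P.q ^ (2 * (k : ℤ) - P.n - 1))]
    congr 2 <;> push_cast <;> ring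
  have s2 : (∑ k ∈ Finset.range (P.n + 1), P.q ^ (-(2 * (k : ℤ) - P.n))) * (P.q - P.q⁻¹) =
      P.q ^ ((P.n : ℤ) + 1) - P.q ^ (-(P.n : ℤ) - 1) := by
    rw [Finset.sum_mul, Finset.sum_congr rfl fun k _ => h2 k,
      Finset.sum_range_sub (fun k : ℕ => -P.q ^ (-(2 * (k : ℤ) - P.n - 1))), sub_neg_eq_add,
      add_comm, ← sub_eq_add_neg]
    congr 2 <;> push_cast <;> ring
  simp only [xw_eq, ← Finset.mul_sum, sw, mul_inv, ← zpow_neg, Finset.sum_add_distrib, inv_pow]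
  rw [eq_div_of_mul_eq hs s1, eq_div_of_mul_eq hs s2]
  ring

/-- The eigenvalue of `AWPair.inhom_eigen` in closed form. -/
lemma inhom_eigenvalue (hP : P.IsGeneric) {m : ℕ} (w : Fin m → ℂ) :
    P.q⁻¹ ^ (2 * P.n) * (P.tCoef - P.q ^ 2 * P.rCoef * ∑ j, P.xw (w j) +
        P.rCoef * ∑ k ∈ Finset.range (P.n + 1),
          P.xw (P.ζ ^ 2 * P.q ^ (2 * (k : ℤ) - P.n))) =
      P.q ^ (-2 * (P.n : ℤ)) *
      (P.cs * (P.ζ ^ 2 + P.ζ⁻¹ ^ 2) * P.qNum +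
        P.q ^ (P.n : ℤ) * (P.b * P.q ^ (P.n : ℤ) + P.c * P.q ^ (-(P.n : ℤ))) -
        P.q * P.cs * ∑ j, sw (w j)) := by
  have hq := hP.q_ne
  have hs := hP.q_sub_inv_ne
  have hd := hP.q_sq_sub_inv_ne
  have e1 : P.q⁻¹ ^ (2 * P.n) = P.q ^ (-2 * (P.n : ℤ)) := by
    rw [neg_mul, zpow_neg, inv_pow, ← zpow_natCast]; push_cast; rfl
  rw [sum_specRoots hP, e1]
  congr 1
  simp only [xw_eq, ← Finset.mul_sum]
  unfold tCoef rCoef qNum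
  rw [zpow_add₀ hq, zpow_sub₀ hq, zpow_neg, zpow_one]
  have hQ : P.q ^ (P.n : ℤ) ≠ 0 := zpow_ne_zero _ hq
  generalize P.q ^ (P.n : ℤ) = Q at *
  generalize ∑ j, sw (w j) = σ
  generalize P.ζ ^ 2 + P.ζ⁻¹ ^ 2 = Z
  generalize P.q ^ 2 - P.q⁻¹ ^ 2 = d at *
  have hq2 := hP.q_sq_ne_one
  field_simp
  ring

lemma rev_tuple (w : ℂ) : P.rev.xw w = -P.xw w := by
  rw [xw_eq, xw_eq, rev_q, inv_inv, ← neg_sub, inv_neg]; ring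

/-- The inhomogeneous Bethe equations of `AWPair.inhom_eigen` in a form which does not depend on
the normalization of the spectral variable. -/
lemma inhom_bethe_of_sw {m : ℕ} (hn : P.n = m) {w : Fin m → ℂ}
    (hinj : Function.Injective fun i => sw (w i))
    (hB : ∀ i, P.q⁻¹ * (w i)⁻¹ * P.shiftB (w i) *
          ∏ j ∈ Finset.univ.erase i,
            ((sw (P.q ^ 2 * w i) - sw (w j)) / (sw (w i) - sw (w j))) +
        P.q⁻¹ * w i * P.shiftB (w i)⁻¹ *
          ∏ j ∈ Finset.univ.erase i,
            ((sw (P.q ^ 2 * (w i)⁻¹) - sw (w j)) / (sw (w i) - sw (w j))) =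
        P.q⁻¹ ^ (2 * P.n) * P.rCoef * ((P.q ^ 2 - P.q⁻¹ ^ 2)⁻¹ ^ 2) * (P.specProd (w i) /
          ∏ j ∈ Finset.univ.erase i, (sw (w i) - sw (w j)))) (i : Fin m) :
    P.q⁻¹ * (w i)⁻¹ * P.shiftB (w i) *
          ∏ j ∈ Finset.univ.erase i, (P.xw (P.q ^ 2 * w i) - P.xw (w j)) +
        P.q⁻¹ * w i * P.shiftB (w i)⁻¹ *
          ∏ j ∈ Finset.univ.erase i, (P.xw (P.q ^ 2 * (w i)⁻¹) - P.xw (w j)) =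
        P.q⁻¹ ^ (2 * P.n) * P.rCoef * P.specPoly.eval (P.xw (w i)) := by
  subst hn
  have hprod : ∀ y, ∏ j ∈ Finset.univ.erase i, (P.xw y - P.xw (w j)) =
      (-(P.q ^ 2 - P.q⁻¹ ^ 2)⁻¹) ^ (P.n - 1) *
        ∏ j ∈ Finset.univ.erase i, (sw y - sw (w j)) := by
    intro y
    have : (Finset.univ.erase i).card = P.n - 1 := by
      rw [Finset.card_erase_of_mem (Finset.mem_univ i), Finset.card_univ, Fintype.card_fin]
    rw [← this, ← Finset.prod_const, ← Finset.prod_mul_distrib]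
    refine Finset.prod_congr rfl fun k _ => ?_
    rw [xw_eq, xw_eq]; ring
  have hD : ∏ j ∈ Finset.univ.erase i, (sw (w i) - sw (w j)) ≠ 0 := by
    rw [Finset.prod_ne_zero_iff]
    intro j hj
    exact sub_ne_zero.mpr fun h => Finset.ne_of_mem_erase hj (hinj h).symm
  have h := hB i
  rw [Finset.prod_div_distrib, Finset.prod_div_distrib] at h
  have hn : P.n + 1 = (P.n - 1) + 2 := by have := i.pos; omega
  rw [hprod, hprod, eval_specPoly_eq, hn, pow_add]
  generalize (-(P.q ^ 2 - P.q⁻¹ ^ 2)⁻¹) ^ (P.n - 1) = e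
  rw [neg_sq]
  generalize (P.q ^ 2 - P.q⁻¹ ^ 2)⁻¹ ^ 2 = d2 at *
  generalize ∏ j ∈ Finset.univ.erase i, (sw (w i) - sw (w j)) = D at *
  generalize ∏ j ∈ Finset.univ.erase i, (sw (P.q ^ 2 * w i) - sw (w j)) = N at *
  generalize ∏ j ∈ Finset.univ.erase i, (sw (P.q ^ 2 * (w i)⁻¹) - sw (w j)) = N' at *
  have e1 : ∀ x, x / D * D = x := fun x => div_mul_cancel₀ x hD
  linear_combination e * D * h - P.q⁻¹ * (w i)⁻¹ * P.shiftB (w i) * e * e1 N -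
    P.q⁻¹ * w i * P.shiftB (w i)⁻¹ * e * e1 N' +
    P.q⁻¹ ^ (2 * P.n) * P.rCoef * d2 * e * e1 (P.specProd (w i))

/-- The homogeneous Bethe equations of `AWPair.hom_eigen` in a form which does not depend on
the normalization of the spectral variable. -/
lemma hom_bethe_of_sw {M : ℕ} {w : Fin M → ℂ}
    (hinj : Function.Injective fun i => sw (w i))
    (hB : ∀ i, P.shiftB (w i) *
          ∏ j ∈ Finset.univ.erase i,
            ((sw (P.q ^ 2 * w i) - sw (w j)) / (sw (w i) - sw (w j))) +
        P.shiftB (w i)⁻¹ *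
          ∏ j ∈ Finset.univ.erase i,
            ((sw (P.q ^ 2 * (w i)⁻¹) - sw (w j)) / (sw (w i) - sw (w j))) = 0) (i : Fin M) :
    P.shiftB (w i) *
          ∏ j ∈ Finset.univ.erase i, (P.xw (P.q ^ 2 * w i) - P.xw (w j)) +
        P.shiftB (w i)⁻¹ *
          ∏ j ∈ Finset.univ.erase i, (P.xw (P.q ^ 2 * (w i)⁻¹) - P.xw (w j)) = 0 := by
  have hprod : ∀ y, ∏ j ∈ Finset.univ.erase i, (P.xw y - P.xw (w j)) =
      (-(P.q ^ 2 - P.q⁻¹ ^ 2)⁻¹) ^ (M - 1) *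
        ∏ j ∈ Finset.univ.erase i, (sw y - sw (w j)) := by
    intro y
    have : (Finset.univ.erase i).card = M - 1 := by
      rw [Finset.card_erase_of_mem (Finset.mem_univ i), Finset.card_univ, Fintype.card_fin]
    rw [← this, ← Finset.prod_const, ← Finset.prod_mul_distrib]
    refine Finset.prod_congr rfl fun k _ => ?_
    rw [xw_eq, xw_eq]; ring
  have hD : ∏ j ∈ Finset.univ.erase i, (sw (w i) - sw (w j)) ≠ 0 := by
    rw [Finset.prod_ne_zero_iff]
    intro j hj
    exact sub_ne_zero.mpr fun h => Finset.ne_of_mem_erase hj (hinj h).symm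
  have h := hB i
  rw [Finset.prod_div_distrib, Finset.prod_div_distrib] at h
  rw [hprod, hprod]
  generalize (-(P.q ^ 2 - P.q⁻¹ ^ 2)⁻¹) ^ (M - 1) = e
  generalize ∏ j ∈ Finset.univ.erase i, (sw (w i) - sw (w j)) = D at *
  generalize ∏ j ∈ Finset.univ.erase i, (sw (P.q ^ 2 * w i) - sw (w j)) = N at *
  generalize ∏ j ∈ Finset.univ.erase i, (sw (P.q ^ 2 * (w i)⁻¹) - sw (w j)) = N' at *
  have e1 : ∀ x, x / D * D = x := fun x => div_mul_cancel₀ x hD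
  linear_combination e * D * h - P.shiftB (w i) * e * e1 N - P.shiftB (w i)⁻¹ * e * e1 N'

/-! ### The Bethe equations in terms of the roots -/

lemma h_eq (hq : P.q ≠ 0) {u v : ℂ} (hu : u ≠ 0) (hv : v ≠ 0) :
    P.h u v = (sw (P.q ^ 2 * (P.q * u ^ 2)) - sw (P.q * v ^ 2)) /
      (sw (P.q * u ^ 2) - sw (P.q * v ^ 2)) := by
  unfold h
  rw [bf_mul_bf (by positivity) (by positivity), bf_mul_bf (by positivity) (by positivity)]
  congr 3 <;> field_simp

lemma f_eq (hq : P.q ≠ 0) {u v : ℂ} (hu : u ≠ 0) (hv : v ≠ 0) :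
    P.f u v = (sw (P.q ^ 2 * (P.q * u ^ 2)⁻¹) - sw (P.q * v ^ 2)) /
      (sw (P.q * u ^ 2) - sw (P.q * v ^ 2)) := by
  unfold f
  have e1 : P.q * v / u * (u * v) = P.q * v ^ 2 := by field_simp
  have e2 : P.q * v / u / (u * v) = P.q ^ 2 * (P.q * u ^ 2)⁻¹ := by field_simp
  have e3 : v / u * (P.q * u * v) = P.q * v ^ 2 := by field_simp
  have e4 : v / u / (P.q * u * v) = (P.q * u ^ 2)⁻¹ := by field_simp
  rw [bf_mul_bf (by positivity) (by positivity), bf_mul_bf (by positivity) (by positivity),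
    e1, e2, e3, e4, sw_inv, ← neg_div_neg_eq, neg_sub, neg_sub]

lemma inhomTerm_eq (hP : P.IsGeneric) {u : Fin P.n → ℂ} (hu : ∀ i, u i ≠ 0) (i : Fin P.n) :
    P.inhomTerm u i = bf (u i ^ 2) / bf P.q * (P.specProd (P.q * u i ^ 2) /
      ∏ j ∈ Finset.univ.erase i, (sw (P.q * u i ^ 2) - sw (P.q * u j ^ 2))) := by
  have hp := hP.p_ne
  have hz := hP.ζ_ne
  unfold inhomTerm
  rw [mul_div_assoc]
  congr 2
  -- The factor containing `ζ` at index `k` pairs with the one containing `ζ⁻¹` at index `2s - k`.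
  · rw [Finset.prod_mul_distrib, ← Finset.prod_range_reflect
      (fun k : ℕ => bf (P.p ^ (1 + 2 * (k : ℤ) - P.n) * P.ζ⁻¹ * u i)), ← Finset.prod_mul_distrib]
    refine Finset.prod_congr rfl fun k hk => ?_
    have : k ≤ P.n := by simpa [Nat.lt_succ_iff] using hk
    rw [Nat.add_sub_cancel, Nat.cast_sub this]
    have hk1 := zpow_ne_zero (1 + 2 * (k : ℤ) - P.n) hp
    have hk2 := zpow_ne_zero (1 + 2 * ((P.n : ℤ) - k) - P.n) hp
    rw [bf_mul_bf (by simp [hk1, hz, hu]) (by simp [hk2, hz, hu])]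
    have e1 : P.p ^ (1 + 2 * (k : ℤ) - P.n) * P.p ^ (1 + 2 * ((P.n : ℤ) - k) - P.n) = P.q := by
      rw [← zpow_add₀ hp, q, ← zpow_natCast]; congr 1; push_cast; ring
    have e2 : P.p ^ (1 + 2 * (k : ℤ) - P.n) / P.p ^ (1 + 2 * ((P.n : ℤ) - k) - P.n) =
        P.q ^ (2 * (k : ℤ) - P.n) := by
      rw [← zpow_sub₀ hp, q, ← zpow_natCast, ← zpow_mul]; congr 1; push_cast; ring
    congr 2
    · rw [← e1]; have := hu i; field_simp
    · rw [← e2]; have := hu i; field_simp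
  · refine Finset.prod_congr rfl fun j _ => ?_
    have hq := hP.q_ne
    have h1 := hu i
    have h2 := hu j
    have e1 : u i / u j * (P.q * u i * u j) = P.q * u i ^ 2 := by field_simp
    have e2 : u i / u j / (P.q * u i * u j) = (P.q * u j ^ 2)⁻¹ := by field_simp
    rw [bf_mul_bf (by positivity) (by positivity), e1, e2, sw_inv]

lemma sw_injective {M : ℕ} {u : Fin M → ℂ} (hu : P.IsAdmissible u) :
    Function.Injective fun i => sw (P.q * u i ^ 2) := by
  intro i j hij
  apply hu.symRoot_inj
  have e : ∀ x, P.symRoot x = sw (P.q * x ^ 2) / (P.q + P.q⁻¹) := by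
    intro x; unfold symRoot sw; rw [mul_inv, inv_pow]
  simp only at hij ⊢
  rw [e, e, hij]

lemma sq_ne_one (hP : P.IsGeneric) {M : ℕ} {u : Fin M → ℂ} (hu : P.IsAdmissible u) (i : Fin M) :
    (P.q * u i ^ 2) ^ 2 ≠ 1 := by
  have h1 := hu.bf_q_sq_ne i
  have h2 := hP.q_ne
  have h3 := hu.ne_zero i
  intro h
  apply h1
  unfold bf
  rw [sub_eq_zero]
  exact eq_inv_of_mul_eq_one_left (by rw [← sq]; exact h)

lemma Λ₁_one (u : ℂ) : P.Λ₁ 1 u = P.q ^ (-(P.n : ℤ) - 1) / u *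
    (P.q ^ ((P.n : ℤ) + 1) * u * P.ζ⁻¹ - u⁻¹ * P.ζ) *
    (P.q ^ ((P.n : ℤ) + 1) * u * P.ζ - u⁻¹ * P.ζ⁻¹) *
    (u * P.cs * P.q ^ (-(P.n : ℤ)) + u⁻¹ * P.b * P.q ^ (P.n : ℤ)) *
    (u + u⁻¹ * (P.bs / P.b)) := by
  simp [Λ₁]

lemma Λ₁_neg_one (u : ℂ) : P.Λ₁ (-1) u = P.q ^ (-(P.n : ℤ) - 1) * u *
    (P.q ^ ((P.n : ℤ) + 1) * u * P.ζ⁻¹ - u⁻¹ * P.ζ) *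
    (P.q ^ ((P.n : ℤ) + 1) * u * P.ζ - u⁻¹ * P.ζ⁻¹) *
    (u * P.cs * P.q ^ (-(P.n : ℤ)) + u⁻¹ * P.b * P.q ^ (P.n : ℤ)) *
    (u * (P.c / P.cs) + u⁻¹) := by
  simp [Λ₁]

lemma Λ₂_one (u : ℂ) : P.Λ₂ 1 u = (u ^ 2 - u⁻¹ ^ 2) * P.q ^ (-(P.n : ℤ) - 1) /
      (u * (P.q * u ^ 2 - P.q⁻¹ * u⁻¹ ^ 2)) *
    (P.q ^ ((P.n : ℤ) - 1) * u⁻¹ * P.ζ - u * P.ζ⁻¹) *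
    (P.q ^ ((P.n : ℤ) - 1) * u⁻¹ * P.ζ⁻¹ - u * P.ζ) *
    (P.q ^ 2 * u * P.b * P.q ^ (P.n : ℤ) + u⁻¹ * P.cs * P.q ^ (-(P.n : ℤ))) *
    (P.q ^ 2 * u * (P.bs / P.b) + u⁻¹) := by
  simp [Λ₂]

lemma Λ₂_neg_one (u : ℂ) : P.Λ₂ (-1) u = (u ^ 2 - u⁻¹ ^ 2) * P.q ^ (-(P.n : ℤ) - 1) /
      (u⁻¹ * (P.q * u ^ 2 - P.q⁻¹ * u⁻¹ ^ 2)) *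
    (P.q ^ ((P.n : ℤ) - 1) * u⁻¹ * P.ζ - u * P.ζ⁻¹) *
    (P.q ^ ((P.n : ℤ) - 1) * u⁻¹ * P.ζ⁻¹ - u * P.ζ) *
    (P.q ^ 2 * u * P.b * P.q ^ (P.n : ℤ) + u⁻¹ * P.cs * P.q ^ (-(P.n : ℤ))) *
    (P.q ^ 2 * u + u⁻¹ * (P.c / P.cs)) := by
  simp [Λ₂]

/-- The shift coefficients of `diffA` are, up to a common factor, those of the equations
`inhomEPlus = 0`. -/
lemma shift_plus (hP : P.IsGeneric) {u : ℂ} (hu : u ≠ 0) (hu2 : (P.q * u ^ 2) ^ 2 ≠ 1) :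
    ((u⁻¹ ^ 2 * bf (u ^ 2) * (P.q + P.q⁻¹)) *
        (P.q⁻¹ * (P.q * u ^ 2)⁻¹ * P.shiftB (P.q * u ^ 2)) =
      -((P.q ^ 2 * u ^ 3)⁻¹ * P.Λ₂ 1 u)) ∧
    (u⁻¹ ^ 2 * bf (u ^ 2) * (P.q + P.q⁻¹)) *
        (P.q⁻¹ * (P.q * u ^ 2) * P.shiftB (P.q * u ^ 2)⁻¹) =
      bf (u ^ 2) / bf (P.q * u ^ 2) * u * P.Λ₁ 1 u := by
  have hq := hP.q_ne
  have hq4 := hP.q_sq_add_one_ne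
  have hb := hP.b_ne
  have hcs := hP.cs_ne
  have hz := hP.ζ_ne
  rw [Λ₂_one, Λ₁_one]
  unfold shiftB bf
  have hw2' : (P.q * u ^ 2) ^ 2 - 1 ≠ 0 := sub_ne_zero.mpr hu2
  have e6 : P.q * u ^ 2 - (P.q * u ^ 2)⁻¹ = ((P.q * u ^ 2) ^ 2 - 1) / (P.q * u ^ 2) := by
    field_simp
  have e7 : (P.q * u ^ 2)⁻¹ - (P.q * u ^ 2)⁻¹⁻¹ = -((P.q * u ^ 2) ^ 2 - 1) / (P.q * u ^ 2) := by
    field_simp; ring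
  have e8 : P.q * u ^ 2 - P.q⁻¹ * u⁻¹ ^ 2 = ((P.q * u ^ 2) ^ 2 - 1) / (P.q * u ^ 2) := by
    field_simp
  rw [e6, e7, e8, zpow_add₀ hq, zpow_sub₀ hq, zpow_sub₀ hq, zpow_neg, zpow_one]
  have hQ : P.q ^ (P.n : ℤ) ≠ 0 := zpow_ne_zero _ hq
  generalize P.q ^ (P.n : ℤ) = Q at *
  generalize (P.q * u ^ 2) ^ 2 - 1 = d at *
  constructor <;> field_simp <;> ring

end Params

namespace Params

variable {P : Params}

/-- The shift coefficients of the operator `diffB` attached to `P.swap` are, up to a common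
factor, those of the homogeneous equations. -/
lemma shift_hom (hP : P.IsGeneric) {u : ℂ} (hu : u ≠ 0) (hu2 : (P.q * u ^ 2) ^ 2 ≠ 1) :
    (-(u * bf (u ^ 2) * (P.q + P.q⁻¹)) * P.swap.shiftB (P.q * u ^ 2) = P.Λ₂ (-1) u) ∧
    -(u * bf (u ^ 2) * (P.q + P.q⁻¹)) * P.swap.shiftB (P.q * u ^ 2)⁻¹ =
      -(bf (u ^ 2) / bf (P.q * u ^ 2)) * P.Λ₁ (-1) u := by
  have hq := hP.q_ne
  have hq4 := hP.q_sq_add_one_ne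
  have hb := hP.b_ne
  have hbs := hP.bs_ne
  have hcs := hP.cs_ne
  have hz := hP.ζ_ne
  have hc : P.c = P.bs * P.cs / P.b := by
    rw [eq_div_iff hP.b_ne, ← hP.bc_eq, mul_comm]
  rw [Λ₂_neg_one, Λ₁_neg_one]
  unfold shiftB bf
  simp only [swap_n, swap_q, swap_b, swap_bs, swap_cs, swap_ζ, hc, inv_inv]
  have hw2' : (P.q * u ^ 2) ^ 2 - 1 ≠ 0 := sub_ne_zero.mpr hu2
  have e6 : P.q * u ^ 2 - (P.q * u ^ 2)⁻¹ = ((P.q * u ^ 2) ^ 2 - 1) / (P.q * u ^ 2) := by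
    field_simp
  have e7 : (P.q * u ^ 2)⁻¹ - P.q * u ^ 2 = -((P.q * u ^ 2) ^ 2 - 1) / (P.q * u ^ 2) := by
    field_simp; ring
  have e8 : P.q * u ^ 2 - P.q⁻¹ * u⁻¹ ^ 2 = ((P.q * u ^ 2) ^ 2 - 1) / (P.q * u ^ 2) := by
    field_simp
  rw [e6, e7, e8, zpow_add₀ hq, zpow_sub₀ hq, zpow_sub₀ hq, zpow_neg, zpow_one]
  have hQ : P.q ^ (P.n : ℤ) ≠ 0 := zpow_ne_zero _ hq
  generalize P.q ^ (P.n : ℤ) = Q at *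
  generalize (P.q * u ^ 2) ^ 2 - 1 = d at *
  constructor <;> field_simp <;> ring

lemma shift_dual (hP : P.IsGeneric) {u : ℂ} (hu : u ≠ 0) (hu2 : (P.q * u ^ 2) ^ 2 ≠ 1) :
    ((bf (u ^ 2) * (P.q + P.q⁻¹)) *
        (P.q⁻¹ * (P.q * u ^ 2)⁻¹ * P.swap.shiftB (P.q * u ^ 2)) =
      -((P.q ^ 2 * u ^ 3)⁻¹ * P.Λ₂ (-1) u)) ∧
    (bf (u ^ 2) * (P.q + P.q⁻¹)) *
        (P.q⁻¹ * (P.q * u ^ 2) * P.swap.shiftB (P.q * u ^ 2)⁻¹) =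
      bf (u ^ 2) / bf (P.q * u ^ 2) * u * P.Λ₁ (-1) u := by
  have hq := hP.q_ne
  obtain ⟨h1, h2⟩ := shift_hom hP hu hu2
  constructor
  · rw [← h1]; field_simp
  · have : bf (u ^ 2) / bf (P.q * u ^ 2) * u * P.Λ₁ (-1) u =
        -(u * (-(bf (u ^ 2) / bf (P.q * u ^ 2)) * P.Λ₁ (-1) u)) := by ring
    rw [this, ← h2]; field_simp

/-- The shift coefficients of the operator `diffA` attached to `P.rev` are, up to a common
factor, those of the equations `inhomEMinus = 0`. -/
lemma shift_minus (hP : P.IsGeneric) {u : ℂ} (hu : u ≠ 0) (hu2 : (P.q * u ^ 2) ^ 2 ≠ 1) :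
    (-(u ^ 2 * bf (u ^ 2) * (P.q + P.q⁻¹)) *
        (P.q * (P.q * u ^ 2)⁻¹ * P.rev.shiftB (P.q * u ^ 2)) =
      bf (u ^ 2) / bf (P.q * u ^ 2) * u⁻¹ * P.Λ₁ (-1) u) ∧
    -(u ^ 2 * bf (u ^ 2) * (P.q + P.q⁻¹)) *
        (P.q * (P.q * u ^ 2) * P.rev.shiftB (P.q * u ^ 2)⁻¹) =
      -(P.q ^ 2 * u ^ 3 * P.Λ₂ (-1) u) := by
  have hq := hP.q_ne
  have hq4 : 1 + P.q ^ 2 ≠ 0 := by rw [add_comm]; exact hP.q_sq_add_one_ne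
  have hb := hP.b_ne
  have hcs := hP.cs_ne
  have hz := hP.ζ_ne
  rw [Λ₂_neg_one, Λ₁_neg_one]
  unfold shiftB bf
  simp only [rev_n, rev_q, rev_b, rev_bs, rev_cs, rev_ζ, inv_inv]
  have hw2' : (P.q * u ^ 2) ^ 2 - 1 ≠ 0 := sub_ne_zero.mpr hu2
  have e6 : P.q * u ^ 2 - (P.q * u ^ 2)⁻¹ = ((P.q * u ^ 2) ^ 2 - 1) / (P.q * u ^ 2) := by
    field_simp
  have e7 : (P.q * u ^ 2)⁻¹ - P.q * u ^ 2 = -((P.q * u ^ 2) ^ 2 - 1) / (P.q * u ^ 2) := by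
    field_simp; ring
  have e8 : P.q * u ^ 2 - P.q⁻¹ * u⁻¹ ^ 2 = ((P.q * u ^ 2) ^ 2 - 1) / (P.q * u ^ 2) := by
    field_simp
  simp only [inv_zpow', neg_neg, neg_sub, neg_add]
  rw [e6, e7, e8, sub_neg_eq_add, ← sub_eq_add_neg, add_comm (1 : ℤ), zpow_add₀ hq, zpow_sub₀ hq,
    zpow_sub₀ hq, zpow_neg, zpow_one]
  have hQ : P.q ^ (P.n : ℤ) ≠ 0 := zpow_ne_zero _ hq
  generalize P.q ^ (P.n : ℤ) = Q at *
  generalize (P.q * u ^ 2) ^ 2 - 1 = d at *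
  constructor <;> field_simp <;> ring

/-- The coefficient of the inhomogeneous term. -/
lemma inhom_coef (hP : P.IsGeneric) :
    (P.q + P.q⁻¹) * (P.q⁻¹ ^ (2 * P.n) * P.rCoef * (P.q ^ 2 - P.q⁻¹ ^ 2)⁻¹ ^ 2) =
      -(P.q ^ (-1 - 2 * (P.n : ℤ)) * P.cs / bf P.q) := by
  have hq := hP.q_ne
  have hqq := hP.q_add_inv_ne
  have e2 : P.q ^ (-1 - 2 * (P.n : ℤ)) = P.q⁻¹ * P.q⁻¹ ^ (2 * P.n) := by
    rw [zpow_sub₀ hq, zpow_neg_one, div_eq_mul_inv, inv_pow, ← zpow_natCast]; push_cast; rfl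
  have e3 : P.q ^ 2 - P.q⁻¹ ^ 2 = (P.q + P.q⁻¹) * bf P.q := by unfold bf; ring
  have hbq : bf P.q ≠ 0 := hP.q_sub_inv_ne
  rw [e2, rCoef, e3]
  generalize P.q⁻¹ ^ (2 * P.n) = Q
  generalize bf P.q = d at *
  generalize P.q + P.q⁻¹ = e at *
  field_simp

end Params

variable {P : Params} {V : Type*} [AddCommGroup V] [Module ℂ V] {A B : Module.End ℂ V}

lemma prod_h_eq (hq : P.q ≠ 0) {M : ℕ} {u : Fin M → ℂ} (hu : ∀ i, u i ≠ 0) (i : Fin M) :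
    ∏ j ∈ Finset.univ.erase i, P.h (u i) (u j) = ∏ j ∈ Finset.univ.erase i,
      ((sw (P.q ^ 2 * (P.q * u i ^ 2)) - sw (P.q * u j ^ 2)) /
        (sw (P.q * u i ^ 2) - sw (P.q * u j ^ 2))) :=
  Finset.prod_congr rfl fun j _ => h_eq hq (hu i) (hu j)

lemma prod_f_eq (hq : P.q ≠ 0) {M : ℕ} {u : Fin M → ℂ} (hu : ∀ i, u i ≠ 0) (i : Fin M) :
    ∏ j ∈ Finset.univ.erase i, P.f (u i) (u j) = ∏ j ∈ Finset.univ.erase i,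
      ((sw (P.q ^ 2 * (P.q * u i ^ 2)⁻¹) - sw (P.q * u j ^ 2)) /
        (sw (P.q * u i ^ 2) - sw (P.q * u j ^ 2))) :=
  Finset.prod_congr rfl fun j _ => f_eq hq (hu i) (hu j)

/-- The vector `∏_j (X - x_j) Ω`, where `X` is the third generator and `x_j` the spectral variable
of the root `u_j`. -/
def rootVec (P : Params) (A B : Module.End ℂ V) {M : ℕ} (u : Fin M → ℂ) (Ω : V) : V :=
  aeval (third P A B) (rootPoly P fun j => P.q * u j ^ 2) Ω

lemma xw_injective (hP : P.IsGeneric) {M : ℕ} {u : Fin M → ℂ} (hu : P.IsAdmissible u) :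
    Function.Injective fun i => P.xw (P.q * u i ^ 2) := by
  intro i j hij
  apply sw_injective hu
  simp only [xw_eq] at hij ⊢
  exact mul_left_cancel₀ (neg_ne_zero.mpr (inv_ne_zero hP.q_sq_sub_inv_ne)) hij

lemma sum_sw (P : Params) {M : ℕ} (u : Fin M → ℂ) :
    ∑ j, sw (P.q * u j ^ 2) = ∑ j, (P.q * u j ^ 2 + P.q⁻¹ * (u j)⁻¹ ^ 2) :=
  Finset.sum_congr rfl fun j _ => by unfold sw; rw [mul_inv, inv_pow]

theorem AWPair.inhomPlus_eigen (hP : P.IsGeneric) (h : AWPair P A B) {Ω : V}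
    (hΩ : B Ω = P.swap.thZ 0 • Ω) (hm : ∀ v, B v = P.swap.thZ (-1) • v → v = 0)
    (hM : ∀ v, B v = P.swap.thZ (P.n + 1) • v → v = 0) {M : ℕ} {u : Fin P.n → ℂ}
    (hu : P.IsInhomPlus M u) :
    A (rootVec P A B u Ω) = P.θ M • rootVec P A B u Ω := by
  obtain ⟨ha, hE, hθ⟩ := hu
  have hq := hP.q_ne
  have hw : ∀ i, P.q * u i ^ 2 ≠ 0 := fun i => mul_ne_zero hq (pow_ne_zero 2 (ha.ne_zero i))
  rw [rootVec, h.inhom_eigen hP hΩ hm hM rfl hw (sq_ne_one hP ha) (xw_injective hP ha),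
    inhom_eigenvalue hP, sum_sw, ← hθ]
  apply inhom_bethe_of_sw rfl (sw_injective ha)
  intro i
  have hui := ha.ne_zero i
  have hb2 := ha.bf_sq_ne i
  have hqq := hP.q_add_inv_ne
  have hqs := hP.q_sub_inv_ne
  obtain ⟨s1, s2⟩ := shift_plus hP hui (sq_ne_one hP ha i)
  have hEi := hE i
  unfold inhomEPlus at hEi
  rw [prod_h_eq hq ha.ne_zero, prod_f_eq hq ha.ne_zero, inhomTerm_eq hP ha.ne_zero] at hEi
  have hl : (u i)⁻¹ ^ 2 * bf (u i ^ 2) * (P.q + P.q⁻¹) ≠ 0 := by positivity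
  apply mul_left_cancel₀ hl
  have e1 := inhom_coef hP
  generalize ∏ j ∈ Finset.univ.erase i, ((sw (P.q ^ 2 * (P.q * u i ^ 2)) - sw (P.q * u j ^ 2)) /
    (sw (P.q * u i ^ 2) - sw (P.q * u j ^ 2))) = H at *
  generalize ∏ j ∈ Finset.univ.erase i, ((sw (P.q ^ 2 * (P.q * u i ^ 2)⁻¹) - sw (P.q * u j ^ 2)) /
    (sw (P.q * u i ^ 2) - sw (P.q * u j ^ 2))) = F at *
  generalize P.specProd (P.q * u i ^ 2) / _ = S at *
  linear_combination hEi + H * s1 + F * s2 - (u i)⁻¹ ^ 2 * bf (u i ^ 2) * S * e1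

/-- The equations `dualInhomEMinus = 0` are those of the transposed pair. -/
theorem AWPair.inhomDual_eigen (hP : P.IsGeneric) (h : AWPair P.swap A B) {Ω : V}
    (hΩ : B Ω = P.thZ 0 • Ω) (hm : ∀ v, B v = P.thZ (-1) • v → v = 0)
    (hM : ∀ v, B v = P.thZ (P.n + 1) • v → v = 0) {N : ℕ} {u : Fin P.n → ℂ}
    (hu : P.IsDualInhomMinus N u) :
    A (rootVec P.swap A B u Ω) = P.θs N • rootVec P.swap A B u Ω := by
  obtain ⟨ha, hE, hθ⟩ := hu
  have hq := hP.q_ne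
  have hw : ∀ i, P.q * u i ^ 2 ≠ 0 := fun i => mul_ne_zero hq (pow_ne_zero 2 (ha.ne_zero i))
  rw [rootVec]
  have hz : P.swap.ζ⁻¹ = P.ζ := inv_inv _
  have key := h.inhom_eigen hP.swap (m := P.n) (w := fun i => P.q * u i ^ 2) (by rwa [swap_swap])
    (by rwa [swap_swap]) (by rwa [swap_swap, swap_n]) rfl hw (sq_ne_one hP ha) (xw_injective hP ha) ?_
  · refine key.trans ?_
    rw [inhom_eigenvalue hP.swap]
    have e := sum_sw P u
    rw [e, hθ, hz, swap_ζ, add_comm (P.ζ⁻¹ ^ 2)]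
    rfl
  apply inhom_bethe_of_sw (P := P.swap) (m := P.n) rfl (sw_injective ha)
  intro i
  have hui := ha.ne_zero i
  have hb2 := ha.bf_sq_ne i
  have hqq := hP.q_add_inv_ne
  obtain ⟨s1, s2⟩ := shift_dual hP hui (sq_ne_one hP ha i)
  have hEi := hE i
  unfold dualInhomEMinus at hEi
  rw [prod_h_eq hq ha.ne_zero, prod_f_eq hq ha.ne_zero, inhomTerm_eq hP ha.ne_zero] at hEi
  have hl : bf (u i ^ 2) * (P.q + P.q⁻¹) ≠ 0 := by positivity
  apply mul_left_cancel₀ hl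
  have e1 := inhom_coef hP.swap
  rw [specProd_swap]
  simp only [swap_n, swap_q, swap_cs] at e1 ⊢
  generalize ∏ j ∈ Finset.univ.erase i, ((sw (P.q ^ 2 * (P.q * u i ^ 2)) - sw (P.q * u j ^ 2)) /
    (sw (P.q * u i ^ 2) - sw (P.q * u j ^ 2))) = H at *
  generalize ∏ j ∈ Finset.univ.erase i, ((sw (P.q ^ 2 * (P.q * u i ^ 2)⁻¹) - sw (P.q * u j ^ 2)) /
    (sw (P.q * u i ^ 2) - sw (P.q * u j ^ 2))) = F at *
  generalize P.specProd (P.q * u i ^ 2) / _ = S at *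
  linear_combination hEi + H * s1 + F * s2 - bf (u i ^ 2) * S * e1

theorem AWPair.homDual_eigen (hP : P.IsGeneric) (h : AWPair P.swap A B) {Ω : V}
    (hΩ : B Ω = P.thZ 0 • Ω) (hm : ∀ v, B v = P.thZ (-1) • v → v = 0)
    {M : ℕ} {u : Fin M → ℂ} (hu : P.IsHomMinus u) :
    B (rootVec P.swap A B u Ω) = P.θ M • rootVec P.swap A B u Ω := by
  obtain ⟨ha, hE⟩ := hu
  have hq := hP.q_ne
  have hw : ∀ i, P.q * u i ^ 2 ≠ 0 := fun i => mul_ne_zero hq (pow_ne_zero 2 (ha.ne_zero i))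
  rw [rootVec]
  have key := h.hom_eigen hP.swap (w := fun i => P.q * u i ^ 2) (by rwa [swap_swap])
    (by rwa [swap_swap]) hw (sq_ne_one hP ha) (xw_injective hP ha) ?_
  · refine key.trans ?_
    rw [swap_swap]; rfl
  apply hom_bethe_of_sw (P := P.swap) (sw_injective ha)
  intro i
  have hui := ha.ne_zero i
  have hb2 := ha.bf_sq_ne i
  have hqq := hP.q_add_inv_ne
  obtain ⟨s1, s2⟩ := shift_hom hP hui (sq_ne_one hP ha i)
  have hEi := hE i
  unfold homE at hEi
  rw [prod_h_eq hq ha.ne_zero, prod_f_eq hq ha.ne_zero] at hEi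
  have hl : -(u i * bf (u i ^ 2) * (P.q + P.q⁻¹)) ≠ 0 := neg_ne_zero.mpr (by positivity)
  apply mul_left_cancel₀ hl
  simp only [swap_q]
  generalize ∏ j ∈ Finset.univ.erase i, ((sw (P.q ^ 2 * (P.q * u i ^ 2)) - sw (P.q * u j ^ 2)) /
    (sw (P.q * u i ^ 2) - sw (P.q * u j ^ 2))) = H at *
  generalize ∏ j ∈ Finset.univ.erase i, ((sw (P.q ^ 2 * (P.q * u i ^ 2)⁻¹) - sw (P.q * u j ^ 2)) /
    (sw (P.q * u i ^ 2) - sw (P.q * u j ^ 2))) = F at *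
  linear_combination hEi + H * s1 + F * s2

lemma aeval_third_rev (hP : P.IsGeneric) {M : ℕ} (w : Fin M → ℂ) :
    aeval (third P.rev B A) (rootPoly P.rev w) =
      (-1 : ℂ) ^ M • aeval (third P A B) (rootPoly P w) := by
  have e : (rootPoly P.rev w).comp (-X) = C ((-1) ^ M) * rootPoly P w := by
    unfold rootPoly
    have : (C ((-1) ^ M) : ℂ[X]) = ∏ _j : Fin M, C (-1) := by simp
    rw [this, ← Finset.prod_mul_distrib, Polynomial.prod_comp]
    refine Finset.prod_congr rfl fun j _ => ?_
    rw [sub_comp, X_comp, C_comp, rev_tuple, C_neg, C_neg, C_1]; ring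
  have e2 : third P.rev B A = aeval (third P A B) (-X : ℂ[X]) := by
    rw [third_rev hP, map_neg, aeval_X]
  rw [e2, ← aeval_comp, e, map_mul, aeval_C, Algebra.algebraMap_eq_smul_one, smul_mul_assoc,
    one_mul]

/-- The equations `inhomEMinus = 0` are those of the pair with `q` inverted. -/
theorem AWPair.inhomMinus_eigen (hP : P.IsGeneric) (h : AWPair P A B) {Ω : V}
    (hΩ : A Ω = P.thZ 0 • Ω) (hm : ∀ v, A v = P.thZ (-1) • v → v = 0)
    (hM : ∀ v, A v = P.thZ (P.n + 1) • v → v = 0) {N : ℕ} {u : Fin P.n → ℂ}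
    (hu : P.IsInhomMinus N u) :
    B (rootVec P A B u Ω) = P.θs N • rootVec P A B u Ω := by
  obtain ⟨ha, hE, hθ⟩ := hu
  have hq := hP.q_ne
  have hw : ∀ i, P.q * u i ^ 2 ≠ 0 := fun i => mul_ne_zero hq (pow_ne_zero 2 (ha.ne_zero i))
  have hinj : Function.Injective fun i => P.rev.xw (P.q * u i ^ 2) := by
    intro i j hij
    apply xw_injective hP ha
    simpa only [rev_tuple, neg_inj] using hij
  have key := (h.rev hP).inhom_eigen hP.rev (m := P.n) (w := fun i => P.q * u i ^ 2)
    (by rwa [rev_swap_thZ]) (by simpa only [rev_swap_thZ] using hm)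
    (by simpa only [rev_swap_thZ, rev_n] using hM) rfl hw (sq_ne_one hP ha) hinj ?_
  · rw [aeval_third_rev hP, inhom_eigenvalue hP.rev] at key
    rw [rootVec]
    rw [LinearMap.smul_apply, map_smul, smul_comm] at key
    have key := smul_right_injective V (pow_ne_zero P.n (neg_ne_zero.mpr one_ne_zero)) key
    refine key.trans ?_
    have e := sum_sw P u
    simp only [rev_n, rev_q, rev_b, rev_c, rev_cs, rev_ζ, qNum, inv_inv, inv_zpow', neg_neg,
      neg_mul] at e ⊢
    rw [e, hθ, qNum, ← neg_div_neg_eq, neg_sub, neg_sub]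
    congr 2
    ring
  apply inhom_bethe_of_sw (P := P.rev) (m := P.n) rfl (sw_injective ha)
  intro i
  have hui := ha.ne_zero i
  have hb2 := ha.bf_sq_ne i
  have hqq := hP.q_add_inv_ne
  obtain ⟨s1, s2⟩ := shift_minus hP hui (sq_ne_one hP ha i)
  have hEi := hE i
  unfold inhomEMinus at hEi
  rw [prod_h_eq hq ha.ne_zero, prod_f_eq hq ha.ne_zero, inhomTerm_eq hP ha.ne_zero] at hEi
  have hl : -(u i ^ 2 * bf (u i ^ 2) * (P.q + P.q⁻¹)) ≠ 0 := neg_ne_zero.mpr (by positivity)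
  apply mul_left_cancel₀ hl
  have e1 := inhom_coef hP.rev
  have e3 : bf P.q⁻¹ = -bf P.q := by unfold bf; rw [inv_inv]; ring
  have e4 : sw (P.q⁻¹ ^ 2 * (P.q * u i ^ 2)) = sw (P.q ^ 2 * (P.q * u i ^ 2)⁻¹) := by
    rw [← sw_inv, mul_inv]; simp
  have e5 : sw (P.q⁻¹ ^ 2 * (P.q * u i ^ 2)⁻¹) = sw (P.q ^ 2 * (P.q * u i ^ 2)) := by
    rw [← sw_inv, mul_inv]; simp
  rw [specProd_rev]
  simp only [rev_n, rev_q, rev_cs, inv_inv, inv_zpow', e3, e4, e5,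
    show -(-1 - 2 * (P.n : ℤ)) = 1 + 2 * P.n by ring] at e1 ⊢
  generalize ∏ j ∈ Finset.univ.erase i, ((sw (P.q ^ 2 * (P.q * u i ^ 2)) - sw (P.q * u j ^ 2)) /
    (sw (P.q * u i ^ 2) - sw (P.q * u j ^ 2))) = H at *
  generalize ∏ j ∈ Finset.univ.erase i, ((sw (P.q ^ 2 * (P.q * u i ^ 2)⁻¹) - sw (P.q * u j ^ 2)) /
    (sw (P.q * u i ^ 2) - sw (P.q * u j ^ 2))) = F at *
  generalize P.specProd (P.q * u i ^ 2) / _ = S at *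
  linear_combination hEi + H * s2 + F * s1 + u i ^ 2 * bf (u i ^ 2) * S * e1

/-! ### Tridiagonal action on the eigenbases -/

/-- An Askey-Wilson pair acting irreducibly, with eigenbases of both operators normalized by the
subdiagonal coefficients. The dimension `n + 1` is a free index so that the exchange of the two
operators preserves the structure. -/
structure LeonardData (P : Params) {V : Type*} [AddCommGroup V] [Module ℂ V] {n : ℕ}
    (A B : Module.End ℂ V) (e e' : Module.Basis (Fin (n + 1)) ℂ V) : Prop where
  dim : P.n = n
  pair : AWPair P A B
  eigA : ∀ M, A (e M) = P.thZ (M : ℕ) • e M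
  eigB : ∀ N, B (e' N) = P.swap.thZ (N : ℕ) • e' N
  irr : ∀ W : Submodule ℂ V, (∀ w ∈ W, A w ∈ W) → (∀ w ∈ W, B w ∈ W) → W = ⊥ ∨ W = ⊤
  normB : ∀ i : Fin n, e.coord i.succ (B (e i.castSucc)) = P.coefAs (i + 1)
  normA : ∀ i : Fin n, e'.coord i.succ (A (e' i.castSucc)) = P.coefA (i + 1)

lemma coord_apply_sum {V ι : Type*} [AddCommGroup V] [Module ℂ V] [Fintype ι]
    (e : Module.Basis ι ℂ V) (T : Module.End ℂ V) (k : ι) (v : V) :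
    e.coord k (T v) = ∑ j, e.coord j v * e.coord k (T (e j)) := by
  have hv : e.coord k (T v) = e.coord k (T (∑ j, e.repr v j • e j)) := by rw [e.sum_repr]
  rw [hv, map_sum, map_sum]
  refine Finset.sum_congr rfl fun j _ => ?_
  rw [map_smul, map_smul, smul_eq_mul, e.coord_apply j]

/-- If the matrix of `T` vanishes below the subdiagonal, then the `m`-th coordinate of `p(T) e₀`,
for `p` of degree at most `m`, is the leading coefficient times the product of the subdiagonal
entries. -/
lemma coord_aeval {V : Type*} [AddCommGroup V] [Module ℂ V] {n : ℕ}
    {e : Module.Basis (Fin (n + 1)) ℂ V} {T : Module.End ℂ V}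
    (hT : ∀ j k : Fin (n + 1), (j : ℕ) + 1 < k → e.coord k (T (e j)) = 0)
    {t : ℕ → ℂ} (ht : ∀ j k : Fin (n + 1), (j : ℕ) + 1 = k → e.coord k (T (e j)) = t j)
    {p : ℂ[X]} {m : Fin (n + 1)} (hp : p.natDegree ≤ m) :
    e.coord m (aeval T p (e 0)) = p.coeff m * ∏ i ∈ Finset.range m, t i := by
  have hpow : ∀ (i : ℕ) (k : Fin (n + 1)), (i < k → e.coord k ((T ^ i) (e 0)) = 0) ∧
      (i = k → e.coord k ((T ^ i) (e 0)) = ∏ i ∈ Finset.range k, t i) := by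
    intro i
    induction i with
    | zero =>
      intro k
      rw [pow_zero, Module.End.one_apply, e.coord_apply, e.repr_self]
      constructor
      · intro h
        rw [Finsupp.single_apply, if_neg]
        rintro rfl
        simp at h
      · intro h
        have : k = 0 := Fin.ext h.symm
        subst this
        simp
    | succ i ih =>
      intro k
      rw [pow_succ', Module.End.mul_apply, coord_apply_sum]
      constructor
      · intro h
        refine Finset.sum_eq_zero fun j _ => ?_
        rcases lt_or_ge i (j : ℕ) with hj | hj
        · rw [(ih j).1 hj, zero_mul]
        · rw [hT j k (by omega), mul_zero]
      · intro h
        have hi : i < n + 1 := by omega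
        rw [Finset.sum_eq_single (⟨i, hi⟩ : Fin (n + 1)), (ih _).2 rfl, ht _ _ h, ← h,
          Finset.prod_range_succ]
        · intro j _ hj
          have hj' : (j : ℕ) ≠ i := fun h => hj (Fin.ext h)
          rcases lt_or_gt_of_ne hj' with hj | hj
          · rw [hT j k (by omega), mul_zero]
          · rw [(ih j).1 hj, zero_mul]
        · simp
  rw [aeval_eq_sum_range' (Nat.lt_succ_of_le hp), LinearMap.sum_apply, map_sum,
    Finset.sum_range_succ, Finset.sum_eq_zero, zero_add, LinearMap.smul_apply, map_smul,
    (hpow _ _).2 rfl, smul_eq_mul]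
  intro i hi
  rw [LinearMap.smul_apply, map_smul, (hpow i m).1 (Finset.mem_range.mp hi), smul_zero]

namespace LeonardData

variable {P : Params} {V : Type*} [AddCommGroup V] [Module ℂ V] {n : ℕ}
  {A B : Module.End ℂ V} {e e' : Module.Basis (Fin (n + 1)) ℂ V}

lemma swap (hP : P.IsGeneric) (h : LeonardData P A B e e') : LeonardData P.swap B A e' e where
  dim := h.dim
  pair := h.pair.swap hP
  eigA := h.eigB
  eigB := by rw [swap_swap]; exact h.eigA
  irr W hA hB := h.irr W hB hA
  normB := h.normA
  normA := by
    unfold coefA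
    rw [swap_swap]
    exact h.normB

lemma coord_A (h : LeonardData P A B e e') (k : Fin (n + 1)) (v : V) :
    e.coord k (A v) = P.thZ (k : ℕ) * e.coord k v := by
  rw [coord_apply_sum, Finset.sum_eq_single k]
  · rw [h.eigA, map_smul, e.coord_apply, e.coord_apply, e.repr_self, Finsupp.single_eq_same,
      smul_eq_mul]
    ring
  · intro j _ hj
    rw [h.eigA, map_smul, e.coord_apply, e.coord_apply, e.repr_self, Finsupp.single_eq_of_ne hj.symm,
      smul_zero, mul_zero]
  · simp

/-- The matrix entries of the first Askey-Wilson relation. -/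
lemma entry_rel (hP : P.IsGeneric) (h : LeonardData P A B e e') (M N : Fin (n + 1)) :
    e.coord M (B (e N)) * ((P.thZ (M : ℕ) - P.thZ ((N : ℕ) + 1)) *
        (P.thZ (M : ℕ) - P.thZ ((N : ℕ) - 1))) =
      (P.ω * P.thZ (N : ℕ) + P.η) * e.coord M (e N) := by
  have hrel := congrArg (e.coord M) (LinearMap.congr_fun h.pair.rel₁ (e N))
  simp only [LinearMap.add_apply, LinearMap.sub_apply, LinearMap.smul_apply,
    Module.End.mul_apply, Module.End.one_apply, map_add, map_sub, map_smul, h.eigA, h.coord_A,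
    smul_eq_mul] at hrel
  rw [← thZ_factor hP.q_ne]
  linear_combination hrel

lemma tridiag (hP : P.IsGeneric) (h : LeonardData P A B e e') {M N : Fin (n + 1)} (hMN : M ≠ N)
    (h1 : (M : ℕ) ≠ N + 1) (h2 : (N : ℕ) ≠ M + 1) : e.coord M (B (e N)) = 0 := by
  have hd := h.dim
  have hMN' : (M : ℕ) ≠ N := fun h => hMN (Fin.ext h)
  have := h.entry_rel hP M N
  rw [e.coord_apply M (e N), e.repr_self, Finsupp.single_eq_of_ne hMN, mul_zero] at this
  refine (mul_eq_zero.mp this).resolve_right (mul_ne_zero ?_ ?_)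
  · exact sub_ne_zero.mpr (hP.thZ_ne (by omega) (by omega) (by omega))
  · exact sub_ne_zero.mpr (hP.thZ_ne (by omega) (by omega) (by omega))

lemma diag (hP : P.IsGeneric) (h : LeonardData P A B e e') (M : Fin (n + 1)) :
    e.coord M (B (e M)) = P.swap.diagA (M : ℕ) := by
  have hd := h.dim
  have := h.entry_rel hP M M
  rw [e.coord_apply M (e M), e.repr_self, Finsupp.single_eq_same, mul_one] at this
  unfold diagA
  rw [swap_swap, ω_swap hP, ηs_swap, eq_div_iff, this]
  refine mul_ne_zero ?_ ?_
  · exact sub_ne_zero.mpr (hP.thZ_ne (by omega) (by omega) (by omega))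
  · exact sub_ne_zero.mpr (hP.thZ_ne (by omega) (by omega) (by omega))

/-- No set of coordinates cuts out a proper invariant subspace. -/
lemma coord_irr (h : LeonardData P A B e e') (S : Set (Fin (n + 1)))
    (hS : ∀ k ∈ S, ∀ j ∉ S, e.coord k (B (e j)) = 0) : S = ∅ ∨ S = Set.univ := by
  classical
  let W : Submodule ℂ V := ⨅ k ∈ S, LinearMap.ker (e.coord k)
  have hW : ∀ v, v ∈ W ↔ ∀ k ∈ S, e.coord k v = 0 := by
    intro v; simp [W]
  have hirr : W = ⊥ ∨ W = ⊤ := by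
    refine h.irr W ?_ ?_
    · intro w hw
      rw [hW] at hw ⊢
      intro k hk
      rw [h.coord_A, hw k hk, mul_zero]
    · intro w hw
      rw [hW] at hw ⊢
      intro k hk
      rw [coord_apply_sum]
      refine Finset.sum_eq_zero fun j _ => ?_
      by_cases hj : j ∈ S
      · rw [hw j hj, zero_mul]
      · rw [hS k hk j hj, mul_zero]
  rcases hirr with hbot | htop
  · right
    by_contra hne
    obtain ⟨j, hj⟩ := (Set.ne_univ_iff_exists_notMem S).mp hne
    have : e j ∈ W := by
      rw [hW]
      intro k hk
      rw [e.coord_apply, e.repr_self, Finsupp.single_eq_of_ne]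
      rintro rfl; exact hj hk
    rw [hbot, Submodule.mem_bot] at this
    exact e.ne_zero j this
  · left
    by_contra hne
    obtain ⟨j, hj⟩ := Set.nonempty_iff_ne_empty.mpr hne
    have := (hW (e j)).mp (by rw [htop]; trivial) j hj
    rw [e.coord_apply, e.repr_self, Finsupp.single_eq_same] at this
    exact one_ne_zero this

lemma subdiag_ne_zero (hP : P.IsGeneric) (h : LeonardData P A B e e') (j k : Fin (n + 1))
    (hjk : (j : ℕ) + 1 = k) : e.coord k (B (e j)) ≠ 0 := by
  intro h0
  have hS : ∀ i ∈ {i | k ≤ i}, ∀ l ∉ {i | k ≤ i}, e.coord i (B (e l)) = 0 := by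
    intro i (hi : k ≤ i) l (hl : ¬ k ≤ l)
    rw [not_le] at hl
    have hi' : (k : ℕ) ≤ i := hi
    have hl' : (l : ℕ) < k := hl
    by_cases hc : i = k ∧ l = j
    · rw [hc.1, hc.2, h0]
    · apply h.tridiag hP
      · rintro rfl; omega
      · intro h3; exact hc ⟨Fin.ext (by omega), Fin.ext (by omega)⟩
      · omega
  rcases h.coord_irr _ hS with hS | hS
  · exact (Set.mem_empty_iff_false k).mp (hS ▸ le_refl k)
  · have : j ∈ {i | k ≤ i} := hS ▸ Set.mem_univ j
    have : (k : ℕ) ≤ j := this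
    omega

lemma superdiag_ne_zero (hP : P.IsGeneric) (h : LeonardData P A B e e') (j k : Fin (n + 1))
    (hjk : (j : ℕ) + 1 = k) : e.coord j (B (e k)) ≠ 0 := by
  intro h0
  have hS : ∀ i ∈ {i | i ≤ j}, ∀ l ∉ {i | i ≤ j}, e.coord i (B (e l)) = 0 := by
    intro i (hi : i ≤ j) l (hl : ¬ l ≤ j)
    rw [not_le] at hl
    have hi' : (i : ℕ) ≤ j := hi
    have hl' : (j : ℕ) < l := hl
    by_cases hc : i = j ∧ l = k
    · rw [hc.1, hc.2, h0]
    · apply h.tridiag hP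
      · rintro rfl; omega
      · omega
      · intro h3; exact hc ⟨Fin.ext (by omega), Fin.ext (by omega)⟩
  rcases h.coord_irr _ hS with hS | hS
  · exact (Set.mem_empty_iff_false j).mp (hS ▸ le_refl j)
  · have : k ∈ {i | i ≤ j} := hS ▸ Set.mem_univ k
    have : (k : ℕ) ≤ j := this
    omega

lemma coefAs_ne_zero (hP : P.IsGeneric) (h : LeonardData P A B e e') (i : Fin n) :
    P.coefAs (i + 1) ≠ 0 := by
  rw [← h.normB]
  exact h.subdiag_ne_zero hP _ _ (by simp)

/-- An eigenvector of `𝖠*` is determined by its first coordinate in the eigenbasis of `𝖠`. -/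
lemma coord_zero_ne (hP : P.IsGeneric) (h : LeonardData P A B e e') {v : V} {μ : ℂ}
    (hv : B v = μ • v) (hv0 : v ≠ 0) : e.coord 0 v ≠ 0 := by
  intro h0
  apply hv0
  have key : ∀ m : ℕ, ∀ k : Fin (n + 1), (k : ℕ) ≤ m → e.coord k v = 0 := by
    intro m
    induction m with
    | zero =>
      intro k hk
      have : k = 0 := Fin.ext (by simpa using hk)
      rw [this, h0]
    | succ m ih =>
      intro k hk
      rcases hk.lt_or_eq with hk | hk
      · exact ih k (by omega)
      · have hm : m < n + 1 := by omega
        have hrow := congrArg (e.coord ⟨m, hm⟩) hv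
        rw [coord_apply_sum, map_smul, ih ⟨m, hm⟩ le_rfl, smul_zero,
          Finset.sum_eq_single k] at hrow
        · exact (mul_eq_zero.mp hrow).resolve_right (h.superdiag_ne_zero hP _ _ hk.symm)
        · intro j _ hj
          have hj' : (j : ℕ) ≠ k := fun h => hj (Fin.ext h)
          rcases le_or_gt (j : ℕ) m with hjm | hjm
          · rw [ih j hjm, zero_mul]
          · rw [h.tridiag hP, mul_zero]
            · rintro rfl; simp at hjm
            · show (⟨m, hm⟩ : Fin (n + 1)).val ≠ j + 1
              have : (⟨m, hm⟩ : Fin (n + 1)).val = m := rfl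
              omega
            · show (j : ℕ) ≠ (⟨m, hm⟩ : Fin (n + 1)).val + 1
              have : (⟨m, hm⟩ : Fin (n + 1)).val = m := rfl
              omega
        · simp
  apply e.ext_elem
  intro i
  simpa using key i i le_rfl

lemma not_eigenB (hP : P.IsGeneric) (h : LeonardData P A B e e') {k : ℤ}
    (hk : k = -1 ∨ k = n + 1) {v : V} (hv : B v = P.swap.thZ k • v) : v = 0 := by
  have hd := h.dim
  apply e'.ext_elem
  intro N
  have h1 := (h.swap hP).coord_A N v
  rw [hv, map_smul, smul_eq_mul] at h1
  have h2 : P.swap.thZ k ≠ P.swap.thZ (N : ℕ) := by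
    apply hP.swap.thZ_ne <;> (try rw [swap_n]) <;> omega
  have h3 : (P.swap.thZ k - P.swap.thZ (N : ℕ)) * e'.coord N v = 0 := by
    linear_combination h1
  have := (mul_eq_zero.mp h3).resolve_left (sub_ne_zero.mpr h2)
  simpa using this

end LeonardData

/-! ### Overlaps of the eigenbases as `q`-Racah polynomials -/

namespace Params

variable {P : Params}

/-- The coefficients of the split form: `𝖠` is bidiagonal, with these off-diagonal entries, on the
functionals `⟨θ_0|(𝖠* - θ*_0)⋯(𝖠* - θ*_{k-1})`. -/
def splitCoef (P : Params) (k : ℤ) : ℂ :=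
  P.c * P.cs * P.q ^ (-4 * k - 2) *
    ((1 + P.b / P.cs * P.q ^ ((P.n : ℤ) + 1) * P.ζ ^ 2 * P.q ^ (2 * k)) *
      (1 + P.bs / P.c * P.q ^ ((P.n : ℤ) + 1) * P.ζ⁻¹ ^ 2 * P.q ^ (2 * k)) *
      (1 - P.q ^ (-2 * (P.n : ℤ)) * P.q ^ (2 * k)) * (1 - P.q ^ 2 * P.q ^ (2 * k)))

lemma splitCoef_eq (hq : P.q ≠ 0) {k : ℤ} {x : ℂ} (hx : P.q ^ (2 * k) = x) :
    P.splitCoef k = P.c * P.cs * (x⁻¹ ^ 2 * P.q⁻¹ ^ 2) *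
    ((1 + P.b / P.cs * (P.q ^ (P.n : ℤ) * P.q) * P.ζ ^ 2 * x) *
      (1 + P.bs / P.c * (P.q ^ (P.n : ℤ) * P.q) * P.ζ⁻¹ ^ 2 * x) *
      (1 - (P.q ^ (P.n : ℤ))⁻¹ ^ 2 * x) * (1 - P.q ^ 2 * x)) := by
  have h1 : P.q ^ (-4 * k - 2) = x⁻¹ ^ 2 * P.q⁻¹ ^ 2 := by
    rw [← hx, ← zpow_natCast, ← zpow_natCast, inv_zpow', inv_zpow', ← zpow_mul, ← zpow_add₀ hq]
    congr 1; push_cast; ring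
  have h2 : P.q ^ (-2 * (P.n : ℤ)) = (P.q ^ (P.n : ℤ))⁻¹ ^ 2 := by
    rw [← zpow_natCast, inv_zpow', ← zpow_mul]
    congr 1; push_cast; ring
  unfold splitCoef
  rw [h1, h2, hx, zpow_add₀ hq, zpow_one]

lemma thZ_eq {k : ℤ} {x : ℂ} (hx : P.q ^ (2 * k) = x) : P.thZ k = P.b * x + P.c * x⁻¹ := by
  unfold thZ
  rw [← hx, ← zpow_neg, neg_mul]

lemma splitCoef_neg_one (hq : P.q ≠ 0) : P.splitCoef (-1) = 0 := by
  rw [splitCoef_eq hq (x := P.q⁻¹ ^ 2) (by rw [inv_pow]; simp only [mul_neg, mul_one, zpow_neg]; rfl)]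
  have : 1 - P.q ^ 2 * P.q⁻¹ ^ 2 = 0 := by field_simp; ring
  rw [this]; ring

/-- The recurrence for the off-diagonal split coefficients forced by the second relation. -/
lemma splitCoef_succ (hP : P.IsGeneric) (k : ℤ) :
    P.splitCoef (k + 1) = P.ω - P.splitCoef (k - 1)
      - (P.thZ k + P.thZ (k + 1)) * (P.swap.thZ k + P.swap.thZ (k + 1))
      + (P.q ^ 2 + P.q⁻¹ ^ 2) * (P.swap.thZ k * P.thZ k + P.thZ (k + 1) * P.swap.thZ (k + 1)
        + P.splitCoef k) := by
  have hq := hP.q_ne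
  have hb := hP.b_ne
  have hbs := hP.bs_ne
  have hcs := hP.cs_ne
  have hz := hP.ζ_ne
  have hc : P.c = P.bs * P.cs / P.b := by
    rw [eq_div_iff hP.b_ne, ← hP.bc_eq, mul_comm]
  have hQ : P.q ^ (P.n : ℤ) ≠ 0 := zpow_ne_zero _ hq
  have hx0 : P.q ^ (2 * k) ≠ 0 := zpow_ne_zero _ hq
  have h1 : P.q ^ (2 * (k + 1)) = P.q ^ (2 * k) * P.q ^ 2 := by
    rw [mul_add, zpow_add₀ hq]; rfl
  have h2 : P.q ^ (2 * (k - 1)) = P.q ^ (2 * k) * P.q⁻¹ ^ 2 := by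
    rw [mul_sub, zpow_sub₀ hq, div_eq_mul_inv, inv_pow]; rfl
  rw [splitCoef_eq hq h1, splitCoef_eq hq h2, splitCoef_eq hq rfl, thZ_eq rfl, thZ_eq h1,
    thZ_eq (P := P.swap) (k := k) rfl, thZ_eq (P := P.swap) h1]
  unfold ω
  simp only [swap_b, swap_c, swap_q]
  rw [zpow_add₀ hq, zpow_sub₀ hq, zpow_neg, zpow_one, hc]
  generalize P.q ^ (P.n : ℤ) = Q at *
  generalize P.q ^ (2 * k) = x at *
  field_simp
  ring

/-- The coefficient of the `k`-th split form in the second relation vanishes. -/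
lemma splitCoef_balance (hP : P.IsGeneric) (k : ℤ) :
    2 * (P.thZ k * P.swap.thZ k ^ 2) + P.splitCoef (k - 1) * (P.swap.thZ (k - 1) + P.swap.thZ k)
      - (P.q ^ 2 + P.q⁻¹ ^ 2) * P.swap.thZ k *
        (P.thZ k * P.swap.thZ k + P.splitCoef (k - 1) + P.splitCoef k)
      + (P.swap.thZ k + P.swap.thZ (k + 1)) * P.splitCoef k
      - P.ρ * P.thZ k - P.ω * P.swap.thZ k - P.ηs = 0 := by
  have hq := hP.q_ne
  have hb := hP.b_ne
  have hbs := hP.bs_ne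
  have hcs := hP.cs_ne
  have hz := hP.ζ_ne
  have hq4 := hP.q_sq_add_one_ne
  have hc : P.c = P.bs * P.cs / P.b := by
    rw [eq_div_iff hP.b_ne, ← hP.bc_eq, mul_comm]
  have hQ : P.q ^ (P.n : ℤ) ≠ 0 := zpow_ne_zero _ hq
  have hx0 : P.q ^ (2 * k) ≠ 0 := zpow_ne_zero _ hq
  have h1 : P.q ^ (2 * (k + 1)) = P.q ^ (2 * k) * P.q ^ 2 := by
    rw [mul_add, zpow_add₀ hq]; rfl
  have h2 : P.q ^ (2 * (k - 1)) = P.q ^ (2 * k) * P.q⁻¹ ^ 2 := by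
    rw [mul_sub, zpow_sub₀ hq, div_eq_mul_inv, inv_pow]; rfl
  rw [splitCoef_eq hq h2, splitCoef_eq hq rfl, thZ_eq rfl,
    thZ_eq (P := P.swap) (k := k) rfl, thZ_eq (P := P.swap) h1, thZ_eq (P := P.swap) h2]
  unfold ω ρ ηs
  simp only [swap_b, swap_c, swap_q]
  rw [zpow_add₀ hq, zpow_sub₀ hq, zpow_neg, zpow_one, hc]
  generalize P.q ^ (P.n : ℤ) = Q at *
  generalize P.q ^ (2 * k) = x at *
  field_simp
  ring

/-- The first split coefficient, read off from the diagonal entry of `𝖠*` at `|θ_0⟩`. -/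
lemma splitCoef_zero (hP : P.IsGeneric) :
    (P.thZ 0 - P.thZ 1) * (P.swap.diagA 0 - P.swap.thZ 0) = P.splitCoef 0 := by
  have hq := hP.q_ne
  have hq2 := hP.q_sq_ne_one
  have h2 := sub_ne_zero.mpr (hP.thZ_ne (i := 0) (j := -1) (by norm_num) (by norm_num)
    (by simp; omega))
  have h1 := sub_ne_zero.mpr (hP.thZ_ne (i := 0) (j := 1) (by norm_num) (by norm_num)
    (by simp))
  have hd : P.swap.diagA 0 * ((P.thZ 0 - P.thZ 1) * (P.thZ 0 - P.thZ (-1))) =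
      P.ω * P.thZ 0 + P.η := by
    unfold diagA
    rw [swap_swap, zero_add, zero_sub, div_mul_cancel₀ _ (mul_ne_zero h1 h2), ω_swap hP, ηs_swap]
  apply mul_right_cancel₀ h2
  have key : P.ω * P.thZ 0 + P.η - P.swap.thZ 0 * ((P.thZ 0 - P.thZ 1) * (P.thZ 0 - P.thZ (-1)))
      = P.splitCoef 0 * (P.thZ 0 - P.thZ (-1)) := by
    have hb := hP.b_ne
    have hbs := hP.bs_ne
    have hcs := hP.cs_ne
    have hz := hP.ζ_ne
    have hq4 := hP.q_sq_add_one_ne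
    have hc : P.c = P.bs * P.cs / P.b := by
      rw [eq_div_iff hP.b_ne, ← hP.bc_eq, mul_comm]
    have hQ : P.q ^ (P.n : ℤ) ≠ 0 := zpow_ne_zero _ hq
    have h0 : P.q ^ (2 * (0 : ℤ)) = 1 := by simp
    have h1 : P.q ^ (2 * (1 : ℤ)) = P.q ^ 2 := rfl
    have h2 : P.q ^ (2 * (-1 : ℤ)) = P.q⁻¹ ^ 2 := by
      rw [inv_pow]; simp only [mul_neg, mul_one, zpow_neg]; rfl
    rw [splitCoef_eq hq h0, thZ_eq h0, thZ_eq h1, thZ_eq h2, thZ_eq (P := P.swap) h0]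
    unfold ω η
    simp only [swap_b, swap_c]
    rw [zpow_add₀ hq, zpow_sub₀ hq, zpow_neg, zpow_one, hc]
    generalize P.q ^ (P.n : ℤ) = Q at *
    field_simp
    ring
  linear_combination hd + key

/-- The denominators of `A*_{M,M-1}` cancel against differences of eigenvalues. -/
lemma coefAs_mul (hP : P.IsGeneric) {M : ℕ} {x : ℂ} (hx : P.q ^ (2 * (M : ℤ)) = x)
    (h1 : P.thZ ((M : ℤ) - 1) ≠ P.thZ (M + 1)) (h2 : P.thZ M ≠ P.thZ ((M : ℤ) - 1)) :
    P.coefAs M * ((P.thZ ((M : ℤ) - 1) - P.thZ (M + 1)) * (P.thZ M - P.thZ ((M : ℤ) - 1))) =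
      P.q ^ 2 * (P.q ^ (P.n : ℤ))⁻¹ ^ 2 *
        ((1 - x) * (P.c - P.b * (x * (P.q ^ (P.n : ℤ)) ^ 2)) *
          (P.bs * (P.q ^ (P.n : ℤ) * P.q⁻¹) * P.ζ⁻¹ ^ 2 + P.b * (x * P.q⁻¹ ^ 2)) *
          (P.c * (P.q ^ (P.n : ℤ) * P.q⁻¹) * P.ζ ^ 2 + P.cs * (x * P.q⁻¹ ^ 2))) *
        ((P.q ^ 2 - P.q⁻¹ ^ 2) * (1 - P.q ^ 2) * x⁻¹ ^ 2) := by
  have hq := hP.q_ne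
  have hx0 : x ≠ 0 := hx ▸ zpow_ne_zero _ hq
  have e1 : P.q ^ (2 * ((M : ℤ) + 1)) = x * P.q ^ 2 := by
    rw [mul_add, zpow_add₀ hq, hx]; rfl
  have e2 : P.q ^ (2 * ((M : ℤ) - 1)) = x * P.q⁻¹ ^ 2 := by
    rw [mul_sub, zpow_sub₀ hq, div_eq_mul_inv, inv_pow, hx]; rfl
  have e3 : P.q ^ (2 * (M : ℤ) - 2) = x * P.q⁻¹ ^ 2 := by rw [← e2]; ring_nf
  have e4 : P.q ^ (4 * (M : ℤ)) = x ^ 2 := by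
    rw [← hx, ← zpow_natCast, ← zpow_mul]; congr 1; push_cast; ring
  have e5 : P.q ^ (4 * (M : ℤ) - 2) = x ^ 2 * P.q⁻¹ ^ 2 := by
    rw [zpow_sub₀ hq, e4, div_eq_mul_inv, inv_pow]; rfl
  have e6 : P.q ^ (2 - 2 * (P.n : ℤ)) = P.q ^ 2 * (P.q ^ (P.n : ℤ))⁻¹ ^ 2 := by
    rw [zpow_sub₀ hq, mul_comm (2 : ℤ), zpow_mul, div_eq_mul_inv, inv_pow]; rfl
  have e7 : P.q ^ (2 * (M : ℤ) + 2 * (P.n : ℤ)) = x * (P.q ^ (P.n : ℤ)) ^ 2 := by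
    rw [zpow_add₀ hq, hx, mul_comm (2 : ℤ), zpow_mul]; rfl
  have d1 : P.thZ ((M : ℤ) - 1) - P.thZ (M + 1) =
      (P.q ^ 2 - P.q⁻¹ ^ 2) * (P.c - P.b * x ^ 2) * x⁻¹ := by
    rw [thZ_eq e1, thZ_eq e2]; field_simp; ring
  have d2 : P.thZ M - P.thZ ((M : ℤ) - 1) =
      (1 - P.q ^ 2) * (P.c - P.b * (x ^ 2 * P.q⁻¹ ^ 2)) * x⁻¹ := by
    rw [thZ_eq e2, thZ_eq hx]; field_simp; ring
  have n1 : P.c - P.b * x ^ 2 ≠ 0 := by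
    intro h; apply h1; rw [← sub_eq_zero, d1, h]; ring
  have n2 : P.c - P.b * (x ^ 2 * P.q⁻¹ ^ 2) ≠ 0 := by
    intro h; apply h2; rw [← sub_eq_zero, d2, h]; ring
  rw [d1, d2]
  unfold coefAs
  rw [e3, e4, e5, e6, e7, zpow_sub₀ hq, zpow_one, hx, div_eq_mul_inv (P.q ^ (P.n : ℤ))]
  generalize P.c - P.b * x ^ 2 = D1 at *
  generalize P.c - P.b * (x ^ 2 * P.q⁻¹ ^ 2) = D2 at *
  have hQ : P.q ^ (P.n : ℤ) ≠ 0 := zpow_ne_zero _ hq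
  field_simp

/-- The entries of the row `M` of `𝖠*`, weighted by `θ_j - θ_{M+1}`, have the sum that is forced
by an eigenvector for `θ*_0` with all coordinates equal. -/
lemma coefAs_row (hP : P.IsGeneric) {M : ℕ} (hM : 1 ≤ M) (hMn : M ≤ P.n) :
    P.coefAs M * (P.thZ ((M : ℤ) - 1) - P.thZ (M + 1)) +
        P.swap.diagA M * (P.thZ M - P.thZ (M + 1)) =
      P.swap.thZ 1 * P.thZ M + P.diagA 0 * (P.swap.thZ 0 - P.swap.thZ 1) -
        P.swap.thZ 0 * P.thZ (M + 1) := by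
  have n1 : P.thZ ((M : ℤ) - 1) ≠ P.thZ (M + 1) :=
    hP.thZ_ne (by omega) (by omega) (by omega)
  have n2 : P.thZ M ≠ P.thZ ((M : ℤ) - 1) := hP.thZ_ne (by omega) (by omega) (by omega)
  have n3 : P.thZ M ≠ P.thZ ((M : ℤ) + 1) := hP.thZ_ne (by omega) (by omega) (by omega)
  have hc1 := coefAs_mul hP (M := M) rfl n1 n2
  have hd : P.swap.diagA M * ((P.thZ M - P.thZ (M + 1)) * (P.thZ M - P.thZ ((M : ℤ) - 1))) =
      P.ω * P.thZ M + P.η := by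
    unfold diagA
    rw [swap_swap, div_mul_cancel₀ _ (mul_ne_zero (sub_ne_zero.mpr n3) (sub_ne_zero.mpr n2)),
      ω_swap hP, ηs_swap]
  have ha := diagA_zero_mul hP
  have hq := hP.q_ne
  have hq2 := hP.q_sq_ne_one
  have hs := hP.q_sub_inv_ne
  apply mul_right_cancel₀ (sub_ne_zero.mpr n2)
  have ha' : P.diagA 0 * (P.swap.thZ 0 - P.swap.thZ 1) =
      -(P.q⁻¹ * (P.ω / (P.q - P.q⁻¹)) + P.tCoef * (P.swap.thZ 1 - P.q⁻¹ ^ 2 * P.swap.thZ 0)) := by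
    apply mul_left_cancel₀ hq
    field_simp at ha ⊢
    linear_combination -ha
  have h1 : P.q ^ (2 * ((M : ℤ) + 1)) = P.q ^ (2 * (M : ℤ)) * P.q ^ 2 := by
    rw [mul_add, zpow_add₀ hq]; rfl
  have h2 : P.q ^ (2 * ((M : ℤ) - 1)) = P.q ^ (2 * (M : ℤ)) * P.q⁻¹ ^ 2 := by
    rw [mul_sub, zpow_sub₀ hq, div_eq_mul_inv, inv_pow]; rfl
  have key : P.q ^ 2 * (P.q ^ (P.n : ℤ))⁻¹ ^ 2 *
        ((1 - P.q ^ (2 * (M : ℤ))) *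
          (P.c - P.b * (P.q ^ (2 * (M : ℤ)) * (P.q ^ (P.n : ℤ)) ^ 2)) *
          (P.bs * (P.q ^ (P.n : ℤ) * P.q⁻¹) * P.ζ⁻¹ ^ 2 +
            P.b * (P.q ^ (2 * (M : ℤ)) * P.q⁻¹ ^ 2)) *
          (P.c * (P.q ^ (P.n : ℤ) * P.q⁻¹) * P.ζ ^ 2 +
            P.cs * (P.q ^ (2 * (M : ℤ)) * P.q⁻¹ ^ 2))) *
        ((P.q ^ 2 - P.q⁻¹ ^ 2) * (1 - P.q ^ 2) * (P.q ^ (2 * (M : ℤ)))⁻¹ ^ 2) +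
      (P.ω * P.thZ M + P.η) =
      (P.swap.thZ 1 * P.thZ M
        - (P.q⁻¹ * (P.ω / (P.q - P.q⁻¹)) + P.tCoef * (P.swap.thZ 1 - P.q⁻¹ ^ 2 * P.swap.thZ 0))
        - P.swap.thZ 0 * P.thZ (M + 1)) * (P.thZ M - P.thZ ((M : ℤ) - 1)) := by
    have hb := hP.b_ne
    have hbs := hP.bs_ne
    have hcs := hP.cs_ne
    have hz := hP.ζ_ne
    have hq4 := hP.q_sq_add_one_ne
    have hc : P.c = P.bs * P.cs / P.b := by
      rw [eq_div_iff hP.b_ne, ← hP.bc_eq, mul_comm]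
    have hQ : P.q ^ (P.n : ℤ) ≠ 0 := zpow_ne_zero _ hq
    have hx0 : P.q ^ (2 * (M : ℤ)) ≠ 0 := zpow_ne_zero _ hq
    have k0 : P.q ^ (2 * (0 : ℤ)) = 1 := by simp
    have k1 : P.q ^ (2 * (1 : ℤ)) = P.q ^ 2 := rfl
    rw [thZ_eq (P := P.swap) k0, thZ_eq (P := P.swap) k1, thZ_eq h1, thZ_eq h2,
      thZ_eq (k := (M : ℤ)) rfl]
    unfold ω η tCoef
    simp only [swap_b, swap_c]
    rw [zpow_add₀ hq, zpow_sub₀ hq, zpow_neg, zpow_one, hc]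
    generalize P.q ^ (P.n : ℤ) = Q at *
    generalize P.q ^ (2 * (M : ℤ)) = x at *
    clear ha ha' hd hc1 n1 n2 n3 hs
    field_simp
    ring
  linear_combination hc1 + hd + key - ha' * (P.thZ M - P.thZ ((M : ℤ) - 1))

end Params

namespace Params

variable {P : Params}

lemma qPoch_div_eq_prod (a₁ a₂ a₃ a₄ b₁ b₂ b₃ Q z : ℂ) (k : ℕ) :
    (qPoch a₁ Q k * qPoch a₂ Q k * qPoch a₃ Q k * qPoch a₄ Q k) /
      (qPoch b₁ Q k * qPoch b₂ Q k * qPoch b₃ Q k * qPoch Q Q k) * z ^ k =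
    ∏ i ∈ Finset.range k, ((1 - a₁ * Q ^ i) * (1 - a₂ * Q ^ i) * (1 - a₃ * Q ^ i) *
      (1 - a₄ * Q ^ i)) / ((1 - b₁ * Q ^ i) * (1 - b₂ * Q ^ i) * (1 - b₃ * Q ^ i) *
      (1 - Q * Q ^ i)) * z := by
  simp only [qPoch, Finset.prod_mul_distrib, Finset.prod_div_distrib, Finset.prod_const,
    Finset.card_range]

lemma thZ_sub_thZ (hP : P.IsGeneric) (M i : ℕ) :
    P.thZ M - P.thZ i = -(P.c * (P.q ^ (2 * (i : ℤ)))⁻¹) *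
      ((1 - P.q ^ (-2 * (M : ℤ)) * (P.q ^ 2) ^ i) *
        (1 - P.b / P.c * P.q ^ (2 * (M : ℤ)) * (P.q ^ 2) ^ i)) := by
  have hq := hP.q_ne
  have hc := hP.c_ne
  have e1 : (P.q ^ 2) ^ i = P.q ^ (2 * (i : ℤ)) := by
    rw [zpow_mul]; simp only [zpow_natCast]; rfl
  have e2 : P.q ^ (-2 * (M : ℤ)) = (P.q ^ (2 * (M : ℤ)))⁻¹ := by rw [← zpow_neg, neg_mul]
  rw [thZ_eq (k := M) rfl, thZ_eq (k := i) rfl, e1, e2]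
  have h1 := zpow_ne_zero (2 * (i : ℤ)) hq
  have h2 := zpow_ne_zero (2 * (M : ℤ)) hq
  generalize P.q ^ (2 * (i : ℤ)) = x at *
  generalize P.q ^ (2 * (M : ℤ)) = y at *
  field_simp
  ring

/-- The terminating series for `R_M(θ*_N)` in terms of the eigenvalue sequences and the split
coefficients. -/
lemma qRacah_eq_sum (hP : P.IsGeneric) (M N : ℕ) :
    P.qRacah M N = ∑ k ∈ Finset.range (M + 1), ∏ i ∈ Finset.range k,
      (P.thZ M - P.thZ i) / P.splitCoef i * (P.swap.thZ N - P.swap.thZ i) := by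
  have hq := hP.q_ne
  unfold qRacah fourPhiThree
  rw [tsum_eq_sum (s := Finset.range (M + 1))]
  · refine Finset.sum_congr rfl fun k _ => ?_
    rw [qPoch_div_eq_prod]
    refine Finset.prod_congr rfl fun i _ => ?_
    rw [thZ_sub_thZ hP, thZ_sub_thZ hP.swap]
    simp only [swap_b, swap_c, swap_q]
    have e1 : (P.q ^ 2) ^ i = P.q ^ (2 * (i : ℤ)) := by
      rw [zpow_mul]; simp only [zpow_natCast]; rfl
    have e2 : P.q ^ (-4 * (i : ℤ) - 2) = (P.q ^ (2 * (i : ℤ)))⁻¹ ^ 2 * (P.q ^ 2)⁻¹ := by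
      rw [zpow_sub₀ hq, div_eq_mul_inv, ← zpow_natCast, inv_zpow', ← zpow_mul]
      congr 1
      congr 1; push_cast; ring
    unfold splitCoef
    rw [e2, e1]
    simp only [neg_mul, sub_neg_eq_add]
    have hx := zpow_ne_zero (2 * (i : ℤ)) hq
    have hc := hP.c_ne
    have hcs := hP.cs_ne
    generalize (1 + P.b / P.cs * P.q ^ ((P.n : ℤ) + 1) * P.ζ ^ 2 * P.q ^ (2 * (i : ℤ))) = d1
    generalize (1 + P.bs / P.c * P.q ^ ((P.n : ℤ) + 1) * P.ζ⁻¹ ^ 2 * P.q ^ (2 * (i : ℤ))) = d2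
    generalize (1 - P.q ^ (-(2 * (P.n : ℤ))) * P.q ^ (2 * (i : ℤ))) = d3
    generalize (1 - P.q ^ 2 * P.q ^ (2 * (i : ℤ))) = d4
    generalize (1 - P.q ^ (-(2 * (M : ℤ))) * P.q ^ (2 * (i : ℤ))) = n1
    generalize (1 - P.b / P.c * P.q ^ (2 * (M : ℤ)) * P.q ^ (2 * (i : ℤ))) = n2
    generalize (1 - P.q ^ (-(2 * (N : ℤ))) * P.q ^ (2 * (i : ℤ))) = n3
    generalize (1 - P.bs / P.cs * P.q ^ (2 * (N : ℤ)) * P.q ^ (2 * (i : ℤ))) = n4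
    generalize P.q ^ (2 * (i : ℤ)) = x at *
    rw [div_mul_eq_mul_div, div_mul_eq_mul_div,
      show -(P.c * x⁻¹ * (n1 * n2)) * -(P.cs * x⁻¹ * (n3 * n4)) =
        (P.c * P.cs * (x⁻¹ ^ 2 * (P.q ^ 2)⁻¹)) * (n1 * n2 * n3 * n4 * P.q ^ 2) by
        field_simp, mul_div_mul_left]
    exact mul_ne_zero (mul_ne_zero hc hcs) (mul_ne_zero (pow_ne_zero _ (inv_ne_zero hx))
      (inv_ne_zero (pow_ne_zero _ hq)))
  · intro k hk
    have hMk : M < k := by simpa using hk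
    have : qPoch (P.q ^ (-2 * (M : ℤ))) (P.q ^ 2) k = 0 := by
      refine Finset.prod_eq_zero (Finset.mem_range.mpr hMk) ?_
      rw [← zpow_natCast, ← zpow_natCast, ← zpow_mul, ← zpow_add₀ hq]
      simp
    rw [this]; simp

lemma qRacah_swap (M N : ℕ) : P.swap.qRacah N M = P.qRacah M N := by
  unfold qRacah fourPhiThree
  simp only [swap_q, swap_b, swap_c, swap_bs, swap_cs, swap_ζ, swap_n, inv_inv]
  refine tsum_congr fun k => ?_
  congr 2 <;> ring

end Params

/-- If `T` has vanishing entries beyond the superdiagonal and nonvanishing ones on it, a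
polynomial of degree `m` in `T` takes the first coordinate form to a form not vanishing at the
`m`-th basis vector. -/
lemma dual_aeval_ne_zero {V : Type*} [AddCommGroup V] [Module ℂ V] {n : ℕ}
    {e : Module.Basis (Fin (n + 1)) ℂ V} {T : Module.End ℂ V}
    (hT : ∀ j k : Fin (n + 1), (j : ℕ) + 1 < k → e.coord j (T (e k)) = 0)
    (hT' : ∀ j k : Fin (n + 1), (j : ℕ) + 1 = k → e.coord j (T (e k)) ≠ 0)
    {p : ℂ[X]} {m : Fin (n + 1)} (hp : p.natDegree ≤ m) (hp' : p.coeff m ≠ 0) :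
    aeval T.dualMap p (e.coord 0) (e m) ≠ 0 := by
  let t : ℕ → ℂ := fun i => if hi : i < n then
    e.coord (⟨i, hi⟩ : Fin n).castSucc (T (e (⟨i, hi⟩ : Fin n).succ)) else 1
  have hco : ∀ (k : Fin (n + 1)) (f : Module.Dual ℂ V), e.dualBasis.coord k f = f (e k) := by
    intro k f
    rw [Module.Basis.coord_apply, Module.Basis.dualBasis_repr]
  have hdb : ∀ k, e.dualBasis k = e.coord k := fun k => by rw [Module.Basis.coe_dualBasis]
  have := coord_aeval (e := e.dualBasis) (T := T.dualMap) (t := t) (p := p) (m := m) ?_ ?_ hp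
  · rw [hco, hdb] at this
    rw [this]
    refine mul_ne_zero hp' (Finset.prod_ne_zero_iff.mpr fun i hi => ?_)
    have hi : i < n := by have := Finset.mem_range.mp hi; omega
    simp only [t, dif_pos hi]
    exact hT' _ _ rfl
  · intro j k hjk
    rw [hco, hdb, LinearMap.dualMap_apply, hT j k hjk]
  · intro j k hjk
    have hj : (j : ℕ) < n := by omega
    rw [hco, hdb, LinearMap.dualMap_apply]
    simp only [t, dif_pos hj]
    congr 3
    exact Fin.ext hjk.symm

/-- The functional `f ∘ (𝖠* - θ*_0)⋯(𝖠* - θ*_{k-1})`. -/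
def splitForm {V : Type*} [AddCommGroup V] [Module ℂ V] (P : Params) (B : Module.End ℂ V)
    (f : Module.Dual ℂ V) (k : ℕ) : Module.Dual ℂ V :=
  aeval B.dualMap (∏ i ∈ Finset.range k, (X - C (P.swap.thZ i))) f

section

variable {P : Params} {V : Type*} [AddCommGroup V] [Module ℂ V] {A B : Module.End ℂ V}
  {f : Module.Dual ℂ V}

lemma splitForm_zero : splitForm P B f 0 = f := by simp [splitForm]

lemma dualMap_splitForm (k : ℕ) :
    B.dualMap (splitForm P B f k) =
      splitForm P B f (k + 1) + P.swap.thZ k • splitForm P B f k := by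
  unfold splitForm
  rw [Finset.prod_range_succ, mul_comm, map_mul, Module.End.mul_apply, map_sub, aeval_X, aeval_C,
    LinearMap.sub_apply, Module.algebraMap_end_apply]
  abel

lemma splitForm_apply_eigen {v : V} {μ : ℂ} (hv : B v = μ • v) (k : ℕ) :
    splitForm P B f k v = (∏ i ∈ Finset.range k, (μ - P.swap.thZ i)) * f v := by
  induction k with
  | zero => simp [splitForm_zero]
  | succ k ih =>
    have := LinearMap.congr_fun (dualMap_splitForm (P := P) (B := B) (f := f) k) v
    rw [LinearMap.dualMap_apply, hv, map_smul, LinearMap.add_apply, LinearMap.smul_apply,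
      smul_eq_mul, smul_eq_mul, ih] at this
    rw [Finset.prod_range_succ]
    linear_combination -this

/-- One step of the propagation of bidiagonality along `g₀, g₁, g₂` by the second relation. -/
lemma AWPair.split_step (h : AWPair P A B) {w g₀ g₁ g₂ : V} {s s₀ s₁ t₀ t₁ t₂ φ φ₀ φ₁ : ℂ}
    (hB₀ : B g₀ = g₁ + s₀ • g₀) (hB₁ : B g₁ = g₂ + s₁ • g₁) (hA₀ : A g₀ = t₀ • g₀ + w)
    (hw : B w = φ • g₀ + s • w) (hA₁ : A g₁ = t₁ • g₁ + φ₀ • g₀)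
    (ht : t₂ + t₀ = (P.q ^ 2 + P.q⁻¹ ^ 2) * t₁)
    (hs : s ^ 2 - (P.q ^ 2 + P.q⁻¹ ^ 2) * s * s₀ + s₀ ^ 2 - P.ρ = 0)
    (hφ : φ₁ = P.ω - φ - (t₀ + t₁) * (s₀ + s₁) +
      (P.q ^ 2 + P.q⁻¹ ^ 2) * (s₀ * t₀ + t₁ * s₁ + φ₀))
    (hbal : 2 * (t₀ * s₀ ^ 2) + φ * (s + s₀) - (P.q ^ 2 + P.q⁻¹ ^ 2) * s₀ * (t₀ * s₀ + φ + φ₀) +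
      (s₀ + s₁) * φ₀ - P.ρ * t₀ - P.ω * s₀ - P.ηs = 0) :
    A g₂ = t₂ • g₂ + φ₁ • g₁ := by
  have hrel := LinearMap.congr_fun h.rel₂ g₀
  simp only [LinearMap.add_apply, LinearMap.sub_apply, LinearMap.smul_apply,
    Module.End.mul_apply, Module.End.one_apply, hB₀, hB₁, hA₀, hA₁, hw, map_add, map_smul] at hrel
  rw [← sub_eq_zero] at hrel ⊢
  rw [← hrel]
  match_scalars
  · ring
  · linear_combination -ht
  · linear_combination -hφ
  · linear_combination -hbal
  · linear_combination -hs

end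

namespace LeonardData

variable {P : Params} {V : Type*} [AddCommGroup V] [Module ℂ V] {n : ℕ}
  {A B : Module.End ℂ V} {e e' : Module.Basis (Fin (n + 1)) ℂ V}

lemma dual_eigen_eq (hP : P.IsGeneric) (h : LeonardData P A B e e') {f : Module.Dual ℂ V}
    {M : Fin (n + 1)} (hf : A.dualMap f = P.thZ (M : ℕ) • f) : f = f (e M) • e.coord M := by
  have hd := h.dim
  refine e.ext fun j => ?_
  have hj := LinearMap.congr_fun hf (e j)
  rw [LinearMap.dualMap_apply, h.eigA, map_smul, LinearMap.smul_apply, smul_eq_mul,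
    smul_eq_mul] at hj
  rw [LinearMap.smul_apply, e.coord_apply, e.repr_self, smul_eq_mul]
  by_cases hjM : j = M
  · subst hjM; simp
  · rw [Finsupp.single_eq_of_ne (Ne.symm hjM), mul_zero]
    have hne : P.thZ (j : ℕ) ≠ P.thZ (M : ℕ) :=
      hP.thZ_ne (fun h => hjM (Fin.ext (by exact_mod_cast h))) (by omega) (by omega)
    have : (P.thZ (j : ℕ) - P.thZ (M : ℕ)) * f (e j) = 0 := by linear_combination hj
    exact (mul_eq_zero.mp this).resolve_left (sub_ne_zero.mpr hne)

lemma not_eigen_dual (hP : P.IsGeneric) (h : LeonardData P A B e e') {k : ℤ}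
    (hk : k = -1 ∨ k = n + 1) {f : Module.Dual ℂ V} (hf : A.dualMap f = P.thZ k • f) : f = 0 := by
  have hd := h.dim
  refine e.ext fun j => ?_
  have hj := LinearMap.congr_fun hf (e j)
  rw [LinearMap.dualMap_apply, h.eigA, map_smul, LinearMap.smul_apply, smul_eq_mul,
    smul_eq_mul] at hj
  have hne : P.thZ (j : ℕ) ≠ P.thZ k := hP.thZ_ne (by omega) (by omega) (by omega)
  have : (P.thZ (j : ℕ) - P.thZ k) * f (e j) = 0 := by linear_combination hj
  exact (mul_eq_zero.mp this).resolve_left (sub_ne_zero.mpr hne)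

lemma coord_eigen_dual (h : LeonardData P A B e e') (M : Fin (n + 1)) :
    A.dualMap (e.coord M) = P.thZ (M : ℕ) • e.coord M := by
  ext v
  rw [LinearMap.dualMap_apply, h.coord_A]; rfl

/-- In the chosen normalization all coordinates of `|θ*_0⟩` in the eigenbasis of `𝖠` agree. -/
lemma coord_ground (hP : P.IsGeneric) (h : LeonardData P A B e e') {Ω : V}
    (hΩ : B Ω = P.swap.thZ 0 • Ω) (k : Fin (n + 1)) : e.coord k Ω = e.coord 0 Ω := by
  have hd := h.dim
  have hg := h.pair.B_A_ground hP hΩ fun v hv => h.not_eigenB hP (Or.inl rfl) hv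
  induction k using Fin.induction with
  | zero => rfl
  | succ i ih =>
    rw [← ih]
    -- The row `M` of `(𝖠* - θ*_1)(𝖠 - a)Ω = 0` minus `θ_{M+1}` times that of `(𝖠* - θ*_0)Ω = 0` is
    -- free of the superdiagonal entry.
    have r1 := congrArg (e.coord i.succ) hΩ
    have r2 := congrArg (e.coord i.succ) hg
    simp only [map_smul, smul_eq_mul, map_sub, h.coord_A, hΩ] at r2
    rw [map_smul, smul_eq_mul] at r1
    rw [coord_apply_sum] at r1 r2
    simp only [h.coord_A] at r2
    have hsum : ∑ j : Fin (n + 1), (P.thZ (j : ℕ) - P.thZ ((i.succ : ℕ) + 1)) *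
        (e.coord j Ω * e.coord i.succ (B (e j))) =
        (P.thZ ((i : ℕ)) - P.thZ ((i.succ : ℕ) + 1)) *
            (e.coord i.castSucc Ω * P.coefAs (i + 1)) +
          (P.thZ ((i.succ : ℕ)) - P.thZ ((i.succ : ℕ) + 1)) *
            (e.coord i.succ Ω * P.swap.diagA (i.succ : ℕ)) := by
      rw [Finset.sum_eq_add i.castSucc i.succ, h.normB, h.diag hP]
      · rfl
      · exact (Fin.castSucc_lt_succ).ne
      · rintro j - ⟨hj1, hj2⟩
        have hj1' : (j : ℕ) ≠ i := fun h => hj1 (Fin.ext h)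
        by_cases hj3 : (j : ℕ) = i.succ + 1
        · rw [hj3]; push_cast; ring
        · rw [h.tridiag hP (Ne.symm hj2) (by simp; omega) hj3, mul_zero, mul_zero]
      · simp
      · simp
    have hsum2 : ∑ j : Fin (n + 1), (P.thZ (j : ℕ) - P.thZ ((i.succ : ℕ) + 1)) *
        (e.coord j Ω * e.coord i.succ (B (e j))) =
        ∑ j : Fin (n + 1), P.thZ (j : ℕ) * e.coord j Ω * e.coord i.succ (B (e j)) -
          P.thZ ((i.succ : ℕ) + 1) * ∑ j : Fin (n + 1), e.coord j Ω * e.coord i.succ (B (e j)) := by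
      rw [Finset.mul_sum, ← Finset.sum_sub_distrib]
      exact Finset.sum_congr rfl fun j _ => by ring
    have hrow := coefAs_row hP (M := i + 1) (by omega) (by omega)
    have hne : P.thZ (i : ℕ) ≠ P.thZ ((i : ℤ) + 1 + 1) :=
      hP.thZ_ne (by omega) (by omega) (by omega)
    have hc := h.coefAs_ne_zero hP i
    rw [hsum, r1] at hsum2
    simp only [Fin.val_succ, Nat.cast_add, Nat.cast_one, add_sub_cancel_right] at hsum2 hrow r2
    have : P.coefAs (i + 1) * (P.thZ (i : ℕ) - P.thZ ((i : ℤ) + 1 + 1)) *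
        (e.coord i.succ Ω - e.coord i.castSucc Ω) = 0 := by
      linear_combination e.coord i.succ Ω * hrow - hsum2 - r2
    exact sub_eq_zero.mp ((mul_eq_zero.mp this).resolve_left
      (mul_ne_zero hc (sub_ne_zero.mpr hne)))

/-- The transpose of `𝖠` is bidiagonal on the split forms. For `k = 0` the last term vanishes
because its coefficient does. -/
lemma dualMap_A_splitForm (hP : P.IsGeneric) (h : LeonardData P A B e e') (k : ℕ) :
    A.dualMap (splitForm P B (e.coord 0) k) = P.thZ k • splitForm P B (e.coord 0) k +
      P.splitCoef ((k : ℤ) - 1) • splitForm P B (e.coord 0) (k - 1) := by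
  have hq := hP.q_ne
  have h0 : A.dualMap (splitForm P B (e.coord 0) 0) = P.thZ 0 • splitForm P B (e.coord 0) 0 := by
    rw [splitForm_zero, h.coord_eigen_dual]; rfl
  induction k using Nat.twoStepInduction with
  | zero =>
    rw [Nat.cast_zero, zero_sub, splitCoef_neg_one hq, zero_smul, add_zero]
    exact h0
  | one =>
    have hB := dualMap_splitForm (P := P) (B := B) (f := e.coord 0) 0
    have hg := (h.pair.dual.swap hP).B_A_ground hP.swap (Ω := splitForm P B (e.coord 0) 0)
      (by rw [swap_swap]; exact h0)
      (by rw [swap_swap]; exact fun v hv => h.not_eigen_dual hP (Or.inl rfl) hv)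
    rw [swap_swap, hB, map_sub, map_add, map_smul, map_smul, h0] at hg
    have hz := splitCoef_zero hP
    simp only [Nat.cast_zero, zero_add] at hg hB ⊢
    rw [Nat.cast_one, sub_self, ← hz]
    rw [← sub_eq_zero] at hg ⊢
    rw [← hg]
    match_scalars <;> ring
  | more k ih0 ih1 =>
    have := h.pair.dual.split_step (dualMap_splitForm k) (dualMap_splitForm (k + 1)) ih0
      (φ := P.splitCoef ((k : ℤ) - 1)) (s := P.swap.thZ ((k : ℤ) - 1)) (t₂ := P.thZ ((k : ℤ) + 2))
      (φ₁ := P.splitCoef ((k : ℤ) + 1))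
      ?_ ih1 ?_ ?_ ?_ ?_
    · convert this using 3 <;> push_cast <;> ring_nf
    · rcases k with - | k
      · rw [Nat.cast_zero, zero_sub, splitCoef_neg_one hq, zero_smul, map_zero,
          smul_zero, add_zero]
      · rw [map_smul, Nat.add_sub_cancel, dualMap_splitForm, Nat.cast_add, Nat.cast_one,
          add_sub_cancel_right]
        module
    · have := thZ_add_thZ (P := P) hq ((k : ℤ) + 1)
      push_cast
      rw [← this]; ring_nf
    · have := thZ_factor (P := P.swap) hq (k : ℤ) (P.swap.thZ ((k : ℤ) - 1))
      rw [sub_self, mul_zero, ρ_swap hP] at this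
      exact this
    · have := splitCoef_succ hP k
      push_cast
      rw [add_sub_cancel_right]
      exact this
    · have := splitCoef_balance hP k
      push_cast
      rw [add_sub_cancel_right]
      exact this

/-- If a split coefficient vanished, a split form would be a multiple of a coordinate form that
vanishes at `|θ*_0⟩`. -/
lemma splitCoef_ne_zero (hP : P.IsGeneric) (h : LeonardData P A B e e') {k : ℕ} (hk : k < n) :
    P.splitCoef k ≠ 0 := by
  intro h0
  have hA := h.dualMap_A_splitForm hP (k + 1)
  rw [Nat.cast_add, Nat.cast_one, add_sub_cancel_right, h0, zero_smul, add_zero] at hA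
  have hk' : k + 1 < n + 1 := by omega
  have hf := h.dual_eigen_eq hP (M := ⟨k + 1, hk'⟩) (by simpa using hA)
  have hB0 : B (e' 0) = P.swap.thZ 0 • e' 0 := by rw [h.eigB]; rfl
  have hv := LinearMap.congr_fun hf (e' 0)
  rw [splitForm_apply_eigen hB0, Finset.prod_eq_zero (i := 0) (by simp) (by simp), zero_mul,
    LinearMap.smul_apply, h.coord_ground hP hB0, smul_eq_mul] at hv
  refine mul_ne_zero ?_ (h.coord_zero_ne hP hB0 (e'.ne_zero 0)) hv.symm
  refine dual_aeval_ne_zero ?_ (fun j k hjk => h.superdiag_ne_zero hP j k hjk) ?_ ?_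
  · intro j k hjk
    exact h.tridiag hP (by rintro rfl; omega) (by omega) (by omega)
  · rw [natDegree_finsetProd_X_sub_C_eq_card, Finset.card_range]
  · have hmon : (∏ i ∈ Finset.range (k + 1), (X - C (P.swap.thZ i))).Monic :=
      monic_prod_of_monic _ _ fun i _ => monic_X_sub_C _
    have := hmon.coeff_natDegree
    rw [natDegree_finsetProd_X_sub_C_eq_card, Finset.card_range] at this
    simp [this]

/-- The transition coefficients between the eigenbases are `q`-Racah polynomials. The form
`∑_k ∏_{i<k} (θ_M - θ_i)/φ_i · g_k`, with `g_k` the split forms and `φ_i` the split coefficients,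
is an eigenform of `𝖠` for `θ_M`; its value at `|θ*_0⟩` identifies it with the `M`-th coordinate
form. -/
theorem coord_eq_qRacah (hP : P.IsGeneric) (h : LeonardData P A B e e') (M N : Fin (n + 1)) :
    e.coord M (e' N) = P.qRacah M N * e.coord 0 (e' N) := by
  let c : ℕ → ℂ := fun k => ∏ i ∈ Finset.range k, (P.thZ (M : ℕ) - P.thZ i) / P.splitCoef i
  let g : ℕ → Module.Dual ℂ V := splitForm P B (e.coord 0)
  have hc0 : c 0 = 1 := by simp [c]
  -- The defect of each partial sum lies in its last term and vanishes at `m = M`.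
  have key : ∀ m : ℕ, m ≤ n → A.dualMap (∑ k ∈ Finset.range (m + 1), c k • g k) =
      P.thZ (M : ℕ) • (∑ k ∈ Finset.range (m + 1), c k • g k) -
        (c m * (P.thZ (M : ℕ) - P.thZ m)) • g m := by
    intro m
    induction m with
    | zero =>
      intro _
      have := h.dualMap_A_splitForm hP 0
      rw [Nat.cast_zero, zero_sub, splitCoef_neg_one hP.q_ne, zero_smul, add_zero] at this
      rw [Finset.sum_range_one, hc0, one_smul, this, Nat.cast_zero]
      module
    | succ m ih =>
      intro hm
      have hcm : c (m + 1) * P.splitCoef m = c m * (P.thZ (M : ℕ) - P.thZ m) := by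
        have := h.splitCoef_ne_zero hP (k := m) (by omega)
        simp only [c]
        rw [Finset.prod_range_succ]
        field_simp
      have := h.dualMap_A_splitForm hP (m + 1)
      rw [Nat.cast_add, Nat.cast_one, add_sub_cancel_right, Nat.add_sub_cancel] at this
      rw [Finset.sum_range_succ, map_add, ih (by omega), map_smul, this, ← hcm]
      push_cast
      module
  have hf := key M (by omega)
  rw [sub_self, mul_zero, zero_smul, sub_zero] at hf
  have hf := h.dual_eigen_eq hP hf
  set F := ∑ k ∈ Finset.range ((M : ℕ) + 1), c k • g k with hF
  have hval : ∀ N : Fin (n + 1), F (e' N) = (∑ k ∈ Finset.range ((M : ℕ) + 1),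
      c k * ∏ i ∈ Finset.range k, (P.swap.thZ (N : ℕ) - P.swap.thZ i)) * e.coord 0 (e' N) := by
    intro N
    rw [hF, LinearMap.sum_apply, Finset.sum_mul]
    refine Finset.sum_congr rfl fun k _ => ?_
    rw [LinearMap.smul_apply, splitForm_apply_eigen (h.eigB N), smul_eq_mul, mul_assoc]
  have hB0 : B (e' 0) = P.swap.thZ 0 • e' 0 := by rw [h.eigB]; rfl
  have h1 := LinearMap.congr_fun hf (e' 0)
  have hne := h.coord_zero_ne hP hB0 (e'.ne_zero 0)
  rw [hval, LinearMap.smul_apply, h.coord_ground hP hB0 M, smul_eq_mul] at h1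
  have h1 := mul_right_cancel₀ hne h1
  rw [Finset.sum_eq_single 0 ?_ (by simp), hc0, Finset.prod_range_zero, one_mul] at h1
  · have h2 := LinearMap.congr_fun hf (e' N)
    rw [hval, ← h1, one_smul] at h2
    rw [← h2, qRacah_eq_sum hP]
    congr 1
    refine Finset.sum_congr rfl fun k _ => ?_
    rw [Finset.prod_mul_distrib]
  · intro k _ hk
    rw [Finset.prod_eq_zero (i := 0) (Finset.mem_range.mpr (by omega)) (by simp), mul_zero]

end LeonardData

/-! ### Matrix entries of the third generator -/

namespace Params

variable {P : Params}

lemma q_thZ_succ_sub (hq : P.q ≠ 0) (k : ℤ) :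
    P.q * P.thZ (k + 1) - P.q⁻¹ * P.thZ k =
      P.b * P.q ^ (2 * k + 1) * (P.q ^ 2 - P.q⁻¹ ^ 2) := by
  have h1 : P.q ^ (2 * (k + 1)) = P.q ^ (2 * k) * P.q ^ 2 := by
    rw [mul_add, zpow_add₀ hq]; rfl
  rw [thZ_eq h1, thZ_eq rfl, zpow_add₀ hq, zpow_one]
  have hx := zpow_ne_zero (2 * k) hq
  field_simp
  ring

lemma q_thZ_sub_succ (hq : P.q ≠ 0) (k : ℤ) :
    P.q * P.thZ k - P.q⁻¹ * P.thZ (k + 1) =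
      P.c * (P.q ^ (2 * k + 1))⁻¹ * (P.q ^ 2 - P.q⁻¹ ^ 2) := by
  have h1 : P.q ^ (2 * (k + 1)) = P.q ^ (2 * k) * P.q ^ 2 := by
    rw [mul_add, zpow_add₀ hq]; rfl
  rw [thZ_eq h1, thZ_eq rfl, zpow_add₀ hq, zpow_one]
  have hx := zpow_ne_zero (2 * k) hq
  field_simp
  ring

end Params

namespace LeonardData

variable {P : Params} {V : Type*} [AddCommGroup V] [Module ℂ V] {n : ℕ}
  {A B : Module.End ℂ V} {e e' : Module.Basis (Fin (n + 1)) ℂ V}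

lemma coord_third (h : LeonardData P A B e e') {j k : Fin (n + 1)} (hjk : j ≠ k) :
    e.coord k (third P A B (e j)) =
      P.ρ⁻¹ * (P.q * P.thZ (j : ℕ) - P.q⁻¹ * P.thZ (k : ℕ)) * e.coord k (B (e j)) := by
  have h0 : e.coord k (e j) = 0 := by
    rw [e.coord_apply, e.repr_self, Finsupp.single_eq_of_ne (Ne.symm hjk)]
  simp only [third, qComm, LinearMap.add_apply, LinearMap.sub_apply, LinearMap.smul_apply,
    Module.End.mul_apply, Module.End.one_apply, map_add, map_sub, map_smul, h.eigA, h.coord_A,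
    smul_eq_mul, h0]
  ring

lemma coord_third_star (hP : P.IsGeneric) (h : LeonardData P A B e e') {j k : Fin (n + 1)}
    (hjk : j ≠ k) :
    e'.coord k (third P A B (e' j)) =
      P.ρ⁻¹ * (P.q * P.swap.thZ (k : ℕ) - P.q⁻¹ * P.swap.thZ (j : ℕ)) *
        e'.coord k (A (e' j)) := by
  have h0 : e'.coord k (e' j) = 0 := by
    rw [e'.coord_apply, e'.repr_self, Finsupp.single_eq_of_ne (Ne.symm hjk)]
  simp only [third, qComm, LinearMap.add_apply, LinearMap.sub_apply, LinearMap.smul_apply,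
    Module.End.mul_apply, Module.End.one_apply, map_add, map_sub, map_smul, h.eigB,
    (h.swap hP).coord_A, smul_eq_mul, h0]
  ring

/-- The leading coordinate of a Bethe vector built on `|θ_0⟩`. -/
lemma coord_last_rootVec (hP : P.IsGeneric) (h : LeonardData P A B e e') (u : Fin n → ℂ) :
    e.coord (Fin.last n) (rootVec P A B u (e 0)) =
      ∏ i ∈ Finset.range n, P.ρ⁻¹ *
        (P.c * (P.q ^ (2 * (i : ℤ) + 1))⁻¹ * (P.q ^ 2 - P.q⁻¹ ^ 2)) * P.coefAs (i + 1) := by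
  unfold rootVec
  rw [coord_aeval (T := third P A B) (m := Fin.last n) (t := fun i => P.ρ⁻¹ *
    (P.c * (P.q ^ (2 * (i : ℤ) + 1))⁻¹ * (P.q ^ 2 - P.q⁻¹ ^ 2)) * P.coefAs (i + 1))]
  · rw [Fin.val_last, coeff_rootPoly, one_mul]
  · intro j k hjk
    rw [h.coord_third (by rintro rfl; omega),
      h.tridiag hP (by rintro rfl; omega) (by omega) (by omega), mul_zero]
  · intro j k hjk
    have hj : (j : ℕ) < n := by omega
    rw [h.coord_third (by rintro rfl; omega), ← hjk, Nat.cast_add, Nat.cast_one,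
      q_thZ_sub_succ hP.q_ne]
    have hn := h.normB ⟨j, hj⟩
    rw [show (⟨j, hj⟩ : Fin n).succ = k from Fin.ext hjk] at hn
    exact congrArg _ hn
  · rw [natDegree_rootPoly, Fin.val_last]

/-- The leading coordinate of a Bethe vector built on `|θ*_0⟩`. -/
lemma coord_last_rootVec_star (hP : P.IsGeneric) (h : LeonardData P A B e e') (u : Fin n → ℂ) :
    e'.coord (Fin.last n) (rootVec P A B u (e' 0)) =
      ∏ i ∈ Finset.range n, P.ρ⁻¹ *
        (P.bs * P.q ^ (2 * (i : ℤ) + 1) * (P.q ^ 2 - P.q⁻¹ ^ 2)) * P.coefA (i + 1) := by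
  unfold rootVec
  rw [coord_aeval (T := third P A B) (m := Fin.last n) (t := fun i => P.ρ⁻¹ *
    (P.bs * P.q ^ (2 * (i : ℤ) + 1) * (P.q ^ 2 - P.q⁻¹ ^ 2)) * P.coefA (i + 1))]
  · rw [Fin.val_last, coeff_rootPoly, one_mul]
  · intro j k hjk
    rw [h.coord_third_star hP (by rintro rfl; omega),
      (h.swap hP).tridiag hP.swap (by rintro rfl; omega) (by omega) (by omega), mul_zero]
  · intro j k hjk
    have hj : (j : ℕ) < n := by omega
    have hs := q_thZ_succ_sub (P := P.swap) hP.q_ne (j : ℕ)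
    simp only [swap_q, swap_b] at hs
    rw [h.coord_third_star hP (by rintro rfl; omega), ← hjk, Nat.cast_add, Nat.cast_one, hs]
    have hn := h.normA ⟨j, hj⟩
    rw [show (⟨j, hj⟩ : Fin n).succ = k from Fin.ext hjk] at hn
    exact congrArg _ hn
  · rw [natDegree_rootPoly, Fin.val_last]

/-- A dual Bethe vector with `m` roots built on `⟨θ_0|` does not vanish at `|θ_m⟩`. -/
lemma dual_rootVec_ne_zero (hP : P.IsGeneric) (h : LeonardData P A B e e') {m : Fin (n + 1)}
    (u : Fin m → ℂ) :
    rootVec P.swap B.dualMap A.dualMap u (e.coord 0) (e m) ≠ 0 := by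
  unfold rootVec
  rw [third_swap_dual hP]
  refine dual_aeval_ne_zero ?_ ?_ (natDegree_rootPoly _).le ?_
  · intro j k hjk
    rw [h.coord_third (by rintro rfl; omega),
      h.tridiag hP (by rintro rfl; omega) (by omega) (by omega), mul_zero]
  · intro j k hjk
    rw [h.coord_third (by rintro rfl; omega), ← hjk, Nat.cast_add, Nat.cast_one,
      q_thZ_succ_sub hP.q_ne]
    exact mul_ne_zero (mul_ne_zero (inv_ne_zero hP.ρ_ne)
      (mul_ne_zero (mul_ne_zero hP.b_ne (zpow_ne_zero _ hP.q_ne)) hP.q_sq_sub_inv_ne))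
      (h.superdiag_ne_zero hP j k hjk)
  · rw [coeff_rootPoly]
    exact one_ne_zero

lemma eigen_eq (hP : P.IsGeneric) (h : LeonardData P A B e e') {v : V} {M : Fin (n + 1)}
    (hv : A v = P.thZ (M : ℕ) • v) : v = e.coord M v • e M := by
  have hd := h.dim
  refine e.ext_elem fun j => ?_
  have hj := h.coord_A j v
  rw [hv, map_smul, smul_eq_mul] at hj
  rw [map_smul, e.repr_self, Finsupp.smul_apply, smul_eq_mul]
  by_cases hjM : j = M
  · subst hjM; simp
  · rw [Finsupp.single_eq_of_ne hjM, mul_zero]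
    have hne : P.thZ (M : ℕ) ≠ P.thZ (j : ℕ) :=
      hP.thZ_ne (fun h => hjM (Fin.ext (by exact_mod_cast h.symm))) (by omega) (by omega)
    have : (P.thZ (M : ℕ) - P.thZ (j : ℕ)) * e.coord j v = 0 := by linear_combination hj
    exact (mul_eq_zero.mp this).resolve_left (_root_.sub_ne_zero.mpr hne)

end LeonardData

/-! ### Bethe states as polynomials in the third generator -/

lemma dualMap_aeval {V : Type*} [AddCommGroup V] [Module ℂ V] (T : Module.End ℂ V) (p : ℂ[X]) :
    (aeval T p).dualMap = aeval T.dualMap p := by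
  induction p using Polynomial.induction_on' with
  | add p r hp hr =>
    rw [map_add, map_add, ← hp, ← hr]
    ext f v
    simp
  | monomial k a =>
    rw [aeval_monomial, aeval_monomial]
    have hpow : (T ^ k).dualMap = T.dualMap ^ k := by
      induction k with
      | zero => ext f v; simp
      | succ k ih =>
        rw [pow_succ, pow_succ', ← ih]
        ext f v; simp
    ext f v
    rw [← Algebra.smul_def, ← Algebra.smul_def, ← hpow]
    simp

section

variable {P : Params} {V : Type*} [AddCommGroup V] [Module ℂ V]

/-- At vanishing gauge parameter only the entry `K12` survives, which is linear in the third
generator. -/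
lemma map_gauged_zero (π : P.AW →ₐ[ℂ] Module.End ℂ V) (ε : ℤˣ) (u : ℂ) :
    π (P.gauged ε 0 u) = aeval (third P (π P.genA) (π P.genAs))
      (C (P.χ * bf (u ^ 2)) * (X - C (P.xw (P.q * u ^ 2)))) := by
  have h : P.gauged ε 0 u = P.K12 u := by simp [gauged]
  rw [h, map_mul, map_sub, aeval_X, aeval_C, aeval_C]
  simp only [K12, third, qComm, xw, map_smul, map_add, map_sub, map_mul, map_one,
    Algebra.algebraMap_eq_smul_one, smul_mul_assoc, one_mul]
  rw [mul_inv, inv_pow, neg_div, neg_smul, sub_neg_eq_add, mul_smul]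

lemma map_list_prod_aeval {R : Type*} [Ring R] [Algebra ℂ R] (π : R →ₐ[ℂ] Module.End ℂ V)
    (T : Module.End ℂ V) {M : ℕ} (x : Fin M → R) (s : Fin M → ℂ) (w : Fin M → ℂ)
    (hx : ∀ i, π (x i) = aeval T (C (s i) * (X - C (P.xw (w i))))) :
    π (List.ofFn x).prod = (∏ i, s i) • aeval T (rootPoly P w) := by
  rw [map_list_prod, List.map_ofFn]
  have : (π ∘ x) = fun i => aeval T (C (s i) * (X - C (P.xw (w i)))) := funext hx
  rw [this, ← map_smul, smul_eq_C_mul, rootPoly, map_prod, ← Finset.prod_mul_distrib,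
    ← List.prod_ofFn, map_list_prod, List.map_ofFn]
  rfl

/-- The scalar relating a dynamical operator at `β = 0` to a factor `X - x(u)`. -/
def ketScalar (P : Params) (ε : ℤˣ) (α u : ℂ) (m : ℤ) : ℂ :=
  -(((ε : ℤ) : ℂ)) * P.q ^ (-(ε : ℤ)) * u ^ (-(ε : ℤ)) / P.γ ε α 0 1 (m + 1) *
    (P.χ * bf (u ^ 2))

lemma betheKet_eq (π : P.AW →ₐ[ℂ] Module.End ℂ V) (ε : ℤˣ) (α : ℂ) (m₀ : ℤ) {M : ℕ}
    (u : Fin M → ℂ) (Ω : V) :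
    P.betheKet π ε α m₀ u Ω =
      (∏ i : Fin M, ketScalar P ε α (u i) (m₀ + 2 * ((M : ℤ) - 1 - (i : ℕ)))) •
        rootVec P (π P.genA) (π P.genAs) u Ω := by
  unfold betheKet stringB
  rw [map_list_prod_aeval (P := P) π (third P (π P.genA) (π P.genAs)) _
    (fun i : Fin M => ketScalar P ε α (u i) (m₀ + 2 * ((M : ℤ) - 1 - (i : ℕ))))
    (fun i => P.q * u i ^ 2)]
  · rfl
  · intro i
    rw [dynB, zero_mul, map_smul, map_gauged_zero, ← map_smul, smul_eq_C_mul, ← mul_assoc, ← C_mul]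
    rfl

/-- The scalar relating a dynamical operator at `α = 0` to a factor `X - x(v)`. -/
def braScalar (P : Params) (β v : ℂ) (m : ℤ) : ℂ :=
  P.q * v / (β * P.q ^ (m - 1)) * (P.χ * bf (v ^ 2))

lemma betheBra_eq (hP : P.IsGeneric) (π : P.AW →ₐ[ℂ] Module.End ℂ V) (β : ℂ) (m₀ : ℤ) {M : ℕ}
    (v : Fin M → ℂ) (Ω : Module.Dual ℂ V) :
    P.betheBra π (-1) β m₀ v Ω =
      (∏ i : Fin M, braScalar P β (v i) (m₀ + 2 * (((i : ℕ) : ℤ) + 1))) •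
        rootVec P.swap (π P.genAs).dualMap (π P.genA).dualMap v Ω := by
  have hγ : ∀ m : ℤ, P.γ (-1) 0 β 1 m = -(β * P.q ^ m) := by
    intro m; simp [γ]
  unfold betheBra stringC
  rw [map_list_prod_aeval (P := P) π (third P (π P.genA) (π P.genAs)) _
    (fun i : Fin M => braScalar P β (v i) (m₀ + 2 * (((i : ℕ) : ℤ) + 1)))
    (fun i => P.q * v i ^ 2)]
  · have := LinearMap.congr_fun (dualMap_aeval (third P (π P.genA) (π P.genAs))
      (rootPoly P fun i => P.q * v i ^ 2)) Ω
    rw [rootVec, third_swap_dual hP, LinearMap.comp_smul]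
    exact congrArg _ this
  · intro i
    rw [dynC, zero_mul, map_smul, map_gauged_zero, ← map_smul, smul_eq_C_mul, ← mul_assoc, ← C_mul,
      hγ]
    simp only [braScalar]
    congr 4
    simp [div_neg, neg_div]

lemma braScalar_ne_zero (hP : P.IsGeneric) {β v : ℂ} (hβ : β ≠ 0) (hv : v ≠ 0)
    (hv2 : bf (v ^ 2) ≠ 0) (m : ℤ) : braScalar P β v m ≠ 0 :=
  mul_ne_zero (div_ne_zero (mul_ne_zero hP.q_ne hv) (mul_ne_zero hβ (zpow_ne_zero _ hP.q_ne)))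
    (mul_ne_zero hP.χ_ne hv2)

lemma ketScalar_one (hP : P.IsGeneric) {α : ℂ} {m₀ : ℤ}
    (hα : (P.q ^ 2 - P.q⁻¹ ^ 2) * P.χ⁻¹ * α * P.cs * P.q ^ m₀ = 1) (u : ℂ) (k : ℤ) :
    ketScalar P 1 α u (m₀ + 2 * k) = P.q⁻¹ * u⁻¹ * bf (u ^ 2) *
      (P.cs * (P.q ^ (2 * k + 1))⁻¹ * (P.q ^ 2 - P.q⁻¹ ^ 2)) := by
  have hα0 : α ≠ 0 := by rintro rfl; simp at hα
  have hq := hP.q_ne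
  have hχ := hP.χ_ne
  have h1 : P.q ^ (m₀ + 2 * k + 1) = P.q ^ m₀ * P.q ^ (2 * k + 1) := by
    rw [← zpow_add₀ hq]; ring_nf
  have hγ : P.γ 1 α 0 1 (m₀ + 2 * k + 1) = -(α * (P.q ^ m₀ * P.q ^ (2 * k + 1))) := by
    rw [← h1]; simp [γ]
  have hx := zpow_ne_zero (2 * k + 1) hq
  have hy := zpow_ne_zero m₀ hq
  have hχ' : P.χ = (P.q ^ 2 - P.q⁻¹ ^ 2) * α * P.cs * P.q ^ m₀ := by
    field_simp at hα ⊢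
    linear_combination -hα
  unfold ketScalar
  rw [hγ, hχ']
  simp only [Units.val_one, Int.cast_one, zpow_neg, zpow_one]
  field_simp

lemma ketScalar_neg_one (hP : P.IsGeneric) {α : ℂ} {m₀ : ℤ}
    (hα : (P.q ^ 2 - P.q⁻¹ ^ 2) * P.χ⁻¹ * α * P.b * P.q ^ (-m₀) = -1) (u : ℂ) (k : ℤ) :
    ketScalar P (-1) α u (m₀ + 2 * k) = -(P.q * u * bf (u ^ 2)) *
      (P.b * P.q ^ (2 * k + 1) * (P.q ^ 2 - P.q⁻¹ ^ 2)) := by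
  have hα0 : α ≠ 0 := by rintro rfl; simp at hα
  have hq := hP.q_ne
  have hχ := hP.χ_ne
  have h1 : P.q ^ (-(m₀ + 2 * k + 1)) = P.q ^ (-m₀) * (P.q ^ (2 * k + 1))⁻¹ := by
    rw [← zpow_neg, ← zpow_add₀ hq]; ring_nf
  have hγ : P.γ (-1) α 0 1 (m₀ + 2 * k + 1) = α * (P.q ^ (-m₀) * (P.q ^ (2 * k + 1))⁻¹) := by
    rw [← h1]; simp [γ]
  have hx := zpow_ne_zero (2 * k + 1) hq
  have hy := zpow_ne_zero (-m₀) hq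
  have hχ' : P.χ = -((P.q ^ 2 - P.q⁻¹ ^ 2) * α * P.b * P.q ^ (-m₀)) := by
    generalize P.q ^ (-m₀) = y at *
    field_simp at hα ⊢
    linear_combination hα
  unfold ketScalar
  rw [hγ, hχ']
  simp only [Units.val_neg, Units.val_one, Int.cast_neg, Int.cast_one, neg_neg, zpow_one]
  generalize P.q ^ (-m₀) = y at *
  field_simp

end

/-! ### Bethe states as eigenvectors -/

section

variable {P : Params} {V : Type*} [AddCommGroup V] [Module ℂ V]
  {π : P.AW →ₐ[ℂ] Module.End ℂ V} {ket kets : Module.Basis (Fin (P.n + 1)) ℂ V}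
  {bra bras : Fin (P.n + 1) → Module.Dual ℂ V}

/-- A subspace stable under both generators is stable under the algebra. -/
lemma map_mem_of_invariant (π : P.AW →ₐ[ℂ] Module.End ℂ V) {W : Submodule ℂ V}
    (hA : ∀ w ∈ W, π P.genA w ∈ W) (hB : ∀ w ∈ W, π P.genAs w ∈ W) (x : P.AW) :
    ∀ w ∈ W, π x w ∈ W := by
  obtain ⟨y, rfl⟩ := RingQuot.mkAlgHom_surjective ℂ P.AWRel x
  induction y using FreeAlgebra.induction with
  | grade0 r =>
    intro w hw
    rw [AlgHom.commutes, AlgHom.commutes, Module.algebraMap_end_apply]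
    exact W.smul_mem r hw
  | grade1 i =>
    fin_cases i
    · exact hA
    · exact hB
  | mul a b ha hb =>
    intro w hw
    rw [map_mul, map_mul, Module.End.mul_apply]
    exact ha _ (hb _ hw)
  | add a b ha hb =>
    intro w hw
    rw [map_add, map_add, LinearMap.add_apply]
    exact W.add_mem (ha _ hw) (hb _ hw)

lemma leonardData (hP : P.IsGeneric) (hπ : P.IsIrreducible π)
    (hE : P.IsEigenData π ket kets bra bras) :
    LeonardData P (π P.genA) (π P.genAs) ket kets where
  dim := rfl
  pair := awPair_of_rep hP.q_ne π
  eigA := hE.ket_eigen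
  eigB := hE.kets_eigen
  irr W hA hB := hπ.2 W (map_mem_of_invariant π hA hB)
  normB := hE.ket_normal
  normA := hE.kets_normal

/-- The dynamical parameter decreases along a string of operators, which reverses the order of the
factors. -/
lemma prod_reflect {n : ℕ} (g : ℤ → ℂ) :
    ∏ i : Fin n, g ((n : ℤ) - 1 - (i : ℕ)) = ∏ i ∈ Finset.range n, g i := by
  rw [Fin.prod_univ_eq_prod_range (fun i => g ((n : ℤ) - 1 - (i : ℕ))) n,
    ← Finset.prod_range_reflect (fun i : ℕ => g i) n]
  refine Finset.prod_congr rfl fun i hi => ?_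
  have := Finset.mem_range.mp hi
  congr 1
  omega

/-- The powers of `q` from the dynamical parameters cancel those in the entries of the third
generator. -/
lemma coord_last_betheKet_plus (hP : P.IsGeneric)
    (h : LeonardData P (π P.genA) (π P.genAs) ket kets) {α : ℂ} {m₀ : ℤ}
    (hα : (P.q ^ 2 - P.q⁻¹ ^ 2) * P.χ⁻¹ * α * P.cs * P.q ^ m₀ = 1) (u : Fin P.n → ℂ) :
    kets.coord (Fin.last P.n) (P.betheKet π 1 α m₀ u (kets 0)) = (P.normPlus u)⁻¹ := by
  rw [betheKet_eq, map_smul, h.coord_last_rootVec_star hP, smul_eq_mul]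
  simp only [ketScalar_one hP hα]
  rw [Finset.prod_mul_distrib,
    prod_reflect fun k => P.cs * (P.q ^ (2 * k + 1))⁻¹ * (P.q ^ 2 - P.q⁻¹ ^ 2),
    mul_assoc, ← Finset.prod_mul_distrib, normPlus, ← Finset.prod_inv_distrib]
  simp only [inv_inv]
  rw [← Fin.prod_univ_eq_prod_range (fun i : ℕ => P.cs * (P.q ^ (2 * (i : ℤ) + 1))⁻¹ *
    (P.q ^ 2 - P.q⁻¹ ^ 2) * (P.ρ⁻¹ * (P.bs * P.q ^ (2 * (i : ℤ) + 1) *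
      (P.q ^ 2 - P.q⁻¹ ^ 2)) * P.coefA (i + 1))), ← Finset.prod_mul_distrib]
  refine Finset.prod_congr rfl fun i _ => ?_
  have hq := hP.q_ne
  have hx := zpow_ne_zero (2 * ((i : ℕ) : ℤ) + 1) hq
  have hD := hP.q_sq_sub_inv_ne
  have hbs := hP.bs_ne
  have hcs := hP.cs_ne
  unfold ρ
  rw [hP.bc_eq]
  generalize P.q ^ 2 - P.q⁻¹ ^ 2 = D at *
  field_simp

lemma coord_last_betheKet_minus (hP : P.IsGeneric)
    (h : LeonardData P (π P.genA) (π P.genAs) ket kets) {α : ℂ} {m₀ : ℤ}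
    (hα : (P.q ^ 2 - P.q⁻¹ ^ 2) * P.χ⁻¹ * α * P.b * P.q ^ (-m₀) = -1) (w : Fin P.n → ℂ) :
    ket.coord (Fin.last P.n) (P.betheKet π (-1) α m₀ w (ket 0)) = (P.normMinus w)⁻¹ := by
  rw [betheKet_eq, map_smul, h.coord_last_rootVec hP, smul_eq_mul]
  simp only [ketScalar_neg_one hP hα]
  rw [Finset.prod_mul_distrib,
    prod_reflect fun k => P.b * P.q ^ (2 * k + 1) * (P.q ^ 2 - P.q⁻¹ ^ 2),
    mul_assoc, ← Finset.prod_mul_distrib, normMinus, ← Finset.prod_inv_distrib]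
  simp only [inv_inv]
  rw [← Fin.prod_univ_eq_prod_range (fun i : ℕ => P.b * P.q ^ (2 * (i : ℤ) + 1) *
    (P.q ^ 2 - P.q⁻¹ ^ 2) * (P.ρ⁻¹ * (P.c * (P.q ^ (2 * (i : ℤ) + 1))⁻¹ *
      (P.q ^ 2 - P.q⁻¹ ^ 2)) * P.coefAs (i + 1))), ← Finset.prod_mul_distrib]
  refine Finset.prod_congr rfl fun i _ => ?_
  have hq := hP.q_ne
  have hx := zpow_ne_zero (2 * ((i : ℕ) : ℤ) + 1) hq
  have hD := hP.q_sq_sub_inv_ne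
  have hb := hP.b_ne
  have hc := hP.c_ne
  unfold ρ
  generalize P.q ^ 2 - P.q⁻¹ ^ 2 = D at *
  field_simp

lemma normPlus_ne_zero (hP : P.IsGeneric)
    (h : LeonardData P (π P.genA) (π P.genAs) ket kets) {u : Fin P.n → ℂ}
    (hu : P.IsAdmissible u) : P.normPlus u ≠ 0 :=
  Finset.prod_ne_zero_iff.mpr fun i _ => inv_ne_zero (mul_ne_zero (mul_ne_zero
    (neg_ne_zero.mpr (mul_ne_zero (inv_ne_zero hP.q_ne) (inv_ne_zero (hu.ne_zero i))))
    (hu.bf_sq_ne i)) ((h.swap hP).coefAs_ne_zero hP.swap i))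

lemma normMinus_ne_zero (hP : P.IsGeneric)
    (h : LeonardData P (π P.genA) (π P.genAs) ket kets) {w : Fin P.n → ℂ}
    (hw : P.IsAdmissible w) : P.normMinus w ≠ 0 :=
  Finset.prod_ne_zero_iff.mpr fun i _ => inv_ne_zero (mul_ne_zero (mul_ne_zero
    (mul_ne_zero hP.q_ne (hw.ne_zero i)) (hw.bf_sq_ne i)) (h.coefAs_ne_zero hP i))

/-- The Bethe state on an inhomogeneous solution for `θ_M` is `|θ_M⟩` up to the normalization. -/
lemma betheKet_plus_eq (hP : P.IsGeneric)
    (h : LeonardData P (π P.genA) (π P.genAs) ket kets) {α : ℂ} {m₀ : ℤ}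
    (hα : (P.q ^ 2 - P.q⁻¹ ^ 2) * P.χ⁻¹ * α * P.cs * P.q ^ m₀ = 1) {M : Fin (P.n + 1)}
    {u : Fin P.n → ℂ} (hu : P.IsInhomPlus M u) :
    P.normInhom ket kets M u ≠ 0 ∧
      P.betheKet π 1 α m₀ u (kets 0) = (P.normInhom ket kets M u)⁻¹ • ket M := by
  have heig : π P.genA (P.betheKet π 1 α m₀ u (kets 0)) =
      P.thZ (M : ℕ) • P.betheKet π 1 α m₀ u (kets 0) := by
    have := h.pair.inhomPlus_eigen hP (h.eigB 0)
      (fun v hv => h.not_eigenB hP (Or.inl rfl) hv)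
      (fun v hv => h.not_eigenB hP (Or.inr rfl) hv) hu
    rw [betheKet_eq, map_smul, this, smul_comm]; rfl
  have hK := h.eigen_eq hP heig
  have hlast := coord_last_betheKet_plus hP h hα u
  have hN := normPlus_ne_zero hP h hu.1
  rw [hK, map_smul, smul_eq_mul] at hlast
  set x := ket.coord M (P.betheKet π 1 α m₀ u (kets 0)) with hx
  have hmul : P.normInhom ket kets M u * x = 1 := by
    unfold normInhom
    rw [Module.Basis.toMatrix_apply, ← Module.Basis.coord_apply, mul_assoc, mul_comm _ x, hlast,
      mul_inv_cancel₀ hN]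
  refine ⟨left_ne_zero_of_mul_eq_one hmul, ?_⟩
  rw [← eq_inv_of_mul_eq_one_right hmul]
  exact hK

/-- The Bethe state on an inhomogeneous solution for `θ*_N` is `|θ*_N⟩` up to the
normalization. -/
lemma betheKet_minus_eq (hP : P.IsGeneric)
    (h : LeonardData P (π P.genA) (π P.genAs) ket kets) {α : ℂ} {m₀ : ℤ}
    (hα : (P.q ^ 2 - P.q⁻¹ ^ 2) * P.χ⁻¹ * α * P.b * P.q ^ (-m₀) = -1) {N : Fin (P.n + 1)}
    {w : Fin P.n → ℂ} (hw : P.IsInhomMinus N w) :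
    P.normInhomStar ket kets N w ≠ 0 ∧
      P.betheKet π (-1) α m₀ w (ket 0) = (P.normInhomStar ket kets N w)⁻¹ • kets N := by
  have hs := h.swap hP
  have heig : π P.genAs (P.betheKet π (-1) α m₀ w (ket 0)) =
      P.swap.thZ (N : ℕ) • P.betheKet π (-1) α m₀ w (ket 0) := by
    have hne : ∀ k : ℤ, k = -1 ∨ k = P.n + 1 → ∀ v, π P.genA v = P.thZ k • v → v = 0 :=
      fun k hk v hv => hs.not_eigenB hP.swap hk (by rwa [swap_swap])
    have := h.pair.inhomMinus_eigen hP (h.eigA 0) (hne _ (Or.inl rfl)) (hne _ (Or.inr rfl)) hw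
    rw [betheKet_eq, map_smul, this, smul_comm]; rfl
  have hK := hs.eigen_eq hP.swap heig
  have hlast := coord_last_betheKet_minus hP h hα w
  have hN := normMinus_ne_zero hP h hw.1
  rw [hK, map_smul, smul_eq_mul] at hlast
  set x := kets.coord N (P.betheKet π (-1) α m₀ w (ket 0)) with hx
  have hmul : P.normInhomStar ket kets N w * x = 1 := by
    unfold normInhomStar
    rw [Module.Basis.toMatrix_apply, ← Module.Basis.coord_apply, mul_assoc, mul_comm _ x, hlast,
      mul_inv_cancel₀ hN]
  refine ⟨left_ne_zero_of_mul_eq_one hmul, ?_⟩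
  rw [← eq_inv_of_mul_eq_one_right hmul]
  exact hK

lemma LeonardData.exists_smul_coord (hP : P.IsGeneric) {n : ℕ} {A B : Module.End ℂ V}
    {e e' : Module.Basis (Fin (n + 1)) ℂ V} (h : LeonardData P A B e e')
    {g : Module.Dual ℂ V} {M : Fin (n + 1)} (hg0 : g ≠ 0)
    (hg : A.dualMap g = P.thZ (M : ℕ) • g) :
    ∃ d : ℂ, d ≠ 0 ∧ g = d • e.coord M := by
  have := h.dual_eigen_eq hP hg
  refine ⟨_, ?_, this⟩
  intro h0
  rw [h0, zero_smul] at this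
  exact hg0 this

lemma betheBra_coord_ne_zero (hP : P.IsGeneric)
    (h : LeonardData P (π P.genA) (π P.genAs) ket kets) {β : ℂ} {m₀ : ℤ} (hβ : β ≠ 0)
    {d : ℂ} (hd : d ≠ 0) {m : Fin (P.n + 1)} {v : Fin m → ℂ} (hv : P.IsAdmissible v) :
    P.betheBra π (-1) β m₀ v (d • ket.coord 0) ≠ 0 := by
  intro h0
  have := LinearMap.congr_fun h0 (ket m)
  rw [betheBra_eq hP, rootVec, map_smul, LinearMap.smul_apply, LinearMap.smul_apply,
    LinearMap.zero_apply] at this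
  refine smul_ne_zero ?_ (smul_ne_zero hd (h.dual_rootVec_ne_zero hP v)) this
  exact Finset.prod_ne_zero_iff.mpr fun i _ =>
    braScalar_ne_zero hP hβ (hv.ne_zero i) (hv.bf_sq_ne i) _

/-- The dual Bethe state on a homogeneous solution with `M` roots is `⟨θ_M|` up to a scalar. -/
lemma betheBra_hom_eq (hP : P.IsGeneric)
    (h : LeonardData P (π P.genA) (π P.genAs) ket kets) {β : ℂ} {m₀ : ℤ} (hβ : β ≠ 0)
    {d : ℂ} (hd : d ≠ 0) {M : Fin (P.n + 1)} {v : Fin M → ℂ} (hv : P.IsHomMinus v) :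
    ∃ d' : ℂ, d' ≠ 0 ∧ P.betheBra π (-1) β m₀ v (d • ket.coord 0) = d' • ket.coord M := by
  refine h.exists_smul_coord hP (betheBra_coord_ne_zero hP h hβ hd hv.1) ?_
  have := (h.pair.dual.swap hP).homDual_eigen hP (Ω := d • ket.coord 0) (u := v)
    (by rw [map_smul, h.coord_eigen_dual, smul_comm]; rfl)
    (fun f hf => h.not_eigen_dual hP (Or.inl rfl) hf) hv
  rw [betheBra_eq hP, map_smul, this, smul_comm]
  rfl

/-- The dual Bethe state on a dual inhomogeneous solution for `θ*_N` is `⟨θ*_N|` up to a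
scalar. -/
lemma betheBra_inhom_eq (hP : P.IsGeneric)
    (h : LeonardData P (π P.genA) (π P.genAs) ket kets) {β : ℂ} {m₀ : ℤ} (hβ : β ≠ 0)
    {d : ℂ} (hd : d ≠ 0) {N : Fin (P.n + 1)} {y : Fin P.n → ℂ} (hy : P.IsDualInhomMinus N y) :
    ∃ d' : ℂ, d' ≠ 0 ∧ P.betheBra π (-1) β m₀ y (d • ket.coord 0) = d' • kets.coord N := by
  refine (h.swap hP).exists_smul_coord hP.swap
    (betheBra_coord_ne_zero (m := Fin.last P.n) hP h hβ hd hy.1) ?_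
  have := (h.pair.dual.swap hP).inhomDual_eigen hP (Ω := d • ket.coord 0) (u := y)
    (by rw [map_smul, h.coord_eigen_dual, smul_comm]; rfl)
    (fun f hf => h.not_eigen_dual hP (Or.inl rfl) hf)
    (fun f hf => h.not_eigen_dual hP (Or.inr rfl) hf) hy
  rw [betheBra_eq hP, map_smul, this, smul_comm]
  rfl

end

end QRacah

end

theorem mainTheorem2 (P : QRacah.Params) (hP : P.IsGeneric)
    {V : Type*} [AddCommGroup V] [Module ℂ V]
    (π : P.AW →ₐ[ℂ] Module.End ℂ V) (hπ : P.IsIrreducible π)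
    (ket kets : Module.Basis (Fin (P.n + 1)) ℂ V)
    (bra bras : Fin (P.n + 1) → Module.Dual ℂ V)
    (hE : P.IsEigenData π ket kets bra bras)
    (m₀ : ℤ) (α₁ α₂ β₁ : ℂ)
    (hα₁ : (P.q ^ 2 - P.q⁻¹ ^ 2) * P.χ⁻¹ * α₁ * P.b * P.q ^ (-m₀) = -1)
    (hα₂ : (P.q ^ 2 - P.q⁻¹ ^ 2) * P.χ⁻¹ * α₂ * P.cs * P.q ^ m₀ = 1)
    (hβ₁ : (P.q ^ 2 - P.q⁻¹ ^ 2) * P.χ⁻¹ * β₁ * P.c * P.q ^ (m₀ - 2) = -1)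
    (M N : Fin (P.n + 1)) :
    -- first variant: `v̄ = S_-^{M(h)}`, `w̄ = S_-^{*N(i)}`, `ū = S_+^{M(i)}`
    (∀ (v : Fin (M : ℕ) → ℂ) (w u : Fin P.n → ℂ),
      P.IsHomMinus v → P.IsInhomMinus N w → P.IsInhomPlus M u →
        P.normInhom ket kets M u ≠ 0 ∧
        bra 0 (P.betheKet π (-1) α₁ m₀ w (ket 0)) ≠ 0 ∧
        P.betheBra π (-1) β₁ m₀ v (bra 0) (P.betheKet π 1 α₂ m₀ u (kets 0)) ≠ 0 ∧
        P.qRacah M N =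
          (P.normInhom ket kets M u)⁻¹ *
            (P.betheBra π (-1) β₁ m₀ v (bra 0) (P.betheKet π (-1) α₁ m₀ w (ket 0)) /
              bra 0 (P.betheKet π (-1) α₁ m₀ w (ket 0))) *
            (bra 0 (ket 0) /
              P.betheBra π (-1) β₁ m₀ v (bra 0) (P.betheKet π 1 α₂ m₀ u (kets 0)))) ∧
    -- second variant: `ū = S_+^{M(i)}`, `ȳ = S_-^{*N(i)}`, `ȳ' = dS_-^{*N(i)}`
    (∀ u y y' : Fin P.n → ℂ,
      P.IsInhomPlus M u → P.IsInhomMinus N y → P.IsDualInhomMinus N y' →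
        P.normInhomStar ket kets N y ≠ 0 ∧
        bras 0 (P.betheKet π 1 α₂ m₀ u (kets 0)) ≠ 0 ∧
        P.betheBra π (-1) β₁ m₀ y' (bra 0) (P.betheKet π (-1) α₁ m₀ y (ket 0)) ≠ 0 ∧
        P.qRacah M N =
          (P.normInhomStar ket kets N y)⁻¹ *
            (P.betheBra π (-1) β₁ m₀ y' (bra 0) (P.betheKet π 1 α₂ m₀ u (kets 0)) /
              bras 0 (P.betheKet π 1 α₂ m₀ u (kets 0))) *
            (bras 0 (kets 0) /
              P.betheBra π (-1) β₁ m₀ y' (bra 0) (P.betheKet π (-1) α₁ m₀ y (ket 0)))) := by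
  have h := QRacah.leonardData hP hπ hE
  have hs := h.swap hP
  have hβ : β₁ ≠ 0 := by rintro rfl; simp at hβ₁
  obtain ⟨d, hd, hbra⟩ := h.exists_smul_coord hP (hE.bra_ne 0) (hE.bra_eigen 0)
  obtain ⟨ds, hds, hbras⟩ := hs.exists_smul_coord hP.swap (hE.bras_ne 0) (hE.bras_eigen 0)
  have hself : ∀ k, ket.coord k (ket k) = 1 := fun k => by
    rw [ket.coord_apply, ket.repr_self, Finsupp.single_eq_same]
  have hselfs : ∀ k, kets.coord k (kets k) = 1 := fun k => by
    rw [kets.coord_apply, kets.repr_self, Finsupp.single_eq_same]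
  refine ⟨fun v w u hv hw hu => ?_, fun u y y' hu hy hy' => ?_⟩
  · obtain ⟨hx0, hx⟩ := QRacah.betheKet_plus_eq hP h hα₂ hu
    obtain ⟨hy0, hy⟩ := QRacah.betheKet_minus_eq hP h hα₁ hw
    obtain ⟨d', hd', hb⟩ := QRacah.betheBra_hom_eq (m₀ := m₀) hP h hβ hd hv
    have hc := h.coord_zero_ne hP (h.eigB N) (kets.ne_zero N)
    rw [hx, hy, hbra, hb]
    simp only [map_smul, LinearMap.smul_apply, smul_eq_mul, hself, mul_one,
      h.coord_eq_qRacah hP M N]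
    refine ⟨hx0, by
      simp only [ne_eq, mul_eq_zero, inv_eq_zero, hy0, hd, hc, or_self, not_false_eq_true], by
      simp only [ne_eq, mul_eq_zero, inv_eq_zero, hx0, hd', or_self, not_false_eq_true], ?_⟩
    field_simp
  · obtain ⟨hx0, hx⟩ := QRacah.betheKet_plus_eq hP h hα₂ hu
    obtain ⟨hy0, hyk⟩ := QRacah.betheKet_minus_eq hP h hα₁ hy
    obtain ⟨d', hd', hb⟩ := QRacah.betheBra_inhom_eq (m₀ := m₀) hP h hβ hd hy'
    have hc := hs.coord_zero_ne hP.swap (hs.eigB M) (ket.ne_zero M)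
    rw [hx, hyk, hbra, hbras, hb]
    simp only [map_smul, LinearMap.smul_apply, smul_eq_mul, hselfs, mul_one,
      hs.coord_eq_qRacah hP.swap N M, QRacah.Params.qRacah_swap]
    refine ⟨hy0, by
      simp only [ne_eq, mul_eq_zero, inv_eq_zero, hx0, hds, hc, or_self, not_false_eq_true], by
      simp only [ne_eq, mul_eq_zero, inv_eq_zero, hy0, hd', or_self, not_false_eq_true], ?_⟩
    field_simp
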